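/- Let $n\ge 2$ and $0\le r\le n-1$. Consider $\mathbb H^n\times\mathbb R$, where $\mathbb H^n$ is the ball model $\{x\in\mathbb R^n:|x|<1\}$ with the metric $4|dx|^2/(1-|x|^2)^2$ and $\mathbb H^n\times\mathbb R$ has the product metric. For an immersed hypersurface with principal curvatures $k_1,\dots,k_n$ let $\binom{n}{r+1}H_{r+1}=\sum_{i_1<\dots<i_{r+1}}k_{i_1}\cdots k_{i_{r+1}}$; the hypersurface is called $r$-minimal if $H_{r+1}=0$. Invariance by rotation means invariance under the rotations about the axis $\{0\}\times\mathbb R$. The asymptotic boundary of a subset of $\mathbb H^n\times\mathbb R$ is the set of its limit points in $\partial_\infty\mathbb H^n\times\mathbb R=S^{n-1}\times\mathbb R$ for the Euclidean topology. Apart from the slices $\mathbb H^n\times\{\tau\}$, the connected complete immersed $r$-minimal hypersurfaces of $\mathbb H^n\times\mathbb R$ invariant by rotation are, as subsets of $\mathbb H^n\times\mathbb R$, the following. a) If $n=r+1$: the right cylinders $S\times\mathbb R$ over the geodesic spheres $S\subset\mathbb H^n$ of dimension $n-1$ centred at $0$. Each of these cylinders is a connected complete embedded $r$-minimal hypersurface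 invariant by rotation. b) If $r+1<n$: up to vertical translation, the members of a one-parameter family $\{\mathcal M_a(r)\}_{a>0}$ with the following properties. For each $a>0$ there are $L(a)>0$ and a smooth function $f_a:(-L(a),L(a))\to(0,\infty)$ such that $$\mathcal M_a(r)=\{(\tanh(f_a(t)/2)\,\zeta,\,t): |t|<L(a),\ \zeta\in S^{n-1}\};$$ the curve $\{(\rho,t)=(f_a(t),t):|t|<L(a)\}$ is its generating curve. Each $\mathcal M_a(r)$ is a connected complete embedded $r$-minimal hypersurface invariant by rotation, is homeomorphic to the annulus $S^{n-1}\times\mathbb R$, and is symmetric with respect to the slice $t=0$. Its distance to the rotation axis is $a$, and this distance is attained exactly at the points of its neck $\mathcal M_a(r)\cap\{t=0\}\ne\emptyset$. Its asymptotic boundary consists of the two horizontal circles $S^{n-1}\times\{L(a)\}$ and $S^{n-1}\times\{-L(a)\}$, whose vertical distance $2L(a)$ is a strictly increasing function of $a\in(0,\infty)$ with range exactly $\left(0,\frac{(r+1)\pi}{n-r-1}\right)$. If $a\ne b$, the generating curves of $\mathcal M_a(r)$ and $\mathcal M_b(r)$ meet in exactly two points, which are of the form $(\rho,t)$ and $(\rho,-t)$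 with $t>0$. -/

import Mathlib

open Set Filter Topology
open scoped Manifold ContDiff ENNReal

noncomputable section

/-- The vector space `ℝⁿ × ℝ` with coordinates `(x, t)`. The product `ℍⁿ × ℝ` is its open subset
`‖x‖ < 1` (ball model of `ℍⁿ`) with the Riemannian metric `hypMetric`. -/
abbrev Amb (n : ℕ) : Type := EuclideanSpace ℝ (Fin n) × ℝ

/-- The open set of `ℝⁿ × ℝ` underlying `ℍⁿ × ℝ`. -/
def hypProd (n : ℕ) : Set (Amb n) := {p | ‖p.1‖ < 1}

/-- The product metric `4 |dx|² / (1 - |x|²)² + dt²` of `ℍⁿ × ℝ` at the point `p`. -/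
def hypMetric {n : ℕ} (p u v : Amb n) : ℝ :=
  (2 / (1 - ‖p.1‖ ^ 2)) ^ 2 * inner ℝ u.1 v.1 + u.2 * v.2

/-- Christoffel symbols of the first kind of `hypMetric`, that is, `⟨∇_u v, w⟩` at `p` for the
Levi-Civita connection and constant vector fields `u, v, w` (Koszul formula). -/
def christoffel {n : ℕ} (p u v w : Amb n) : ℝ :=
  (fderiv ℝ (fun y => hypMetric y v w) p u + fderiv ℝ (fun y => hypMetric y u w) p v
    - fderiv ℝ (fun y => hypMetric y u v) p w) / 2

/-- Length, in `ℍⁿ × ℝ`, of a `C¹` curve defined on `[0, 1]`. -/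
def curveLength {n : ℕ} (γ : ℝ → Amb n) : ℝ :=
  ∫ s in (0 : ℝ)..1, √(hypMetric (γ s) (derivWithin γ (Icc 0 1) s) (derivWithin γ (Icc 0 1) s))

/-- Riemannian distance in `ℍⁿ × ℝ` from the vertical axis `{0} × ℝ` to `p`. -/
def axisDist {n : ℕ} (p : Amb n) : ℝ≥0∞ :=
  ⨅ γ : {γ : ℝ → Amb n // ContDiffOn ℝ 1 γ (Icc 0 1) ∧ (∀ s ∈ Icc (0 : ℝ) 1, γ s ∈ hypProd n) ∧
    (γ 0).1 = 0 ∧ γ 1 = p}, ENNReal.ofReal (curveLength γ.1)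

section Hypersurface

attribute [local instance 2000] chartedSpaceSelf

variable {n : ℕ} {M : Type*} [TopologicalSpace M] [ChartedSpace (EuclideanSpace ℝ (Fin n)) M]

/-- `X : M → ℍⁿ × ℝ` is a smooth immersion of the `n`-manifold `M`. -/
structure IsImmersedHypersurface (X : M → Amb n) : Prop where
  contMDiff : ContMDiff (𝓡 n) 𝓘(ℝ, Amb n) ∞ X
  mem_hypProd : ∀ p, X p ∈ hypProd n
  injective_mfderiv : ∀ p, Function.Injective (mfderiv (𝓡 n) 𝓘(ℝ, Amb n) X p)

/-- The immersion `X` read in the preferred chart at `p`. -/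
def chartRep (X : M → Amb n) (p : M) : EuclideanSpace ℝ (Fin n) → Amb n :=
  X ∘ (chartAt (EuclideanSpace ℝ (Fin n)) p).symm

/-- The differential of `X` at `p`, in the preferred chart at `p`. -/
def chartDiff (X : M → Amb n) (p : M) : EuclideanSpace ℝ (Fin n) →L[ℝ] Amb n :=
  fderiv ℝ (chartRep X p) (chartAt (EuclideanSpace ℝ (Fin n)) p p)

/-- `N` is a unit normal vector to `X` at `p`. -/
def IsUnitNormal (X : M → Amb n) (p : M) (N : Amb n) : Prop :=
  hypMetric (X p) N N = 1 ∧ ∀ a, hypMetric (X p) N (chartDiff X p a) = 0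

/-- The second fundamental form of `X` at `p` relative to the unit normal `N`: the `N`-component
of the ambient covariant derivative of `dX b` in the direction `dX a`. -/
def secondForm (X : M → Amb n) (p : M) (N : Amb n) (a b : EuclideanSpace ℝ (Fin n)) : ℝ :=
  hypMetric (X p)
      (fderiv ℝ (fderiv ℝ (chartRep X p)) (chartAt (EuclideanSpace ℝ (Fin n)) p p) a b) N
    + christoffel (X p) (chartDiff X p a) (chartDiff X p b) N

/-- `A` is the linear operator associated to the second fundamental form by means of the
induced metric. -/
def IsShapeOperator (X : M → Amb n) (p : M) (N : Amb n)
    (A : EuclideanSpace ℝ (Fin n) →ₗ[ℝ] EuclideanSpace ℝ (Fin n)) : Prop :=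
  ∀ a b, hypMetric (X p) (chartDiff X p (A a)) (chartDiff X p b) = secondForm X p N a b

/-- The mean curvature of order `j`: `binom n j * H_j` is the `j`-th elementary symmetric function
of the eigenvalues of the shape operator `A`, counted with multiplicity. -/
def meanCurv (j : ℕ) (A : EuclideanSpace ℝ (Fin n) →ₗ[ℝ] EuclideanSpace ℝ (Fin n)) : ℝ :=
  A.charpoly.roots.esymm j / (n.choose j : ℝ)

/-- `X` is `r`-minimal: `H_{r+1} = 0` everywhere. For an immersion there are exactly two unit
normals at each point, each with exactly one shape operator, and the condition does not depend
on the choice of the unit normal. -/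
def IsRMinimal (r : ℕ) (X : M → Amb n) : Prop :=
  ∀ p N A, IsUnitNormal X p N → IsShapeOperator X p N A → meanCurv (r + 1) A = 0

/-- The distance of the metric induced by `X` on `M`: the infimum of the lengths of `C¹` paths. -/
def inducedDist (X : M → Amb n) (p q : M) : ℝ≥0∞ :=
  ⨅ c : {c : ℝ → M // ContMDiffOn 𝓘(ℝ, ℝ) (𝓡 n) 1 c (Icc 0 1) ∧ c 0 = p ∧ c 1 = q},
    ENNReal.ofReal (curveLength (X ∘ c.1))

/-- `M` with the metric induced by `X` is complete: Cauchy sequences converge. -/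
def IsCompleteHypersurface (X : M → Amb n) : Prop :=
  ∀ u : ℕ → M,
    (∀ ε : ℝ≥0∞, 0 < ε → ∃ k, ∀ i ≥ k, ∀ j ≥ k, inducedDist X (u i) (u j) < ε) →
      ∃ p, Tendsto u atTop (𝓝 p)

/-- A subset of `ℍⁿ × ℝ` is invariant by rotation about the axis `{0} × ℝ`. -/
def IsRotationInvariant (S : Set (Amb n)) : Prop :=
  ∀ A : EuclideanSpace ℝ (Fin n) ≃ₗᵢ[ℝ] EuclideanSpace ℝ (Fin n),
    LinearMap.det (A : EuclideanSpace ℝ (Fin n) →ₗ[ℝ] EuclideanSpace ℝ (Fin n)) = 1 →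
      ∀ p ∈ S, (A p.1, p.2) ∈ S

/-- `X` is a complete immersed `r`-minimal hypersurface of `ℍⁿ × ℝ` invariant by rotation. -/
structure IsCompleteRotationalRMinimal (r : ℕ) (X : M → Amb n) : Prop where
  immersed : IsImmersedHypersurface X
  complete : IsCompleteHypersurface X
  rMinimal : IsRMinimal r X
  rotational : IsRotationInvariant (range X)

end Hypersurface

/-- The set `S` is a connected, complete, embedded `r`-minimal hypersurface of `ℍⁿ × ℝ` invariant
by rotation. -/
def IsEmbeddedCompleteRotationalRMinimal {n : ℕ} (r : ℕ) (S : Set (Amb n)) : Prop :=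
  ∃ (M : Type) (_ : TopologicalSpace M) (_ : ChartedSpace (EuclideanSpace ℝ (Fin n)) M)
    (_ : IsManifold (𝓡 n) ∞ M) (_ : T2Space M) (_ : SecondCountableTopology M)
    (_ : ConnectedSpace M) (X : M → Amb n),
    IsCompleteRotationalRMinimal r X ∧ IsEmbedding X ∧ range X = S

/-- The slice `ℍⁿ × {τ}`. -/
def slice (n : ℕ) (τ : ℝ) : Set (Amb n) := {p | p ∈ hypProd n ∧ p.2 = τ}

/-- The right cylinder over the geodesic sphere of `ℍⁿ` of centre `0` and hyperbolic radius `R`. -/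
def cylinder (n : ℕ) (R : ℝ) : Set (Amb n) := {p | ‖p.1‖ = Real.tanh (R / 2)}

/-- The rotational hypersurface `{(tanh (f t / 2) ζ, t) : t ∈ I, |ζ| = 1}`. -/
def rotHypersurface (n : ℕ) (I : Set ℝ) (f : ℝ → ℝ) : Set (Amb n) :=
  {p | p.2 ∈ I ∧ ∃ ζ : EuclideanSpace ℝ (Fin n), ‖ζ‖ = 1 ∧ p.1 = Real.tanh (f p.2 / 2) • ζ}

/-- Its generating curve, in the coordinates `(ρ, t)`, `ρ` being the distance to the axis. -/
def generatingCurve (I : Set ℝ) (f : ℝ → ℝ) : Set (ℝ × ℝ) := {z | z.2 ∈ I ∧ z.1 = f z.2}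

/-- The image of `S` under the vertical translation by `τ`. -/
def verticalTranslate {n : ℕ} (τ : ℝ) (S : Set (Amb n)) : Set (Amb n) :=
  (fun p => (p.1, p.2 + τ)) '' S

/-- The asymptotic boundary of `S` : its limit points in `∂∞ℍⁿ × ℝ = Sⁿ⁻¹ × ℝ`, for the Euclidean
topology. -/
def asymptoticBoundary {n : ℕ} (S : Set (Amb n)) : Set (Amb n) := {p | ‖p.1‖ = 1 ∧ p ∈ closure S}

end

/-! Let `ρ` be the hyperbolic distance to the axis. The image of the immersion is rotation invariant
and has Hausdorff dimension at most `n` in an ambient space of dimension `n + 1`. Hence the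
differentials of `‖x‖²` and `t` are dependent along the immersion: otherwise the rotations would
sweep out an open set (`IsRotationInvariant.rank_le_one`). So off the axis the unit normal is `C ∂ρ
+ β ∂t` with `C² + β² = 1`. Differentiating it (`IsRadialNormalField.structure_equations`) gives the
principal curvatures `-C coth ρ`, `n - 1` times, and one meridian curvature `k`. The condition
`H_{r+1} = 0` reads `C^r ((r+1) k sinh ρ - (n-r-1) C cosh ρ) = 0`.

It follows that `C^{2(r+1)} (sinh ρ)^{2(n-r-1)}` is locally constant off the axis. On approaching
the axis `C²`, the squared gradient of the height, tends to zero, so a nonzero value of this first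
integral keeps the hypersurface off the axis (`height_const_or_ne`). If the value is zero
everywhere, the height is constant and completeness gives a slice. Otherwise `C` never vanishes, and
the angle `ψ` of the meridian with the vertical satisfies `dψ = (n-r-1)/(r+1) coth ρ dt` and `dρ =
tan ψ dt` (`exists_evolution`).

If `n = r + 1`, then `ψ` is constant: either `ρ` is constant, a cylinder, or the hypersurface is a
cone, whose generators reach the axis in finite length, against completeness. If `r + 1 < n`, put `P
= (r+1)/(n-r-1)`. Then `sinh ρ cos^P ψ` is a constant `s` and `t = τ + P ∫₀^ψ s/√(cos^{2P} u + s²)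
du`, which places the image in a translate of the catenoid with neck radius `arsinh s`. In each case
the whole model is covered, because paths of bounded speed lift in a complete hypersurface
(`exists_apply_eq_endpoint`).

Taking the angle as parameter turns the improper integral for the half height into a proper one over
`[0, π/2]`, increasing in `s`, with limits `0` and `P π/2`. Two generating curves cross once above
the neck because at each crossing there the one with the smaller neck is flatter in the sense that
its distance to the axis grows faster (`exists_unique_crossing`).

Conversely, a profile `f` with `(r+1) f'' = (n-r-1) coth f (1 + f'²)` generates an `r`-minimal
hypersurface. It is complete when it is closed in `ℍⁿ × ℝ`, because the Euclidean position and the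
logarithm of the conformal factor are Lipschitz for the induced distance. -/

/-! ### The ball metric and its Christoffel symbols. -/

/-- The conformal factor of the ball model. -/
noncomputable def conf {n : ℕ} (x : EuclideanSpace ℝ (Fin n)) : ℝ := 2 / (1 - ‖x‖ ^ 2)

theorem one_sub_norm_sq_pos {n : ℕ} {x : EuclideanSpace ℝ (Fin n)} (hx : ‖x‖ < 1) :
    0 < 1 - ‖x‖ ^ 2 := by
  nlinarith [norm_nonneg x]

theorem conf_pos {n : ℕ} {x : EuclideanSpace ℝ (Fin n)} (hx : ‖x‖ < 1) : 0 < conf x :=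
  div_pos two_pos (one_sub_norm_sq_pos hx)

theorem two_le_conf {n : ℕ} {x : EuclideanSpace ℝ (Fin n)} (hx : ‖x‖ < 1) : 2 ≤ conf x := by
  rw [conf, le_div_iff₀ (one_sub_norm_sq_pos hx)]
  nlinarith [sq_nonneg ‖x‖]

theorem conf_mul {n : ℕ} {x : EuclideanSpace ℝ (Fin n)} (hx : ‖x‖ < 1) :
    conf x * (1 - ‖x‖ ^ 2) = 2 := by
  rw [conf, div_mul_cancel₀ _ (one_sub_norm_sq_pos hx).ne']

theorem hypMetric_eq {n : ℕ} (p u v : Amb n) :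
    hypMetric p u v = conf p.1 ^ 2 * inner ℝ u.1 v.1 + u.2 * v.2 := rfl

theorem hypMetric_self {n : ℕ} (p u : Amb n) :
    hypMetric p u u = conf p.1 ^ 2 * ‖u.1‖ ^ 2 + u.2 ^ 2 := by
  rw [hypMetric_eq, real_inner_self_eq_norm_sq, sq u.2]

theorem hypMetric_comm {n : ℕ} (p u v : Amb n) : hypMetric p u v = hypMetric p v u := by
  rw [hypMetric_eq, hypMetric_eq, real_inner_comm, mul_comm u.2]

theorem hypMetric_add_left {n : ℕ} (p u v w : Amb n) :
    hypMetric p (u + v) w = hypMetric p u w + hypMetric p v w := by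
  simp only [hypMetric_eq, Prod.fst_add, Prod.snd_add, inner_add_left]; ring

theorem hypMetric_smul_left {n : ℕ} (p u w : Amb n) (c : ℝ) :
    hypMetric p (c • u) w = c * hypMetric p u w := by
  simp only [hypMetric_eq, Prod.smul_fst, Prod.smul_snd, real_inner_smul_left, smul_eq_mul]; ring

theorem hypMetric_self_eq_zero {n : ℕ} {p u : Amb n} (hp : p ∈ hypProd n) :
    hypMetric p u u = 0 ↔ u = 0 := by
  constructor
  · intro h
    rw [hypMetric_self] at h
    have h1 := conf_pos (x := p.1) hp
    have h2 : 0 ≤ conf p.1 ^ 2 * ‖u.1‖ ^ 2 := by positivity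
    have h3 : u.2 ^ 2 = 0 := by nlinarith [sq_nonneg u.2]
    have h4 : conf p.1 ^ 2 * ‖u.1‖ ^ 2 = 0 := by nlinarith [sq_nonneg u.2]
    have h5 : ‖u.1‖ = 0 := by simpa [h1.ne'] using h4
    exact Prod.ext (norm_eq_zero.1 h5) (by simpa using h3)
  · rintro rfl; simp [hypMetric_eq]

theorem hasFDerivAt_conf {n : ℕ} {x : EuclideanSpace ℝ (Fin n)} (hx : ‖x‖ < 1) :
    HasFDerivAt conf ((conf x ^ 2) • innerSL ℝ x) x := by
  have h1 : HasFDerivAt (fun y : EuclideanSpace ℝ (Fin n) => 1 - ‖y‖ ^ 2)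
      (-(2 • innerSL ℝ x)) x := (hasStrictFDerivAt_norm_sq x).hasFDerivAt.const_sub 1
  have h2 := ((hasDerivAt_inv (one_sub_norm_sq_pos hx).ne').comp_hasFDerivAt x h1).const_mul 2
  have h3 : (conf : EuclideanSpace ℝ (Fin n) → ℝ) = fun y => 2 * (1 - ‖y‖ ^ 2)⁻¹ := by
    funext y; rw [conf, div_eq_mul_inv]
  rw [h3]
  refine h2.congr_fderiv ?_
  ext v
  have h4 := (one_sub_norm_sq_pos hx).ne'
  simp
  generalize 1 - ‖x‖ ^ 2 = d at h4
  field_simp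

theorem contDiffAt_conf {n : ℕ} {x : EuclideanSpace ℝ (Fin n)} (hx : ‖x‖ < 1) :
    ContDiffAt ℝ ∞ conf x := by
  unfold conf
  exact contDiffAt_const.div (contDiffAt_const.sub (contDiff_norm_sq ℝ).contDiffAt)
    (one_sub_norm_sq_pos hx).ne'

theorem fderiv_hypMetric {n : ℕ} {p : Amb n} (hp : p ∈ hypProd n) (u v w : Amb n) :
    fderiv ℝ (fun y => hypMetric y v w) p u
      = 2 * conf p.1 ^ 3 * inner ℝ p.1 u.1 * inner ℝ v.1 w.1 := by
  have h1 : HasFDerivAt (fun y : Amb n => conf y.1)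
      (((conf p.1 ^ 2) • innerSL ℝ p.1).comp (ContinuousLinearMap.fst ℝ _ ℝ)) p :=
    (hasFDerivAt_conf (x := p.1) hp).comp p hasFDerivAt_fst
  have h2 := ((h1.pow 2).mul_const (inner ℝ v.1 w.1)).add_const (v.2 * w.2)
  have h3 : (fun y => hypMetric y v w)
      = fun y : Amb n => conf y.1 ^ 2 * inner ℝ v.1 w.1 + v.2 * w.2 := rfl
  rw [h3, h2.fderiv]
  simp
  ring

/-- The metric varies only through the factor `conf ^ 2` on the horizontal part, and the gradient of
`conf` at `x` is `conf x ^ 2 • x`. The vertical components therefore drop out. -/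
theorem christoffel_eq {n : ℕ} {p : Amb n} (hp : p ∈ hypProd n) (u v w : Amb n) :
    christoffel p u v w = conf p.1 ^ 3 * (inner ℝ p.1 u.1 * inner ℝ v.1 w.1
      + inner ℝ p.1 v.1 * inner ℝ u.1 w.1 - inner ℝ p.1 w.1 * inner ℝ u.1 v.1) := by
  rw [christoffel, fderiv_hypMetric hp, fderiv_hypMetric hp, fderiv_hypMetric hp]
  ring

/-! ### Elementary symmetric functions of two principal curvatures. -/

open Polynomial in
-- After subtracting `c • id` a rank-one operator of trace `d` remains. Its characteristic
-- polynomial is known, and shifting the variable by `c` restores the scalar part.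
theorem charpoly_smul_id_add_smulRight {E : Type*} [AddCommGroup E] [Module ℝ E]
    [FiniteDimensional ℝ E] [Nontrivial E] (c d : ℝ) (φ : E →ₗ[ℝ] ℝ) (e : E) (h : φ e = 1) :
    (c • LinearMap.id + d • φ.smulRight e : E →ₗ[ℝ] E).charpoly
      = (X - C c) ^ (Module.finrank ℝ E - 1) * (X - C (c + d)) := by
  classical
  set A : E →ₗ[ℝ] E := c • LinearMap.id + d • φ.smulRight e with hA
  have h1 : (A - c • (1 : Module.End ℝ E)).charpoly
      = X ^ Module.finrank ℝ E - d • X ^ (Module.finrank ℝ E - 1) := by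
    have h2 : A - c • (1 : Module.End ℝ E) = d • φ.smulRight e := by
      rw [hA]; exact add_sub_cancel_left _ _
    rw [h2]
    let b := Module.finBasis ℝ E
    rw [← LinearMap.charpoly_toMatrix _ b]
    have h3 : LinearMap.toMatrix b b (d • φ.smulRight e)
        = Matrix.vecMulVec (fun i => b.repr e i) (fun j => d * φ (b j)) := by
      ext i j
      simp [LinearMap.toMatrix_apply, Matrix.vecMulVec_apply]
      ring
    rw [h3, Matrix.charpoly_vecMulVec, Fintype.card_fin]
    congr 2
    have h4 : φ e = ∑ i, b.repr e i * φ (b i) := by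
      conv_lhs => rw [← b.sum_repr e]
      rw [map_sum]
      simp only [map_smul, smul_eq_mul]
    rw [dotProduct]
    calc ∑ i, b.repr e i * (d * φ (b i)) = d * ∑ i, b.repr e i * φ (b i) := by
          rw [Finset.mul_sum]; exact Finset.sum_congr rfl fun i _ => by ring
      _ = d := by rw [← h4, h, mul_one]
  rw [LinearMap.charpoly_sub_smul] at h1
  have h5 : A.charpoly = (A.charpoly.comp (X + C c)).comp (X - C c) := by
    rw [comp_assoc]; simp
  rw [h5, h1]
  obtain ⟨k, hk⟩ : ∃ k, Module.finrank ℝ E = k + 1 :=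
    ⟨_, (Nat.succ_pred_eq_of_pos Module.finrank_pos).symm⟩
  rw [hk]
  simp [smul_eq_C_mul]
  ring

/-- Sub-multisets of size `j + 1` are sorted according to whether they contain the exceptional entry
`k`. -/
theorem esymm_cons_replicate (c k : ℝ) (m j : ℕ) :
    (k ::ₘ Multiset.replicate m c).esymm (j + 1)
      = (m.choose (j + 1) : ℝ) * c ^ (j + 1) + k * ((m.choose j : ℝ) * c ^ j) := by
  have hrep : ∀ i : ℕ, (Multiset.replicate m c).esymm i = (m.choose i : ℝ) * c ^ i := by
    intro i
    rw [Multiset.esymm]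
    have : ∀ x ∈ (Multiset.powersetCard i (Multiset.replicate m c)).map Multiset.prod,
        x = c ^ i := by
      intro x hx
      obtain ⟨t, ht, rfl⟩ := Multiset.mem_map.1 hx
      obtain ⟨h1, h2⟩ := Multiset.mem_powersetCard.1 ht
      obtain ⟨l, -, rfl⟩ := Multiset.le_replicate_iff.1 h1
      simp at h2
      simp [h2]
    rw [Multiset.eq_replicate_of_mem this]
    simp
  rw [Multiset.esymm, Multiset.powersetCard_cons, Multiset.map_add, Multiset.sum_add,
    Multiset.map_map]
  have : (Multiset.map (Multiset.prod ∘ Multiset.cons k)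
      (Multiset.powersetCard j (Multiset.replicate m c))).sum
      = k * (Multiset.replicate m c).esymm j := by
    rw [Multiset.esymm, ← Multiset.sum_map_mul_left]
    simp
  rw [this, hrep]
  congr 1
  exact hrep (j + 1)

/-- The mean curvature of order `r + 1` for the principal curvatures `c, …, c, c + d`. -/
theorem meanCurv_eq_zero_iff {n r : ℕ} (hr : r + 1 ≤ n) (c d : ℝ)
    (φ : EuclideanSpace ℝ (Fin n) →ₗ[ℝ] ℝ) (e : EuclideanSpace ℝ (Fin n)) (h : φ e = 1) :
    meanCurv (r + 1) (c • LinearMap.id + d • φ.smulRight e) = 0 ↔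
      c ^ r * (((n : ℝ) - r - 1) * c + (r + 1) * (c + d)) = 0 := by
  have : Nontrivial (EuclideanSpace ℝ (Fin n)) := ⟨e, 0, by rintro rfl; simp at h⟩
  obtain ⟨m, rfl⟩ : ∃ m, n = m + 1 := ⟨n - 1, by omega⟩
  have hrm : r ≤ m := by omega
  have hroots : ((Polynomial.X - Polynomial.C c) ^ m
      * (Polynomial.X - Polynomial.C (c + d))).roots = (c + d) ::ₘ Multiset.replicate m c := by
    rw [Polynomial.roots_mul, Polynomial.roots_pow, Polynomial.roots_X_sub_C,
      Polynomial.roots_X_sub_C, Multiset.nsmul_singleton, add_comm, Multiset.singleton_add]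
    exact mul_ne_zero (pow_ne_zero _ (Polynomial.X_sub_C_ne_zero c))
      (Polynomial.X_sub_C_ne_zero _)
  rw [meanCurv, charpoly_smul_id_add_smulRight c d φ e h, finrank_euclideanSpace_fin,
    Nat.add_sub_cancel, hroots, esymm_cons_replicate]
  have h1 : ((m + 1).choose (r + 1) : ℝ) ≠ 0 := by
    exact_mod_cast (Nat.choose_pos hr).ne'
  have h2 : (m.choose r : ℝ) ≠ 0 := by exact_mod_cast (Nat.choose_pos hrm).ne'
  -- The absorption identity lets the common binomial coefficient be factored out of both terms.
  have h3 : (m.choose (r + 1) : ℝ) * (r + 1) = m.choose r * (m - r) := by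
    have := Nat.choose_succ_right_eq m r
    rw [← Nat.cast_sub hrm]
    exact_mod_cast this
  rw [div_eq_zero_iff, or_iff_left h1]
  have h4 : (m.choose r : ℝ) * (c ^ r * ((((m + 1 : ℕ) : ℝ) - r - 1) * c + (r + 1) * (c + d)))
      = (r + 1) * ((m.choose (r + 1) : ℝ) * c ^ (r + 1) + (c + d) * ((m.choose r : ℝ) * c ^ r)) := by
    push_cast
    linear_combination -(c ^ (r + 1)) * h3
  constructor
  · intro h
    rw [h, mul_zero] at h4
    exact (mul_eq_zero.1 h4).resolve_left h2
  · intro h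
    rw [h, mul_zero] at h4
    exact (mul_eq_zero.1 h4.symm).resolve_left (by positivity)

/-! ### Hyperbolic distance to the axis as a function on the ball. -/

theorem hasFDerivAt_norm_of_ne_zero {E : Type*} [NormedAddCommGroup E] [InnerProductSpace ℝ E]
    {x : E} (hx : x ≠ 0) : HasFDerivAt (fun y : E => ‖y‖) (‖x‖⁻¹ • innerSL ℝ x) x := by
  have h0 : ‖x‖ ≠ 0 := norm_ne_zero_iff.2 hx
  have h := (hasStrictFDerivAt_norm_sq x).hasFDerivAt.sqrt (by positivity)
  have h2 : (fun y : E => √(‖y‖ ^ 2)) = fun y => ‖y‖ := by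
    funext y; exact Real.sqrt_sq (norm_nonneg y)
  rw [h2] at h
  refine h.congr_fderiv ?_
  ext v
  simp [Real.sqrt_sq (norm_nonneg x)]
  field_simp

/-- `sinh ρ` as a function on the ball, `ρ` the distance to the centre. -/
noncomputable def sinhDist {n : ℕ} (x : EuclideanSpace ℝ (Fin n)) : ℝ := conf x * ‖x‖

/-- `cosh ρ` as a function on the ball, `ρ` the distance to the centre. -/
noncomputable def coshDist {n : ℕ} (x : EuclideanSpace ℝ (Fin n)) : ℝ := 1 + conf x * ‖x‖ ^ 2

theorem sinhDist_pos {n : ℕ} {x : EuclideanSpace ℝ (Fin n)} (hx : ‖x‖ < 1) (h0 : x ≠ 0) :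
    0 < sinhDist x := mul_pos (conf_pos hx) (norm_pos_iff.2 h0)

theorem coshDist_pos {n : ℕ} {x : EuclideanSpace ℝ (Fin n)} (hx : ‖x‖ < 1) :
    0 < coshDist x := by
  have := conf_pos hx
  unfold coshDist; positivity

theorem coshDist_sq {n : ℕ} {x : EuclideanSpace ℝ (Fin n)} (hx : ‖x‖ < 1) :
    coshDist x ^ 2 = 1 + sinhDist x ^ 2 := by
  have h := conf_mul hx
  unfold coshDist sinhDist
  linear_combination (-conf x * ‖x‖ ^ 2) * h

/-- This is `d sinh ρ = cosh ρ dρ`, where `dρ` is `conf x / ‖x‖` times the inner product with `x`.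
-/
theorem hasFDerivAt_sinhDist {n : ℕ} {x : EuclideanSpace ℝ (Fin n)} (hx : ‖x‖ < 1) (h0 : x ≠ 0) :
    HasFDerivAt sinhDist ((coshDist x * (conf x / ‖x‖)) • innerSL ℝ x) x := by
  have h := (hasFDerivAt_conf hx).mul (hasFDerivAt_norm_of_ne_zero h0)
  refine h.congr_fderiv ?_
  have h1 : ‖x‖ ≠ 0 := norm_ne_zero_iff.2 h0
  ext v
  simp [coshDist]
  field_simp

/-! ### Structure equations of a hypersurface with radial normal field. -/

section NormalField

variable {n : ℕ} {F : EuclideanSpace ℝ (Fin n) → Amb n} {y₀ : EuclideanSpace ℝ (Fin n)}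
  {α β : EuclideanSpace ℝ (Fin n) → ℝ}

/-- The second fundamental form of the parametrization `F` at `y`. -/
noncomputable def secondFormAt (F : EuclideanSpace ℝ (Fin n) → Amb n)
    (y : EuclideanSpace ℝ (Fin n)) (N : Amb n) (a b : EuclideanSpace ℝ (Fin n)) : ℝ :=
  hypMetric (F y) (fderiv ℝ (fderiv ℝ F) y a b) N
    + christoffel (F y) (fderiv ℝ F y a) (fderiv ℝ F y b) N

/-- The field `(α x, β)` is a unit normal field along `F = (x, t)` near `y₀`. -/
structure IsRadialNormalField (F : EuclideanSpace ℝ (Fin n) → Amb n)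
    (y₀ : EuclideanSpace ℝ (Fin n)) (α β : EuclideanSpace ℝ (Fin n) → ℝ) : Prop where
  contDiffAt : ContDiffAt ℝ ∞ F y₀
  mem_hypProd : F y₀ ∈ hypProd n
  ne_zero : (F y₀).1 ≠ 0
  injective : Function.Injective (fderiv ℝ F y₀)
  diff_radial : DifferentiableAt ℝ α y₀
  diff_vertical : DifferentiableAt ℝ β y₀
  orthogonal : ∀ᶠ y in 𝓝 y₀, ∀ b,
    hypMetric (F y) (α y • (F y).1, β y) (fderiv ℝ F y b) = 0
  unit : ∀ᶠ y in 𝓝 y₀, (sinhDist (F y).1 * α y) ^ 2 + β y ^ 2 = 1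

/-- Weingarten's formula: differentiating the orthogonality relation in the direction `a` trades the
second derivatives of `F` for first derivatives of `α` and `β`. The Christoffel term combines with
the rest, and the factor `1 + conf ‖x‖²` it produces is `coshDist`. -/
theorem IsRadialNormalField.secondFormAt_eq (h : IsRadialNormalField F y₀ α β)
    (a b : EuclideanSpace ℝ (Fin n)) :
    secondFormAt F y₀ (α y₀ • (F y₀).1, β y₀) a b
      = -(conf (F y₀).1 ^ 2 * α y₀ * coshDist (F y₀).1
            * inner ℝ (fderiv ℝ F y₀ a).1 (fderiv ℝ F y₀ b).1
          + conf (F y₀).1 ^ 2 * fderiv ℝ α y₀ a * inner ℝ (F y₀).1 (fderiv ℝ F y₀ b).1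
          + fderiv ℝ β y₀ a * (fderiv ℝ F y₀ b).2) := by
  have hF : HasFDerivAt F (fderiv ℝ F y₀) y₀ :=
    (h.contDiffAt.differentiableAt (by simp)).hasFDerivAt
  have hF2 : HasFDerivAt (fderiv ℝ F) (fderiv ℝ (fderiv ℝ F) y₀) y₀ :=
    ((h.contDiffAt.fderiv_right (m := ∞) (by simp)).differentiableAt
      (by simp)).hasFDerivAt
  have hx : HasFDerivAt (fun y => (F y).1) _ y₀ := hF.fst
  have hb : HasFDerivAt (fun y => fderiv ℝ F y b) _ y₀ := hF2.clm_apply (hasFDerivAt_const b y₀)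
  have hc := (hasFDerivAt_conf (x := (F y₀).1) h.mem_hypProd).comp y₀ hx
  have hE := ((((hc.pow 2).mul h.diff_radial.hasFDerivAt).mul (hx.inner ℝ hb.fst)).add
    (h.diff_vertical.hasFDerivAt.mul hb.snd))
  have hz := hE.congr_of_eventuallyEq (f₁ := fun _ => (0 : ℝ)) (by
    filter_upwards [h.orthogonal] with y hy
    have := hy b
    simp only [hypMetric_eq, real_inner_smul_left] at this
    simp only [Pi.add_apply, Pi.mul_apply, Function.comp_apply]
    linarith)
  have h0 := congrArg (fun T => T a) (hz.unique (hasFDerivAt_const (0 : ℝ) y₀))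
  simp at h0
  rw [secondFormAt, hypMetric_eq, christoffel_eq h.mem_hypProd]
  simp only [real_inner_smul_right, real_inner_self_eq_norm_sq]
  rw [real_inner_comm _ (fderiv ℝ (fderiv ℝ F) y₀ a b).1, real_inner_comm _ (fderiv ℝ F y₀ a).1,
    real_inner_comm (F y₀).1 (fderiv ℝ F y₀ b).1, coshDist]
  linear_combination h0

theorem finrank_amb (n : ℕ) : Module.finrank ℝ (Amb n) = n + 1 := by
  simp

theorem range_eq_ker_of_injective {n : ℕ} {D : EuclideanSpace ℝ (Fin n) →ₗ[ℝ] Amb n}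
    (hD : Function.Injective D) {l : Amb n →ₗ[ℝ] ℝ} (hl : l ≠ 0) (h : ∀ b, l (D b) = 0) :
    LinearMap.range D = LinearMap.ker l := by
  apply Submodule.eq_of_le_of_finrank_eq
  · rintro _ ⟨b, rfl⟩
    exact h b
  · have h1 := LinearMap.finrank_range_of_inj hD
    have h2 := LinearMap.finrank_range_add_finrank_ker l
    rw [LinearMap.range_eq_top.2 (LinearMap.surjective hl), finrank_top, finrank_amb] at h2
    simp at h1 h2
    omega

/-- The structure equations of a rotational hypersurface at a point off the axis. -/
theorem IsRadialNormalField.structure_equations (h : IsRadialNormalField F y₀ α β) :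
    ∃ (w : EuclideanSpace ℝ (Fin n) →L[ℝ] ℝ) (e : EuclideanSpace ℝ (Fin n)) (k : ℝ), w e = 1 ∧
      (∀ b, (fderiv ℝ F y₀ b).2 = sinhDist (F y₀).1 * α y₀ * w b) ∧
      (∀ b, conf (F y₀).1 / ‖(F y₀).1‖ * inner ℝ (F y₀).1 (fderiv ℝ F y₀ b).1 = -β y₀ * w b) ∧
      HasFDerivAt (fun y => sinhDist (F y).1 * α y) ((k * β y₀) • w) y₀ ∧
      HasFDerivAt β (-(k * (sinhDist (F y₀).1 * α y₀)) • w) y₀ ∧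
      (∀ A : EuclideanSpace ℝ (Fin n) →ₗ[ℝ] EuclideanSpace ℝ (Fin n),
        (∀ a b, hypMetric (F y₀) (fderiv ℝ F y₀ (A a)) (fderiv ℝ F y₀ b)
          = secondFormAt F y₀ (α y₀ • (F y₀).1, β y₀) a b) ↔
        A = (-(α y₀ * coshDist (F y₀).1)) • LinearMap.id
          + (k + α y₀ * coshDist (F y₀).1) • (w : EuclideanSpace ℝ (Fin n) →ₗ[ℝ] ℝ).smulRight e) := by
  set x := (F y₀).1 with hxdef
  set D := fderiv ℝ F y₀ with hDdef
  set a₀ := α y₀ with ha₀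
  set b₀ := β y₀ with hb₀
  have hxlt : ‖x‖ < 1 := h.mem_hypProd
  have hr : 0 < ‖x‖ := norm_pos_iff.2 h.ne_zero
  have hlam := conf_pos hxlt
  have hsh := sinhDist_pos hxlt h.ne_zero
  have hch := coshDist_pos hxlt
  set lam := conf x with hlamdef
  set C := sinhDist x * a₀ with hCdef
  have hshdef : sinhDist x = lam * ‖x‖ := rfl
  have hunit : C ^ 2 + b₀ ^ 2 = 1 := h.unit.self_of_nhds
  have horth : ∀ b, lam ^ 2 * (a₀ * inner ℝ x (D b).1) + b₀ * (D b).2 = 0 := by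
    intro b
    have := h.orthogonal.self_of_nhds b
    simpa only [hypMetric_eq, real_inner_smul_left] using this
  -- the meridian direction
  obtain ⟨e, he⟩ : ∃ e, D e = ((-(b₀ / (lam * ‖x‖))) • x, C) := by
    let l : Amb n →ₗ[ℝ] ℝ :=
      { toFun := fun z => hypMetric (F y₀) z (a₀ • x, b₀)
        map_add' := fun u v => hypMetric_add_left _ u v _
        map_smul' := fun c u => hypMetric_smul_left _ u _ c }
    have hl : l ≠ 0 := by
      intro h0
      have h1 : l (a₀ • x, b₀) = 0 := by rw [h0]; rfl
      have h2 : l (a₀ • x, b₀) = C ^ 2 + b₀ ^ 2 := by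
        change hypMetric (F y₀) _ _ = _
        rw [hypMetric_self]
        simp only [norm_smul, mul_pow, Real.norm_eq_abs, sq_abs]
        rw [hCdef, hshdef]; ring
      rw [h2, hunit] at h1
      exact one_ne_zero h1
    have hrange := range_eq_ker_of_injective (D := (D : EuclideanSpace ℝ (Fin n) →ₗ[ℝ] Amb n))
      h.injective hl (fun b => by
        change hypMetric (F y₀) _ _ = 0
        rw [hypMetric_comm]
        exact h.orthogonal.self_of_nhds b)
    have hmem : (((-(b₀ / (lam * ‖x‖))) • x, C) : Amb n) ∈ LinearMap.ker l := by
      change hypMetric (F y₀) _ _ = 0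
      rw [hypMetric_eq]
      simp only [real_inner_smul_left, real_inner_smul_right, real_inner_self_eq_norm_sq]
      rw [hCdef, hshdef]
      change lam ^ 2 * _ + _ = 0
      field_simp
      ring
    rw [← hrange] at hmem
    exact hmem
  -- `w` is the arc-length form of the meridian, the inner product of `D b` with the unit vector `D
  -- e`.
  obtain ⟨w, hw⟩ : ∃ w : EuclideanSpace ℝ (Fin n) →L[ℝ] ℝ,
      ∀ b, w b = -b₀ * (lam / ‖x‖ * inner ℝ x (D b).1) + C * (D b).2 :=
    ⟨(-b₀ * (lam / ‖x‖)) • ((innerSL ℝ x).comp ((ContinuousLinearMap.fst ℝ _ ℝ).comp D))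
      + C • ((ContinuousLinearMap.snd ℝ _ ℝ).comp D), fun b => by simp; ring⟩
  have horth' : ∀ b, C * (lam / ‖x‖ * inner ℝ x (D b).1) + b₀ * (D b).2 = 0 := by
    intro b
    rw [← horth b, hCdef, hshdef]
    field_simp
  have hvert : ∀ b, (D b).2 = C * w b := fun b => by
    rw [hw]; linear_combination (-(D b).2) * hunit + b₀ * horth' b
  have hrad : ∀ b, lam / ‖x‖ * inner ℝ x (D b).1 = -b₀ * w b := fun b => by
    rw [hw]; linear_combination (-(lam / ‖x‖ * inner ℝ x (D b).1)) * hunit + C * horth' b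
  have hradx : ∀ b, lam * inner ℝ x (D b).1 = -b₀ * ‖x‖ * w b := fun b => by
    have := hrad b
    field_simp at this
    linear_combination this
  have hwe : w e = 1 := by
    rw [hw, he]
    simp only [real_inner_smul_right, real_inner_self_eq_norm_sq]
    rw [← hunit]
    field_simp
    ring
  have hinj := h.injective
  -- derivative of the field along the parallels
  have hF : HasFDerivAt F D y₀ := (h.contDiffAt.differentiableAt (by simp)).hasFDerivAt
  have hx : HasFDerivAt (fun y => (F y).1) ((ContinuousLinearMap.fst ℝ _ ℝ).comp D) y₀ := hF.fst
  have hS := (hasFDerivAt_sinhDist hxlt h.ne_zero).comp y₀ hx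
  have hC := hS.mul h.diff_radial.hasFDerivAt
  set C' := fderiv ℝ (fun y => sinhDist (F y).1 * α y) y₀ with hC'
  have hCd : HasFDerivAt (fun y => sinhDist (F y).1 * α y) C' y₀ :=
    (HasFDerivAt.differentiableAt hC).hasFDerivAt
  have hC'b : ∀ b, C' b = sinhDist x * fderiv ℝ α y₀ b
      - a₀ * (coshDist x * b₀ * w b) := by
    intro b
    have := congrArg (fun T => T b) (hCd.unique hC)
    simp only at this
    rw [this]
    simp only [add_apply, smul_apply, smul_eq_mul,
      ContinuousLinearMap.comp_apply, innerSL_apply_apply, Function.comp_apply,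
      ContinuousLinearMap.coe_fst']
    rw [← hxdef, ← hlamdef, ← ha₀]
    linear_combination a₀ * coshDist x * hrad b
  have hsum : ∀ b, C * C' b + b₀ * fderiv ℝ β y₀ b = 0 := by
    intro b
    have h1 := ((hCd.pow 2).add (h.diff_vertical.hasFDerivAt.pow 2)).congr_of_eventuallyEq
      (f₁ := fun _ => (1 : ℝ)) (by
        filter_upwards [h.unit] with y hy
        exact hy.symm)
    have h0 := congrArg (fun T => T b) (h1.unique (hasFDerivAt_const (1 : ℝ) y₀))
    simp at h0
    change 2 * C * C' b + 2 * b₀ * _ = 0 at h0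
    linarith
  have hsymm : ∀ a b, secondFormAt F y₀ (a₀ • x, b₀) a b = secondFormAt F y₀ (a₀ • x, b₀) b a := by
    intro a b
    have h1 : fderiv ℝ (fderiv ℝ F) y₀ a b = fderiv ℝ (fderiv ℝ F) y₀ b a :=
      (h.contDiffAt.isSymmSndFDerivAt (by
        rw [minSmoothness_of_isRCLikeNormedField]
        exact WithTop.coe_le_coe.2 (le_top : (2 : ℕ∞) ≤ ⊤))) a b
    rw [secondFormAt, secondFormAt, h1, christoffel_eq h.mem_hypProd, christoffel_eq h.mem_hypProd,
      real_inner_comm (fderiv ℝ F y₀ a).1 (fderiv ℝ F y₀ b).1]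
    ring
  -- The normal coefficients are constant along the parallels. Symmetry of the second fundamental
  -- form in `(b, e)` and the differentiated unit condition form a linear system in the two
  -- derivatives, whose matrix is invertible because `C ^ 2 + b₀ ^ 2 = 1`.
  have hker : ∀ b, w b = 0 → fderiv ℝ α y₀ b = 0 ∧ fderiv ℝ β y₀ b = 0 := by
    intro b hb
    have h1 := hsymm b e
    rw [h.secondFormAt_eq, h.secondFormAt_eq] at h1
    have hx0 : inner ℝ x (D b).1 = 0 := by
      have := hradx b
      rw [hb, mul_zero] at this
      exact (mul_eq_zero.1 this).resolve_left hlam.ne'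
    have ht0 : (D b).2 = 0 := by rw [hvert, hb, mul_zero]
    have hx1 : inner ℝ (D b).1 x = 0 := by rw [real_inner_comm]; exact hx0
    have h2 := hsum b
    have h3 := hC'b b
    rw [← hxdef, ← hDdef, he, ht0, hx0] at h1
    simp only [real_inner_smul_right, real_inner_smul_left, real_inner_self_eq_norm_sq, hx0, hx1]
      at h1
    rw [hb] at h3
    have h5 : lam ^ 2 * fderiv ℝ α y₀ b * (-(b₀ / (lam * ‖x‖)) * ‖x‖ ^ 2)
        = -b₀ * (sinhDist x * fderiv ℝ α y₀ b) := by rw [hshdef]; field_simp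
    have h4 : -b₀ * (sinhDist x * fderiv ℝ α y₀ b) + C * fderiv ℝ β y₀ b = 0 := by
      rw [← hlamdef, h5] at h1
      linear_combination -h1
    have h6 : sinhDist x * fderiv ℝ α y₀ b = 0 := by
      linear_combination (-(sinhDist x * fderiv ℝ α y₀ b)) * hunit + C * h2 - b₀ * h4 - C ^ 2 * h3
    have h7 : fderiv ℝ β y₀ b = 0 := by
      linear_combination (-(fderiv ℝ β y₀ b)) * hunit + b₀ * h2 + C * h4 - C * b₀ * h3
    exact ⟨(mul_eq_zero.1 h6).resolve_left hsh.ne', h7⟩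
  have hlin : ∀ b, fderiv ℝ α y₀ b = w b * fderiv ℝ α y₀ e ∧
      fderiv ℝ β y₀ b = w b * fderiv ℝ β y₀ e := by
    intro b
    have h1 := hker (b - w b • e) (by rw [map_sub, map_smul, hwe]; simp)
    rw [map_sub, map_sub, map_smul, map_smul, sub_eq_zero, sub_eq_zero] at h1
    exact h1
  -- Since `(C, β)` stays on the unit circle, its derivative along the meridian is a multiple of
  -- `(β, -C)`; the multiple `k` is the meridian curvature.
  set k := b₀ * C' e - C * fderiv ℝ β y₀ e with hk
  have hC'e : ∀ b, C' b = w b * C' e := by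
    intro b
    rw [hC'b, hC'b e, (hlin b).1, hwe]; ring
  have hC'k : C' = (k * b₀) • w := by
    ext b
    rw [hC'e]
    simp only [FunLike.coe_smul, Pi.smul_apply, smul_eq_mul]
    rw [hk]
    linear_combination (-(w b * C' e)) * hunit + w b * C * hsum e
  have hβk : fderiv ℝ β y₀ = (-(k * C)) • w := by
    ext b
    rw [(hlin b).2]
    simp only [FunLike.coe_smul, Pi.smul_apply, smul_eq_mul]
    rw [hk]
    linear_combination (-(w b * fderiv ℝ β y₀ e)) * hunit + w b * b₀ * hsum e
  refine ⟨w, e, k, hwe, hvert, hrad, hC'k ▸ hCd, hβk ▸ h.diff_vertical.hasFDerivAt, ?_⟩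
  -- The second form is a multiple of the first plus a rank-one term in `w ⊗ w`. This displays the
  -- eigenvalue of the parallels and the eigenvalue `k` of `e`.
  have hII : ∀ a b, secondFormAt F y₀ (a₀ • x, b₀) a b
      = -(a₀ * coshDist x) * hypMetric (F y₀) (D a) (D b)
        + (k + a₀ * coshDist x) * (w a * w b) := by
    intro a b
    rw [h.secondFormAt_eq, hypMetric_eq, ← hxdef, ← hDdef, ← hlamdef, ← ha₀, (hlin a).1,
      (hlin a).2, hvert, hvert, hk]
    have h1 := hC'b e
    rw [hwe] at h1
    have h2 := hradx b
    rw [h1]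
    linear_combination (-(lam * w a * fderiv ℝ α y₀ e)) * h2 + a₀ * coshDist x * w a * w b * hunit
      - b₀ * w a * w b * fderiv ℝ α y₀ e * hshdef
  have hDe : ∀ b, hypMetric (F y₀) (D e) (D b) = w b := by
    intro b
    rw [he, hypMetric_eq, hw]
    simp only [real_inner_smul_left]
    rw [← hxdef, ← hlamdef]
    field_simp
  intro A
  constructor
  · intro hA
    ext1 a
    apply h.injective
    rw [← sub_eq_zero, ← map_sub, ← hypMetric_self_eq_zero h.mem_hypProd]
    set B : EuclideanSpace ℝ (Fin n) →ₗ[ℝ] EuclideanSpace ℝ (Fin n) :=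
      (-(a₀ * coshDist x)) • LinearMap.id
        + (k + a₀ * coshDist x) • (w : EuclideanSpace ℝ (Fin n) →ₗ[ℝ] ℝ).smulRight e with hB
    have key : ∀ b, hypMetric (F y₀) (D (A a - B a)) (D b) = 0 := by
      intro b
      have hBa : B a = (-(a₀ * coshDist x)) • a + ((k + a₀ * coshDist x) * w a) • e := by
        simp [hB, mul_smul]
      rw [sub_eq_add_neg, ← neg_one_smul ℝ (B a), map_add, map_smul, hypMetric_add_left,
        hypMetric_smul_left, hA a b, hII, hBa, map_add, map_smul, map_smul, hypMetric_add_left,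
        hypMetric_smul_left, hypMetric_smul_left, hDe]
      ring
    exact key _
  · rintro rfl a b
    have : ((-(a₀ * coshDist x)) • LinearMap.id + (k + a₀ * coshDist x) •
        (w : EuclideanSpace ℝ (Fin n) →ₗ[ℝ] ℝ).smulRight e : EuclideanSpace ℝ (Fin n) →ₗ[ℝ] _) a
        = (-(a₀ * coshDist x)) • a + ((k + a₀ * coshDist x) * w a) • e := by
      simp [mul_smul]
    rw [hII, this, map_add, map_smul, map_smul, hypMetric_add_left,
        hypMetric_smul_left, hypMetric_smul_left, hDe]
    ring

end NormalField

/-! ### Derivatives in charts, and the dimension of the image. -/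

section Charts

attribute [local instance 2000] chartedSpaceSelf

variable {n : ℕ} {M : Type*} [TopologicalSpace M] [ChartedSpace (EuclideanSpace ℝ (Fin n)) M]

theorem contDiffOn_comp_chart_symm [IsManifold (𝓡 n) ∞ M] {V : Type*} [NormedAddCommGroup V]
    [NormedSpace ℝ V] {G : M → V} (hG : ContMDiff (𝓡 n) 𝓘(ℝ, V) ∞ G) (p : M) :
    ContDiffOn ℝ ∞ (G ∘ (chartAt (EuclideanSpace ℝ (Fin n)) p).symm)
      (chartAt (EuclideanSpace ℝ (Fin n)) p).target := by
  rw [← contMDiffOn_iff_contDiffOn]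
  exact hG.comp_contMDiffOn contMDiffOn_chart_symm

theorem contDiffAt_comp_chart_symm [IsManifold (𝓡 n) ∞ M] {V : Type*} [NormedAddCommGroup V]
    [NormedSpace ℝ V] {G : M → V} (hG : ContMDiff (𝓡 n) 𝓘(ℝ, V) ∞ G) (p : M)
    {y : EuclideanSpace ℝ (Fin n)} (hy : y ∈ (chartAt (EuclideanSpace ℝ (Fin n)) p).target) :
    ContDiffAt ℝ ∞ (G ∘ (chartAt (EuclideanSpace ℝ (Fin n)) p).symm) y :=
  (contDiffOn_comp_chart_symm hG p).contDiffAt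
    ((chartAt (EuclideanSpace ℝ (Fin n)) p).open_target.mem_nhds hy)

theorem contDiffAt_transition [IsManifold (𝓡 n) ∞ M] (p q : M)
    {y : EuclideanSpace ℝ (Fin n)} (hy : y ∈ (chartAt (EuclideanSpace ℝ (Fin n)) p).target)
    (hq : (chartAt (EuclideanSpace ℝ (Fin n)) p).symm y
      ∈ (chartAt (EuclideanSpace ℝ (Fin n)) q).source) :
    ContDiffAt ℝ ∞ (chartAt (EuclideanSpace ℝ (Fin n)) q
      ∘ (chartAt (EuclideanSpace ℝ (Fin n)) p).symm) y := by
  rw [← contMDiffAt_iff_contDiffAt]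
  exact ((contMDiffOn_chart (I := 𝓡 n) (n := ∞) (x := q)).contMDiffAt
      ((chartAt (EuclideanSpace ℝ (Fin n)) q).open_source.mem_nhds hq)).comp y
    ((contMDiffOn_chart_symm (I := 𝓡 n) (n := ∞) (x := p)).contMDiffAt
      ((chartAt (EuclideanSpace ℝ (Fin n)) p).open_target.mem_nhds hy))

/-- Transition maps have invertible derivative. -/
theorem exists_hasFDerivAt_transition [IsManifold (𝓡 n) ∞ M] (p q : M)
    {y : EuclideanSpace ℝ (Fin n)} (hy : y ∈ (chartAt (EuclideanSpace ℝ (Fin n)) p).target)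
    (hq : (chartAt (EuclideanSpace ℝ (Fin n)) p).symm y
      ∈ (chartAt (EuclideanSpace ℝ (Fin n)) q).source) :
    ∃ B : EuclideanSpace ℝ (Fin n) ≃L[ℝ] EuclideanSpace ℝ (Fin n),
      HasFDerivAt (chartAt (EuclideanSpace ℝ (Fin n)) q
        ∘ (chartAt (EuclideanSpace ℝ (Fin n)) p).symm)
        (B : EuclideanSpace ℝ (Fin n) →L[ℝ] EuclideanSpace ℝ (Fin n)) y := by
  set cp := chartAt (EuclideanSpace ℝ (Fin n)) p
  set cq := chartAt (EuclideanSpace ℝ (Fin n)) q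
  have h1 : HasFDerivAt (cq ∘ cp.symm) _ y :=
    ((contDiffAt_transition p q hy hq).differentiableAt (by simp)).hasFDerivAt
  have hback : cq.symm (cq (cp.symm y)) = cp.symm y := cq.left_inv hq
  have h2 : HasFDerivAt (cp ∘ cq.symm) _ (cq (cp.symm y)) :=
    ((contDiffAt_transition q p (cq.map_source hq)
      (by rw [hback]; exact cp.map_target hy)).differentiableAt (by simp)).hasFDerivAt
  have h12 := (h2.comp y h1).congr_of_eventuallyEq (f₁ := id) (by
    filter_upwards [cp.open_target.mem_nhds hy,
      (cp.continuousAt_symm hy).preimage_mem_nhds (cq.open_source.mem_nhds hq)] with z hz hz'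
    simp only [Function.comp_apply, id]
    rw [cq.left_inv hz', cp.right_inv hz])
  have h21' := (h1 : HasFDerivAt (cq ∘ cp.symm) _ y)
  have hy' : y = (cp ∘ cq.symm) (cq (cp.symm y)) := by
    simp only [Function.comp_apply]; rw [hback, cp.right_inv hy]
  rw [hy'] at h21'
  have h21 := (h21'.comp _ h2).congr_of_eventuallyEq (f₁ := id) (by
    filter_upwards [cq.open_target.mem_nhds (cq.map_source hq),
      (cq.continuousAt_symm (cq.map_source hq)).preimage_mem_nhds
        (cp.open_source.mem_nhds (by rw [hback]; exact cp.map_target hy))] with z hz hz'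
    simp only [Function.comp_apply, id]
    rw [cp.left_inv hz', cq.right_inv hz])
  have e1 := h12.unique (hasFDerivAt_id _)
  have e2 := h21.unique (hasFDerivAt_id _)
  refine ⟨ContinuousLinearEquiv.equivOfInverse (fderiv ℝ (cq ∘ cp.symm) y)
    (fderiv ℝ (cp ∘ cq.symm) (cq (cp.symm y))) (fun v => ?_) (fun v => ?_), h1⟩
  · exact congrArg (fun T => T v) e1
  · have := congrArg (fun T => T v) e2
    rw [← hy'] at this
    exact this

/-- Derivatives in two charts differ by an invertible linear map. -/
theorem exists_hasFDerivAt_chart [IsManifold (𝓡 n) ∞ M] (p : M)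
    {y : EuclideanSpace ℝ (Fin n)} (hy : y ∈ (chartAt (EuclideanSpace ℝ (Fin n)) p).target)
    {V : Type*} [NormedAddCommGroup V] [NormedSpace ℝ V] (G : M → V)
    {q : M} (hq : (chartAt (EuclideanSpace ℝ (Fin n)) p).symm y = q)
    {G' : EuclideanSpace ℝ (Fin n) →L[ℝ] V}
    (hG : HasFDerivAt (G ∘ (chartAt (EuclideanSpace ℝ (Fin n)) q).symm) G'
      (chartAt (EuclideanSpace ℝ (Fin n)) q q)) :
    ∃ B : EuclideanSpace ℝ (Fin n) ≃L[ℝ] EuclideanSpace ℝ (Fin n),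
      HasFDerivAt (G ∘ (chartAt (EuclideanSpace ℝ (Fin n)) p).symm)
        (G'.comp (B : EuclideanSpace ℝ (Fin n) →L[ℝ] EuclideanSpace ℝ (Fin n))) y := by
  have hqs : (chartAt (EuclideanSpace ℝ (Fin n)) p).symm y
      ∈ (chartAt (EuclideanSpace ℝ (Fin n)) q).source := by rw [hq]; exact mem_chart_source _ q
  obtain ⟨B, hB⟩ := exists_hasFDerivAt_transition p q hy hqs
  refine ⟨B, ?_⟩
  have hG' : HasFDerivAt (G ∘ (chartAt (EuclideanSpace ℝ (Fin n)) q).symm) G'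
      ((chartAt (EuclideanSpace ℝ (Fin n)) q ∘ (chartAt (EuclideanSpace ℝ (Fin n)) p).symm) y) := by
    rw [Function.comp_apply, hq]; exact hG
  refine (hG'.comp y hB).congr_of_eventuallyEq ?_
  filter_upwards [((chartAt (EuclideanSpace ℝ (Fin n)) p).continuousAt_symm hy).preimage_mem_nhds
    ((chartAt (EuclideanSpace ℝ (Fin n)) q).open_source.mem_nhds hqs)] with z hz
  simp only [Function.comp_apply]
  rw [(chartAt (EuclideanSpace ℝ (Fin n)) q).left_inv hz]

/-- A function whose derivative vanishes on an open set is locally constant there. -/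
theorem eventually_eq_of_hasFDerivAt_zero [IsManifold (𝓡 n) ∞ M] {G : M → ℝ} {O : Set M}
    (hO : IsOpen O)
    (hG : ∀ p ∈ O, HasFDerivAt (G ∘ (chartAt (EuclideanSpace ℝ (Fin n)) p).symm)
      (0 : EuclideanSpace ℝ (Fin n) →L[ℝ] ℝ) (chartAt (EuclideanSpace ℝ (Fin n)) p p))
    {p : M} (hp : p ∈ O) : ∀ᶠ q in 𝓝 p, G q = G p := by
  set cp := chartAt (EuclideanSpace ℝ (Fin n)) p with hcp
  have h1 : cp.target ∩ cp.symm ⁻¹' O ∈ 𝓝 (cp p) := by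
    refine inter_mem (chart_target_mem_nhds _ p) ?_
    refine (cp.continuousAt_symm (mem_chart_target _ p)).preimage_mem_nhds ?_
    rw [cp.left_inv (mem_chart_source _ p)]
    exact hO.mem_nhds hp
  obtain ⟨ε, hε, hball⟩ := Metric.mem_nhds_iff.1 h1
  have h2 : ∀ y ∈ Metric.ball (cp p) ε, HasFDerivAt (G ∘ cp.symm)
      (0 : EuclideanSpace ℝ (Fin n) →L[ℝ] ℝ) y := by
    intro y hy
    obtain ⟨B, hB⟩ := exists_hasFDerivAt_chart p (hball hy).1 G rfl (hG _ (hball hy).2)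
    simpa using hB
  have h3 : ∀ y ∈ Metric.ball (cp p) ε, (G ∘ cp.symm) y = (G ∘ cp.symm) (cp p) := by
    intro y hy
    refine (convex_ball (cp p) ε).is_const_of_fderivWithin_eq_zero (𝕜 := ℝ)
      (fun z hz => (h2 z hz).differentiableAt.differentiableWithinAt) ?_ hy
      (Metric.mem_ball_self hε)
    intro z hz
    exact ((h2 z hz).hasFDerivWithinAt).fderivWithin (Metric.isOpen_ball.uniqueDiffWithinAt hz)
  filter_upwards [(cp.continuousAt (mem_chart_source _ p)).preimage_mem_nhds
    (Metric.ball_mem_nhds _ hε), chart_source_mem_nhds (EuclideanSpace ℝ (Fin n)) p] with q hq hq'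
  have := h3 _ hq
  simp only [Function.comp_apply] at this
  rwa [cp.left_inv hq', cp.left_inv (mem_chart_source _ p)] at this

/-- Countably many chart balls cover `M`, and a smooth map on a convex set does not raise Hausdorff
dimension. This bound is what makes the complement of a hypersurface dense even when it is only
immersed. -/
theorem dimH_range_le [IsManifold (𝓡 n) ∞ M] [SecondCountableTopology M] {V : Type*}
    [NormedAddCommGroup V] [NormedSpace ℝ V] {G : M → V} (hG : ContMDiff (𝓡 n) 𝓘(ℝ, V) ∞ G) :
    dimH (range G) ≤ n := by
  have h1 : ∀ p : M, ∃ ε > 0, Metric.ball (chartAt (EuclideanSpace ℝ (Fin n)) p p) ε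
      ⊆ (chartAt (EuclideanSpace ℝ (Fin n)) p).target := fun p =>
    Metric.mem_nhds_iff.1 (chart_target_mem_nhds _ p)
  choose ε hε hball using h1
  obtain ⟨s, hs, hcover⟩ := TopologicalSpace.countable_cover_nhds
    (f := fun p : M => (chartAt (EuclideanSpace ℝ (Fin n)) p).symm
      '' Metric.ball (chartAt (EuclideanSpace ℝ (Fin n)) p p) (ε p)) (fun p => by
    have := (chartAt (EuclideanSpace ℝ (Fin n)) p).symm.image_mem_nhds (mem_chart_target _ p)
      (Metric.ball_mem_nhds _ (hε p))
    rwa [(chartAt (EuclideanSpace ℝ (Fin n)) p).left_inv (mem_chart_source _ p)] at this)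
  have h2 : range G = ⋃ p ∈ s, (G ∘ (chartAt (EuclideanSpace ℝ (Fin n)) p).symm)
      '' Metric.ball (chartAt (EuclideanSpace ℝ (Fin n)) p p) (ε p) := by
    rw [← image_univ, ← hcover, image_iUnion₂]
    simp only [image_comp]
  rw [h2, dimH_bUnion hs]
  refine iSup₂_le fun p _ => ?_
  refine (ContDiffOn.dimH_image_le (((contDiffOn_comp_chart_symm hG p).mono (hball p)).of_le
    (by simp)) (convex_ball _ _) Subset.rfl).trans ?_
  refine (dimH_mono (subset_univ _)).trans ?_
  rw [Real.dimH_univ_eq_finrank]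
  simp

namespace IsImmersedHypersurface

variable {X : M → Amb n}

theorem contDiffAt_chartRep [IsManifold (𝓡 n) ∞ M] (hX : IsImmersedHypersurface X) (p : M)
    {y : EuclideanSpace ℝ (Fin n)} (hy : y ∈ (chartAt (EuclideanSpace ℝ (Fin n)) p).target) :
    ContDiffAt ℝ ∞ (chartRep X p) y := contDiffAt_comp_chart_symm hX.contMDiff p hy

theorem hasFDerivAt_chartDiff [IsManifold (𝓡 n) ∞ M] (hX : IsImmersedHypersurface X) (p : M) :
    HasFDerivAt (chartRep X p) (chartDiff X p) (chartAt (EuclideanSpace ℝ (Fin n)) p p) :=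
  ((hX.contDiffAt_chartRep p (mem_chart_target _ p)).differentiableAt (by simp)).hasFDerivAt

theorem injective_chartDiff [IsManifold (𝓡 n) ∞ M] (hX : IsImmersedHypersurface X) (p : M) :
    Function.Injective (chartDiff X p) := by
  have h := hX.injective_mfderiv p
  have hd : MDifferentiableAt (𝓡 n) 𝓘(ℝ, Amb n) X p :=
    hX.contMDiff.mdifferentiableAt (by simp)
  have h2 : mfderiv (𝓡 n) 𝓘(ℝ, Amb n) X p = chartDiff X p := by
    rw [hd.mfderiv]
    simp only [mfld_simps, fderivWithin_univ]
    rfl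
  rw [h2] at h
  exact h

theorem exists_fderiv_chartRep [IsManifold (𝓡 n) ∞ M] (hX : IsImmersedHypersurface X) (p : M)
    {y : EuclideanSpace ℝ (Fin n)} (hy : y ∈ (chartAt (EuclideanSpace ℝ (Fin n)) p).target)
    {q : M} (hq : (chartAt (EuclideanSpace ℝ (Fin n)) p).symm y = q) :
    ∃ B : EuclideanSpace ℝ (Fin n) ≃L[ℝ] EuclideanSpace ℝ (Fin n),
      ∀ v, fderiv ℝ (chartRep X p) y v = chartDiff X q (B v) := by
  obtain ⟨B, hB⟩ := exists_hasFDerivAt_chart p hy X hq (hX.hasFDerivAt_chartDiff q)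
  exact ⟨B, fun v => congrArg (fun T => T v) hB.fderiv⟩

theorem injective_fderiv_chartRep [IsManifold (𝓡 n) ∞ M] (hX : IsImmersedHypersurface X) (p : M)
    {y : EuclideanSpace ℝ (Fin n)} (hy : y ∈ (chartAt (EuclideanSpace ℝ (Fin n)) p).target) :
    Function.Injective (fderiv ℝ (chartRep X p) y) := by
  obtain ⟨B, hB⟩ := hX.exists_fderiv_chartRep p hy rfl
  have : (fderiv ℝ (chartRep X p) y : EuclideanSpace ℝ (Fin n) → Amb n)
      = chartDiff X ((chartAt (EuclideanSpace ℝ (Fin n)) p).symm y) ∘ B := funext hB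
  rw [this]
  exact (hX.injective_chartDiff _).comp B.injective

end IsImmersedHypersurface

end Charts

/-! ### Consequences of rotation invariance. -/

/-- The reflection exchanging `x` and `y` has determinant `-1`. It is corrected by a second
reflection fixing `y`, along some `z` orthogonal to `y`, which exists because `2 ≤ n`. -/
theorem exists_rotation {n : ℕ} (hn : 2 ≤ n) {x y : EuclideanSpace ℝ (Fin n)} (h : ‖x‖ = ‖y‖) :
    ∃ A : EuclideanSpace ℝ (Fin n) ≃ₗᵢ[ℝ] EuclideanSpace ℝ (Fin n),
      LinearMap.det (A : EuclideanSpace ℝ (Fin n) →ₗ[ℝ] EuclideanSpace ℝ (Fin n)) = 1 ∧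
        A x = y := by
  by_cases hxy : x = y
  · refine ⟨LinearIsometryEquiv.refl ℝ _, ?_, by simpa using hxy⟩
    exact LinearMap.det_id
  have hfin : ∀ v : EuclideanSpace ℝ (Fin n), v ≠ 0 →
      LinearMap.det ((ℝ ∙ v)ᗮ.reflection.toLinearEquiv.toLinearMap :
        EuclideanSpace ℝ (Fin n) →ₗ[ℝ] EuclideanSpace ℝ (Fin n)) = -1 := by
    intro v hv
    have := Submodule.det_reflection (𝕜 := ℝ) (ℝ ∙ v)ᗮ
    rw [Submodule.orthogonal_orthogonal, finrank_span_singleton hv, pow_one] at this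
    exact this
  obtain ⟨z, hz, hzy⟩ : ∃ z : EuclideanSpace ℝ (Fin n), z ≠ 0 ∧ inner ℝ z y = 0 := by
    have h1 : Module.finrank ℝ (ℝ ∙ y) ≤ 1 := finrank_span_le_card (R := ℝ) {y} |>.trans (by simp)
    have h2 := (ℝ ∙ y).finrank_add_finrank_orthogonal
    rw [finrank_euclideanSpace_fin] at h2
    have h3 : 0 < Module.finrank ℝ (ℝ ∙ y)ᗮ := by omega
    have := Module.finrank_pos_iff.1 h3
    obtain ⟨⟨z, hz⟩, hz0⟩ := exists_ne (0 : (ℝ ∙ y)ᗮ)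
    refine ⟨z, fun h => hz0 (Subtype.ext h), ?_⟩
    exact Submodule.inner_left_of_mem_orthogonal (Submodule.mem_span_singleton_self y) hz
  refine ⟨(ℝ ∙ (x - y))ᗮ.reflection.trans (ℝ ∙ z)ᗮ.reflection, ?_, ?_⟩
  · have h1 := hfin (x - y) (sub_ne_zero.2 hxy)
    have h2 := hfin z hz
    have h3 := LinearMap.det_comp
      ((ℝ ∙ z)ᗮ.reflection.toLinearEquiv.toLinearMap)
      ((ℝ ∙ (x - y))ᗮ.reflection.toLinearEquiv.toLinearMap)
    rw [h1, h2] at h3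
    norm_num at h3
    exact h3
  · rw [LinearIsometryEquiv.trans_apply, Submodule.reflection_sub h]
    apply Submodule.reflection_mem_subspace_eq_self
    rw [Submodule.mem_orthogonal_singleton_iff_inner_right]
    exact hzy

theorem IsRotationInvariant.mem_of_norm_eq {n : ℕ} (hn : 2 ≤ n) {S : Set (Amb n)}
    (hS : IsRotationInvariant S) {p q : Amb n} (hp : p ∈ S) (h1 : ‖p.1‖ = ‖q.1‖)
    (h2 : p.2 = q.2) : q ∈ S := by
  obtain ⟨A, hA, hAx⟩ := exists_rotation hn h1
  have := hS A hA p hp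
  rwa [hAx, h2] at this

/-- If this minor were nonzero, `(‖x‖², t) ∘ F` would be a submersion at `y`, so its values would
fill a neighbourhood in the orbit space. Rotating, `S` would be a neighbourhood of `F y`, against
density of the complement. -/
theorem IsRotationInvariant.rank_le_one {n : ℕ} (hn : 2 ≤ n) {S : Set (Amb n)}
    (hS : IsRotationInvariant S) (hd : Dense Sᶜ) {F : EuclideanSpace ℝ (Fin n) → Amb n}
    {y : EuclideanSpace ℝ (Fin n)} (hF : ContDiffAt ℝ ∞ F y) (hFS : ∀ᶠ z in 𝓝 y, F z ∈ S)
    (a b : EuclideanSpace ℝ (Fin n)) :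
    inner ℝ (F y).1 (fderiv ℝ F y a).1 * (fderiv ℝ F y b).2
      = inner ℝ (F y).1 (fderiv ℝ F y b).1 * (fderiv ℝ F y a).2 := by
  by_contra hne
  have hF' : HasStrictFDerivAt F (fderiv ℝ F y) y := hF.hasStrictFDerivAt (by simp)
  have h0 : HasStrictFDerivAt (fun z => ‖(F z).1‖ ^ 2) _ y :=
    (hasStrictFDerivAt_norm_sq (F y).1).comp y hF'.fst
  have h1 := h0.prodMk hF'.snd
  set T := ((2 • (innerSL ℝ (F y).1).comp ((ContinuousLinearMap.fst ℝ _ ℝ).comp (fderiv ℝ F y))).prod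
    ((ContinuousLinearMap.snd ℝ _ ℝ).comp (fderiv ℝ F y))) with hT
  have hsurj : (T : EuclideanSpace ℝ (Fin n) →ₗ[ℝ] ℝ × ℝ).range = ⊤ := by
    rw [LinearMap.range_eq_top]
    rintro ⟨u, v⟩
    set A1 := inner ℝ (F y).1 (fderiv ℝ F y a).1
    set B1 := inner ℝ (F y).1 (fderiv ℝ F y b).1
    set A2 := (fderiv ℝ F y a).2
    set B2 := (fderiv ℝ F y b).2
    have hdet : A1 * B2 - B1 * A2 ≠ 0 := sub_ne_zero.2 hne
    obtain ⟨d, hdd⟩ : ∃ d, d = A1 * B2 - B1 * A2 := ⟨_, rfl⟩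
    rw [← hdd] at hdet
    -- Cramer's rule; `u / 2` appears because the differential of `‖x‖²` is twice the inner product
    -- with `x`.
    refine ⟨((u / 2 * B2 - v * B1) / d) • a + ((v * A1 - u / 2 * A2) / d) • b, ?_⟩
    have hTv : ∀ c, T c = (2 * inner ℝ (F y).1 (fderiv ℝ F y c).1, (fderiv ℝ F y c).2) := by
      intro c; simp [hT]
    change T _ = _
    rw [map_add, map_smul, map_smul, hTv, hTv]
    simp only [Prod.smul_mk, Prod.mk_add_mk, smul_eq_mul]
    change (_ * (2 * A1) + _ * (2 * B1), _ * A2 + _ * B2) = _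
    ext
    · simp only; field_simp; rw [hdd]; ring
    · simp only; field_simp; rw [hdd]; ring
  have h2 := h1.map_nhds_eq_of_surj hsurj
  have h3 : (fun z => (‖(F z).1‖ ^ 2, (F z).2)) '' {z | F z ∈ S} ∈ 𝓝 (‖(F y).1‖ ^ 2, (F y).2) := by
    rw [← h2]
    exact image_mem_map hFS
  have hcont : Continuous fun z : Amb n => (‖z.1‖ ^ 2, z.2) := by fun_prop
  have h4 : S ∈ 𝓝 (F y) := by
    filter_upwards [hcont.continuousAt.preimage_mem_nhds h3] with z hz
    obtain ⟨z', hz', heq⟩ := hz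
    simp only [Prod.mk.injEq] at heq
    refine hS.mem_of_norm_eq hn hz' ?_ heq.2
    exact (sq_eq_sq₀ (norm_nonneg _) (norm_nonneg _)).1 heq.1
  obtain ⟨z, hz1, hz2⟩ := hd.inter_nhds_nonempty h4
  exact hz1 hz2

/-- At a point of the axis the height is stationary. -/
theorem fderiv_snd_eq_zero_of_axis {n : ℕ} (hn : 2 ≤ n) {F : EuclideanSpace ℝ (Fin n) → Amb n}
    {y : EuclideanSpace ℝ (Fin n)} (hF : ContDiffAt ℝ ∞ F y)
    (hinj : Function.Injective (fderiv ℝ F y)) (hy : (F y).1 = 0)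
    (hrank : ∀ᶠ z in 𝓝 y, ∀ a b, inner ℝ (F z).1 (fderiv ℝ F z a).1 * (fderiv ℝ F z b).2
      = inner ℝ (F z).1 (fderiv ℝ F z b).1 * (fderiv ℝ F z a).2)
    (b : EuclideanSpace ℝ (Fin n)) : (fderiv ℝ F y b).2 = 0 := by
  have hF1 : HasFDerivAt F (fderiv ℝ F y) y := (hF.differentiableAt (by simp)).hasFDerivAt
  have hF2 : HasFDerivAt (fderiv ℝ F) (fderiv ℝ (fderiv ℝ F) y) y :=
    ((hF.fderiv_right (m := ∞) (by simp)).differentiableAt (by simp)).hasFDerivAt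
  have hev : ∀ c, HasFDerivAt (fun z => fderiv ℝ F z c) _ y :=
    fun c => hF2.clm_apply (hasFDerivAt_const c y)
  -- Derivative of the rank relation in the direction `v`. On the axis `(F y).1 = 0`, so only the
  -- terms that differentiate this factor survive.
  have key : ∀ a b v, inner ℝ (fderiv ℝ F y v).1 (fderiv ℝ F y a).1 * (fderiv ℝ F y b).2
      = inner ℝ (fderiv ℝ F y v).1 (fderiv ℝ F y b).1 * (fderiv ℝ F y a).2 := by
    intro a b v
    have h1 := ((hF1.fst.inner ℝ (hev a).fst).mul (hev b).snd).sub
      ((hF1.fst.inner ℝ (hev b).fst).mul (hev a).snd)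
    have h2 := h1.congr_of_eventuallyEq (f₁ := fun _ => (0 : ℝ)) (by
      filter_upwards [hrank] with z hz
      have := hz a b
      simp only [Pi.sub_apply, Pi.mul_apply]
      rw [this, sub_self])
    have h0 := congrArg (fun T => T v) (h2.unique (hasFDerivAt_const (0 : ℝ) y))
    simp [hy] at h0
    linarith
  by_contra hb
  -- As `2 ≤ n`, the height differential has a nontrivial kernel. Taking `v = a` in `key` kills the
  -- horizontal part of `dF a` as well, which contradicts injectivity.
  obtain ⟨a, ha, ha0⟩ : ∃ a, (fderiv ℝ F y a).2 = 0 ∧ a ≠ 0 := by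
    let l : EuclideanSpace ℝ (Fin n) →ₗ[ℝ] ℝ :=
      ((ContinuousLinearMap.snd ℝ _ ℝ).comp (fderiv ℝ F y) :
        EuclideanSpace ℝ (Fin n) →L[ℝ] ℝ).toLinearMap
    have h1 := l.finrank_range_add_finrank_ker
    have h2 : Module.finrank ℝ (LinearMap.range l) ≤ 1 :=
      (Submodule.finrank_le _).trans (by simp)
    rw [finrank_euclideanSpace_fin] at h1
    have h3 : 0 < Module.finrank ℝ (LinearMap.ker l) := by omega
    have := Module.finrank_pos_iff.1 h3
    obtain ⟨⟨z, hz⟩, hz0⟩ := exists_ne (0 : LinearMap.ker l)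
    exact ⟨z, hz, fun h => hz0 (Subtype.ext h)⟩
  have h1 := key a b a
  rw [ha, mul_zero] at h1
  have h2 : (fderiv ℝ F y a).1 = 0 := by
    have := (mul_eq_zero.1 h1).resolve_right hb
    exact inner_self_eq_zero.1 this
  exact ha0 (hinj (by rw [map_zero]; exact Prod.ext h2 ha))

/-- A rotational parametrization has, off the axis, a radial unit normal field. -/
theorem exists_isRadialNormalField {n : ℕ} {F : EuclideanSpace ℝ (Fin n) → Amb n}
    {y : EuclideanSpace ℝ (Fin n)} (hF : ContDiffAt ℝ ∞ F y)
    (hinj : Function.Injective (fderiv ℝ F y)) (hmem : F y ∈ hypProd n) (hy : (F y).1 ≠ 0)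
    (hrank : ∀ᶠ z in 𝓝 y, ∀ a b, inner ℝ (F z).1 (fderiv ℝ F z a).1 * (fderiv ℝ F z b).2
      = inner ℝ (F z).1 (fderiv ℝ F z b).1 * (fderiv ℝ F z a).2) :
    ∃ α β, IsRadialNormalField F y α β := by
  -- If both differentials vanished, the tangent space would be the horizontal hyperplane. It would
  -- then contain the radial vector, along which `‖x‖²` is not stationary.
  obtain ⟨e, he⟩ : ∃ e, ¬ (inner ℝ (F y).1 (fderiv ℝ F y e).1 = 0 ∧ (fderiv ℝ F y e).2 = 0) := by
    by_contra! hcon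
    let l₁ : Amb n →ₗ[ℝ] ℝ := LinearMap.snd ℝ _ ℝ
    let l₂ : Amb n →ₗ[ℝ] ℝ := (innerSL ℝ (F y).1).toLinearMap ∘ₗ LinearMap.fst ℝ _ ℝ
    have hz : ((F y).1, (0 : ℝ)) ∈ LinearMap.ker l₁ := by simp [l₁]
    rw [← range_eq_ker_of_injective (D := (fderiv ℝ F y).toLinearMap) hinj (l := l₁)
      (fun h => by simpa [l₁] using congrArg (fun T => T ((0, 1) : Amb n)) h)
      (fun b => (hcon b).2)] at hz
    obtain ⟨b, hb⟩ := hz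
    have h1 := (hcon b).1
    change fderiv ℝ F y b = _ at hb
    rw [hb] at h1
    exact hy (inner_self_eq_zero.1 h1)
  have hF' : ContDiffAt ℝ ∞ (fun z => fderiv ℝ F z e) y :=
    (hF.fderiv_right (m := ∞) (by simp)).clm_apply contDiffAt_const
  set τ : EuclideanSpace ℝ (Fin n) → ℝ := fun z => (fderiv ℝ F z e).2 with hτ
  set μ : EuclideanSpace ℝ (Fin n) → ℝ := fun z => inner ℝ (F z).1 (fderiv ℝ F z e).1 with hμ
  -- By the rank relation `(τ x, -conf² μ)` is normal, and `W` is its squared length.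
  set W : EuclideanSpace ℝ (Fin n) → ℝ := fun z =>
    sinhDist (F z).1 ^ 2 * τ z ^ 2 + (conf (F z).1 ^ 2 * μ z) ^ 2 with hW
  have hτc : ContDiffAt ℝ ∞ τ y := contDiffAt_snd.comp y hF'
  have hμc : ContDiffAt ℝ ∞ μ y := (contDiffAt_fst.comp y hF).inner ℝ (contDiffAt_fst.comp y hF')
  have hcc : ContDiffAt ℝ ∞ (fun z => conf (F z).1) y :=
    ContDiffAt.comp (g := conf) y (contDiffAt_conf (x := (F y).1) hmem) (contDiffAt_fst.comp y hF)
  have hsc : ContDiffAt ℝ ∞ (fun z => sinhDist (F z).1) y :=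
    hcc.mul ((contDiffAt_fst.comp y hF).norm ℝ hy)
  have hWc : ContDiffAt ℝ ∞ W y := ((hsc.pow 2).mul (hτc.pow 2)).add ((hcc.pow 2).mul hμc |>.pow 2)
  have hlam := conf_pos (x := (F y).1) hmem
  have hsh := sinhDist_pos (x := (F y).1) hmem hy
  have hWpos : 0 < W y := by
    rcases eq_or_ne (τ y) 0 with h0 | h0
    · have hμ0 : μ y ≠ 0 := fun h => he ⟨h, h0⟩
      have : 0 < (conf (F y).1 ^ 2 * μ y) ^ 2 := by positivity
      have h2 : 0 ≤ sinhDist (F y).1 ^ 2 * τ y ^ 2 := by positivity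
      exact add_pos_of_nonneg_of_pos h2 this
    · have : 0 < sinhDist (F y).1 ^ 2 * τ y ^ 2 := by positivity
      exact add_pos_of_pos_of_nonneg this (sq_nonneg _)
  have hWs : ContDiffAt ℝ ∞ (fun z => √(W z)) y := hWc.sqrt hWpos.ne'
  have hne : √(W y) ≠ 0 := (Real.sqrt_pos.2 hWpos).ne'
  refine ⟨fun z => τ z / √(W z), fun z => -(conf (F z).1 ^ 2 * μ z) / √(W z), hF, hmem, hy, hinj,
    (hτc.div hWs hne).differentiableAt (by simp),
    (((hcc.pow 2).mul hμc).neg.div hWs hne).differentiableAt (by simp), ?_, ?_⟩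
  · filter_upwards [hrank] with z hz b
    have := hz b e
    rw [hypMetric_eq]
    simp only [real_inner_smul_left]
    change conf (F z).1 ^ 2 * (τ z / _ * _) + -(_ * μ z) / _ * _ = 0
    change _ * τ z = μ z * _ at this
    linear_combination (conf (F z).1 ^ 2 / √(W z)) * this
  · filter_upwards [hWc.continuousAt.eventually (lt_mem_nhds hWpos)] with z hz
    have h1 : √(W z) ≠ 0 := (Real.sqrt_pos.2 hz).ne'
    have h2 : √(W z) ^ 2 = W z := Real.sq_sqrt hz.le
    field_simp
    rw [h2]
    simp only [hW]
    ring

/-! ### Chart-independent height gradient and meridian angle. -/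

section Hypersurface

attribute [local instance 2000] chartedSpaceSelf

variable {n : ℕ} {M : Type*} [TopologicalSpace M] [ChartedSpace (EuclideanSpace ℝ (Fin n)) M]

/-- A choice of unit normal vector. -/
noncomputable def unitNormal (X : M → Amb n) (p : M) : Amb n :=
  Classical.epsilon fun N => IsUnitNormal X p N

/-- The squared length of the gradient of the height function. -/
noncomputable def heightGradSq (X : M → Amb n) (p : M) : ℝ := 1 - (unitNormal X p).2 ^ 2

/-- The angle between the meridian and the vertical direction. -/
noncomputable def meridianAngle (X : M → Amb n) (p : M) : ℝ :=
  Real.arctan (-(unitNormal X p).2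
    / (conf (X p).1 / ‖(X p).1‖ * inner ℝ (X p).1 (unitNormal X p).1))

variable {X : M → Amb n}

theorem isUnitNormal_unitNormal {p : M} {N : Amb n} (h : IsUnitNormal X p N) :
    IsUnitNormal X p (unitNormal X p) := Classical.epsilon_spec ⟨N, h⟩

theorem IsUnitNormal.exists_chartDiff_eq [IsManifold (𝓡 n) ∞ M] (hX : IsImmersedHypersurface X)
    {p : M} {N z : Amb n} (h : IsUnitNormal X p N) (hz : hypMetric (X p) N z = 0) :
    ∃ a, chartDiff X p a = z := by
  let l : Amb n →ₗ[ℝ] ℝ :=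
    { toFun := fun z => hypMetric (X p) z N
      map_add' := fun u v => hypMetric_add_left _ u v _
      map_smul' := fun c u => hypMetric_smul_left _ u _ c }
  have hl : l ≠ 0 := by
    intro h0
    have h1 : l N = 0 := by rw [h0]; rfl
    have h2 : l N = 1 := h.1
    exact one_ne_zero (h2.symm.trans h1)
  have hrange := range_eq_ker_of_injective (D := (chartDiff X p).toLinearMap)
    (hX.injective_chartDiff p) hl (fun b => by
      change hypMetric (X p) _ _ = 0
      rw [hypMetric_comm]
      exact h.2 b)
  have hmem : z ∈ LinearMap.ker l := by
    change hypMetric (X p) _ _ = 0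
    rw [hypMetric_comm]; exact hz
  rw [← hrange] at hmem
  exact hmem

/-- The part of `N'` orthogonal to `N` is tangent, hence orthogonal to itself. The squared height
gradient and the meridian angle are even in the normal, so the arbitrary choice in `unitNormal` does
not affect them. -/
theorem IsUnitNormal.eq_or_eq_neg [IsManifold (𝓡 n) ∞ M] (hX : IsImmersedHypersurface X)
    {p : M} {N N' : Amb n} (h : IsUnitNormal X p N) (h' : IsUnitNormal X p N') :
    N' = N ∨ N' = -N := by
  set c := hypMetric (X p) N' N with hc
  have hz : hypMetric (X p) N (N' + (-c) • N) = 0 := by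
    rw [hypMetric_comm, hypMetric_add_left, hypMetric_smul_left, h.1]; ring
  obtain ⟨a, ha⟩ := h.exists_chartDiff_eq hX hz
  have h0 : N' + (-c) • N = 0 := by
    rw [← hypMetric_self_eq_zero (hX.mem_hypProd p)]
    nth_rewrite 2 [← ha]
    rw [hypMetric_add_left, hypMetric_smul_left, h.2, h'.2]; ring
  have h1 : N' = c • N := by
    rw [neg_smul] at h0
    exact add_neg_eq_zero.1 h0
  have h2 : c ^ 2 = 1 := by
    have := h'.1
    rw [h1, hypMetric_smul_left, hypMetric_comm, hypMetric_smul_left, h.1] at this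
    linarith
  rcases sq_eq_sq_iff_eq_or_eq_neg.1 (h2.trans (one_pow 2).symm) with h3 | h3
  · left; rw [h1, h3, one_smul]
  · right; rw [h1, h3, neg_one_smul]

theorem IsUnitNormal.heightGradSq_eq [IsManifold (𝓡 n) ∞ M] (hX : IsImmersedHypersurface X)
    {p : M} {N : Amb n} (h : IsUnitNormal X p N) : heightGradSq X p = 1 - N.2 ^ 2 := by
  rcases h.eq_or_eq_neg hX (isUnitNormal_unitNormal h) with h1 | h1 <;>
    simp [heightGradSq, h1]

theorem IsUnitNormal.meridianAngle_eq [IsManifold (𝓡 n) ∞ M] (hX : IsImmersedHypersurface X)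
    {p : M} {N : Amb n} (h : IsUnitNormal X p N) : meridianAngle X p
      = Real.arctan (-N.2 / (conf (X p).1 / ‖(X p).1‖ * inner ℝ (X p).1 N.1)) := by
  rcases h.eq_or_eq_neg hX (isUnitNormal_unitNormal h) with h1 | h1
  · rw [meridianAngle, h1]
  · rw [meridianAngle, h1]
    simp only [Prod.fst_neg, Prod.snd_neg, inner_neg_right, mul_neg, div_neg,
      neg_div, neg_neg]

theorem isUnitNormal_chart_symm [IsManifold (𝓡 n) ∞ M] (hX : IsImmersedHypersurface X) (p : M)
    {y : EuclideanSpace ℝ (Fin n)} (hy : y ∈ (chartAt (EuclideanSpace ℝ (Fin n)) p).target)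
    {N : Amb n} (h1 : hypMetric (chartRep X p y) N N = 1)
    (h2 : ∀ b, hypMetric (chartRep X p y) N (fderiv ℝ (chartRep X p) y b) = 0) :
    IsUnitNormal X ((chartAt (EuclideanSpace ℝ (Fin n)) p).symm y) N := by
  refine ⟨h1, fun a => ?_⟩
  obtain ⟨B, hB⟩ := hX.exists_fderiv_chartRep p hy rfl
  have := h2 (B.symm a)
  rw [hB, B.apply_symm_apply] at this
  exact this

/-- Rotational invariance makes distance to the axis and height functionally dependent. -/
theorem chartRep_rank_le_one [IsManifold (𝓡 n) ∞ M] [SecondCountableTopology M] (hn : 2 ≤ n)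
    (hX : IsImmersedHypersurface X) (hrot : IsRotationInvariant (range X)) (p : M)
    {y : EuclideanSpace ℝ (Fin n)} (hy : y ∈ (chartAt (EuclideanSpace ℝ (Fin n)) p).target)
    (a b : EuclideanSpace ℝ (Fin n)) :
    inner ℝ (chartRep X p y).1 (fderiv ℝ (chartRep X p) y a).1 * (fderiv ℝ (chartRep X p) y b).2
      = inner ℝ (chartRep X p y).1 (fderiv ℝ (chartRep X p) y b).1
        * (fderiv ℝ (chartRep X p) y a).2 := by
  refine hrot.rank_le_one hn ?_ (hX.contDiffAt_chartRep p hy)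
    (Eventually.of_forall fun z => mem_range_self _) a b
  apply dense_compl_of_dimH_lt_finrank
  refine (dimH_range_le hX.contMDiff).trans_lt ?_
  rw [finrank_amb]
  exact_mod_cast n.lt_succ_self

/-- The structure equations of a rotational `r`-minimal hypersurface near a point off the axis. -/
theorem exists_local_structure [IsManifold (𝓡 n) ∞ M] [SecondCountableTopology M] (hn : 2 ≤ n)
    {r : ℕ} (hr : r + 1 ≤ n) (hX : IsImmersedHypersurface X)
    (hrot : IsRotationInvariant (range X)) (hmin : IsRMinimal r X) {p : M} (hp : (X p).1 ≠ 0) :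
    ∃ (C β : EuclideanSpace ℝ (Fin n) → ℝ) (w : EuclideanSpace ℝ (Fin n) →L[ℝ] ℝ) (k : ℝ),
      (∀ᶠ y in 𝓝 (chartAt (EuclideanSpace ℝ (Fin n)) p p), C y ^ 2 + β y ^ 2 = 1 ∧
        (∃ N, IsUnitNormal X ((chartAt (EuclideanSpace ℝ (Fin n)) p).symm y) N) ∧
        heightGradSq X ((chartAt (EuclideanSpace ℝ (Fin n)) p).symm y) = C y ^ 2 ∧
        meridianAngle X ((chartAt (EuclideanSpace ℝ (Fin n)) p).symm y)
          = Real.arctan (-β y / C y)) ∧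
      HasFDerivAt C ((k * β (chartAt (EuclideanSpace ℝ (Fin n)) p p)) • w)
        (chartAt (EuclideanSpace ℝ (Fin n)) p p) ∧
      HasFDerivAt β (-(k * C (chartAt (EuclideanSpace ℝ (Fin n)) p p)) • w)
        (chartAt (EuclideanSpace ℝ (Fin n)) p p) ∧
      HasFDerivAt (fun y => (chartRep X p y).2) (C (chartAt (EuclideanSpace ℝ (Fin n)) p p) • w)
        (chartAt (EuclideanSpace ℝ (Fin n)) p p) ∧
      HasFDerivAt (fun y => sinhDist (chartRep X p y).1)
        (-(coshDist (X p).1 * β (chartAt (EuclideanSpace ℝ (Fin n)) p p)) • w)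
        (chartAt (EuclideanSpace ℝ (Fin n)) p p) ∧
      C (chartAt (EuclideanSpace ℝ (Fin n)) p p) ^ r * (((r : ℝ) + 1) * k * sinhDist (X p).1
        - ((n : ℝ) - r - 1) * C (chartAt (EuclideanSpace ℝ (Fin n)) p p) * coshDist (X p).1)
        = 0 := by
  set y₀ := chartAt (EuclideanSpace ℝ (Fin n)) p p with hy₀
  have hty : y₀ ∈ (chartAt (EuclideanSpace ℝ (Fin n)) p).target := mem_chart_target _ p
  have hFy : chartRep X p y₀ = X p := by
    simp only [chartRep, Function.comp_apply]
    rw [(chartAt (EuclideanSpace ℝ (Fin n)) p).left_inv (mem_chart_source _ p)]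
  have htn := (chartAt (EuclideanSpace ℝ (Fin n)) p).open_target.mem_nhds hty
  have hmem : X p ∈ hypProd n := hX.mem_hypProd p
  have hsh := sinhDist_pos (x := (X p).1) hmem hp
  have hch := coshDist_pos (x := (X p).1) hmem
  obtain ⟨α, β, h⟩ := exists_isRadialNormalField (hX.contDiffAt_chartRep p hty)
    (hX.injective_fderiv_chartRep p hty) (by rw [hFy]; exact hmem) (by rw [hFy]; exact hp) (by
      filter_upwards [htn] with z hz
      exact chartRep_rank_le_one hn hX hrot p hz)
  obtain ⟨w, e, k, hwe, ht, hrad, hC, hβ, hA⟩ := h.structure_equations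
  rw [hFy] at ht hrad hβ hA
  have hN : ∀ᶠ y in 𝓝 y₀, IsUnitNormal X ((chartAt (EuclideanSpace ℝ (Fin n)) p).symm y)
      (α y • (chartRep X p y).1, β y) := by
    filter_upwards [htn, h.orthogonal, h.unit] with y hy h1 h2
    refine isUnitNormal_chart_symm hX p hy ?_ h1
    rw [hypMetric_self, ← h2]
    simp only [norm_smul, mul_pow, Real.norm_eq_abs, sq_abs, sinhDist]
    ring
  have hF1 : HasFDerivAt (chartRep X p) (fderiv ℝ (chartRep X p) y₀) y₀ :=
    ((hX.contDiffAt_chartRep p hty).differentiableAt (by simp)).hasFDerivAt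
  refine ⟨fun y => sinhDist (chartRep X p y).1 * α y, β, w, k, ?_, ?_, ?_, ?_, ?_, ?_⟩
  · have hne : ∀ᶠ y in 𝓝 y₀, (chartRep X p y).1 ≠ 0 :=
      (continuous_fst.continuousAt.comp hF1.continuousAt).eventually_ne
        (by simp only [Function.comp_apply]; rw [hFy]; exact hp)
    filter_upwards [hN, h.unit, hne] with y h1 h2 h3
    refine ⟨h2, ⟨_, h1⟩, ?_, ?_⟩
    · rw [h1.heightGradSq_eq hX]; linarith
    · rw [h1.meridianAngle_eq hX]
      change Real.arctan (-β y / (conf (chartRep X p y).1 / ‖(chartRep X p y).1‖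
        * inner ℝ (chartRep X p y).1 (α y • (chartRep X p y).1))) = _
      have : ‖(chartRep X p y).1‖ ≠ 0 := norm_ne_zero_iff.2 h3
      rw [real_inner_smul_right, real_inner_self_eq_norm_sq, sinhDist]
      congr 2
      field_simp
  · exact hC
  · simp only; rw [hFy]; exact hβ
  · simp only; rw [hFy]
    refine hF1.snd.congr_fderiv ?_
    ext v
    simpa using ht v
  · have h1 : HasFDerivAt (fun y => sinhDist (chartRep X p y).1) _ y₀ :=
      HasFDerivAt.comp (g := sinhDist) y₀ (hasFDerivAt_sinhDist (by rw [hFy]; exact hmem)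
        (by rw [hFy]; exact hp)) hF1.fst
    refine h1.congr_fderiv ?_
    ext v
    have := hrad v
    simp only [hFy, ContinuousLinearMap.comp_apply, FunLike.coe_smul, Pi.smul_apply, smul_eq_mul,
      innerSL_apply_apply, ContinuousLinearMap.coe_fst']
    linear_combination coshDist (X p).1 * this
  · simp only; rw [hFy]
    have hs := (hA _).2 rfl
    have h1 := hmin p (α y₀ • (X p).1, β y₀) _ (by
      have := hN.self_of_nhds
      rw [hFy, (chartAt (EuclideanSpace ℝ (Fin n)) p).left_inv (mem_chart_source _ p)] at this
      exact this) (by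
      intro a b
      have h2 := hs a b
      rw [secondFormAt, hFy] at h2
      exact h2)
    have h2 : (-(α y₀ * coshDist (X p).1)) ^ r * (((n : ℝ) - r - 1) * (-(α y₀ * coshDist (X p).1))
        + (r + 1) * k) = 0 := by
      have := (meanCurv_eq_zero_iff hr _ _ _ _ hwe).1 h1
      rw [show -(α y₀ * coshDist (X p).1) + (k + α y₀ * coshDist (X p).1) = k by ring] at this
      exact this
    -- The vanishing of `α` is a genuine alternative only for `r ≥ 1`, as at a horizontal tangent
    -- plane; for `r = 0` the power equals one. This is why the factor `C ^ r` is kept in the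
    -- conclusion.
    rcases mul_eq_zero.1 h2 with h3 | h3
    · have h4 := eq_zero_of_pow_eq_zero h3
      have h5 : α y₀ = 0 := by
        have := neg_eq_zero.1 h4
        exact (mul_eq_zero.1 this).resolve_right hch.ne'
      have h6 : r ≠ 0 := by rintro rfl; simp at h3
      rw [h5, mul_zero, zero_pow h6, zero_mul]
    · have : ((r : ℝ) + 1) * k * sinhDist (X p).1
        - ((n : ℝ) - r - 1) * (sinhDist (X p).1 * α y₀) * coshDist (X p).1 = 0 := by
        linear_combination sinhDist (X p).1 * h3
      rw [this, mul_zero]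

end Hypersurface

/-! ### The first integral and the horizontal/vertical dichotomy. -/

section Hypersurface

attribute [local instance 2000] chartedSpaceSelf

variable {n : ℕ} {M : Type*} [TopologicalSpace M] [ChartedSpace (EuclideanSpace ℝ (Fin n)) M]
  {X : M → Amb n}

theorem norm_sq_le_hypMetric {n : ℕ} {p : Amb n} (hp : p ∈ hypProd n) (u : Amb n) :
    ‖u‖ ^ 2 ≤ hypMetric p u u := by
  have h1 := two_le_conf (x := p.1) hp
  rw [hypMetric_self, Prod.norm_def]
  have h2 : ‖u.1‖ ^ 2 ≤ conf p.1 ^ 2 * ‖u.1‖ ^ 2 :=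
    le_mul_of_one_le_left (sq_nonneg _) (by nlinarith)
  rcases max_cases ‖u.1‖ ‖u.2‖ with ⟨h, -⟩ | ⟨h, -⟩ <;> rw [h]
  · nlinarith [sq_nonneg u.2]
  · rw [Real.norm_eq_abs, sq_abs]; nlinarith [sq_nonneg ‖u.1‖]

/-- At the axis point the differential `D₀` has no vertical part, and nearby differentials are
`δ`-close to it. If `z = dF v` is the height gradient, its vertical component equals its squared
length `S`. This component is at most `δ ‖v‖ ≤ 2Kδ ‖z‖ ≤ 2Kδ √S`, whence `S ≤ (2Kδ)²`. -/
theorem eventually_heightGradSq_le [IsManifold (𝓡 n) ∞ M] [SecondCountableTopology M]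
    (hn : 2 ≤ n) (hX : IsImmersedHypersurface X) (hrot : IsRotationInvariant (range X)) {p : M}
    (hp : (X p).1 = 0) {ε : ℝ} (hε : 0 < ε) :
    ∀ᶠ q in 𝓝 p, (∃ N, IsUnitNormal X q N) → heightGradSq X q ≤ ε := by
  set cp := chartAt (EuclideanSpace ℝ (Fin n)) p with hcp
  have hty : cp p ∈ cp.target := mem_chart_target _ p
  have htn := cp.open_target.mem_nhds hty
  have hFy : chartRep X p (cp p) = X p := by
    simp only [chartRep, Function.comp_apply]
    rw [cp.left_inv (mem_chart_source _ p)]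
  have hF := hX.contDiffAt_chartRep p hty
  have hinj := hX.injective_fderiv_chartRep p hty
  have h0 : ∀ b, (fderiv ℝ (chartRep X p) (cp p) b).2 = 0 :=
    fderiv_snd_eq_zero_of_axis hn hF hinj (by rw [hFy]; exact hp) (by
      filter_upwards [htn] with z hz
      exact chartRep_rank_le_one hn hX hrot p hz)
  set D₀ := fderiv ℝ (chartRep X p) (cp p) with hD₀
  obtain ⟨K, hK, hanti⟩ := LinearMap.exists_antilipschitzWith D₀.toLinearMap
    (LinearMap.ker_eq_bot.2 hinj)
  have hK' : (0 : ℝ) < K := hK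
  have hlow : ∀ v, ‖v‖ ≤ K * ‖D₀ v‖ := fun v => by
    simpa using hanti.le_mul_dist v 0
  -- The first bound lets a `δ`-perturbation of `D₀` stay bounded below, with constant `2K` in place
  -- of `K`; the second yields the required estimate.
  obtain ⟨δ, hδ, hδ1, hδ2⟩ : ∃ δ > (0 : ℝ), K * δ ≤ 1 / 2 ∧ (2 * K * δ) ^ 2 ≤ ε := by
    refine ⟨min (1 / (2 * (K : ℝ))) (√ε / (2 * K)), by positivity, ?_, ?_⟩
    · calc K * min (1 / (2 * (K : ℝ))) (√ε / (2 * K)) ≤ K * (1 / (2 * (K : ℝ))) := by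
            gcongr; exact min_le_left _ _
        _ = 1 / 2 := by field_simp
    · have : 2 * K * min (1 / (2 * (K : ℝ))) (√ε / (2 * K)) ≤ √ε := by
        calc 2 * K * min (1 / (2 * (K : ℝ))) (√ε / (2 * K)) ≤ 2 * K * (√ε / (2 * (K : ℝ))) := by
              gcongr; exact min_le_right _ _
          _ = √ε := by field_simp
      calc _ ≤ √ε ^ 2 := by gcongr
        _ = ε := Real.sq_sqrt hε.le
  have hcont : ContinuousAt (fderiv ℝ (chartRep X p)) (cp p) :=
    (hF.fderiv_right (m := ∞) (by simp)).continuousAt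
  have hev : ∀ᶠ y in 𝓝 (cp p), ‖fderiv ℝ (chartRep X p) y - D₀‖ < δ := by
    filter_upwards [hcont (Metric.ball_mem_nhds _ hδ)] with y hy
    simpa [dist_eq_norm] using hy
  filter_upwards [(cp.continuousAt (mem_chart_source _ p)).eventually hev,
    chart_source_mem_nhds (EuclideanSpace ℝ (Fin n)) p] with q hq hqs hN
  obtain ⟨N, hN⟩ := hN
  have hS := hN.heightGradSq_eq hX
  set S := heightGradSq X q with hSdef
  have hz : hypMetric (X q) N ((0, 1) + (-N.2) • N) = 0 := by
    rw [hypMetric_comm, hypMetric_add_left, hypMetric_smul_left, hN.1, hypMetric_eq]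
    simp
  obtain ⟨a, ha⟩ := hN.exists_chartDiff_eq hX hz
  obtain ⟨B, hB⟩ := hX.exists_fderiv_chartRep p (cp.map_source hqs) (cp.left_inv hqs)
  set v := B.symm a with hv
  -- The tangential projection of the vertical unit vector, that is, the gradient of the height.
  set z : Amb n := (0, 1) + (-N.2) • N with hzdef
  have hDv : fderiv ℝ (chartRep X p) (cp q) v = z := by
    rw [hB, hv, B.apply_symm_apply, ha]
  have hz2 : z.2 = S := by
    rw [hS, hzdef]; simp; ring
  have hzz : hypMetric (X q) z z = S := by
    have h1 : hypMetric (X q) N z = 0 := hz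
    have h3 : hypMetric (X q) (0, 1) z = z.2 := by rw [hypMetric_eq]; simp
    nth_rewrite 1 [hzdef]
    rw [hypMetric_add_left, hypMetric_smul_left, h1, h3, hz2]; ring
  have hnz : ‖z‖ ^ 2 ≤ S := hzz ▸ norm_sq_le_hypMetric (hX.mem_hypProd q) z
  have hdiff : ‖z - D₀ v‖ ≤ δ * ‖v‖ := by
    rw [← hDv, ← sub_apply]
    exact (ContinuousLinearMap.le_opNorm _ _).trans (by gcongr)
  have hv1 : ‖v‖ ≤ 2 * K * ‖z‖ := by
    have h1 : ‖D₀ v‖ ≤ ‖z‖ + δ * ‖v‖ := by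
      calc ‖D₀ v‖ = ‖z - (z - D₀ v)‖ := by congr 1; abel
        _ ≤ ‖z‖ + ‖z - D₀ v‖ := norm_sub_le _ _
        _ ≤ _ := by gcongr
    have h2 : ‖v‖ ≤ K * (‖z‖ + δ * ‖v‖) := (hlow v).trans (by gcongr)
    nlinarith [norm_nonneg v]
  have hS0 : 0 ≤ S := (sq_nonneg _).trans hnz
  have hS1 : S ≤ 2 * K * δ * ‖z‖ := by
    have h1 : S = (z - D₀ v).2 := by rw [Prod.snd_sub, h0, hz2, sub_zero]
    calc S ≤ ‖(z - D₀ v).2‖ := by rw [← h1]; exact le_abs_self _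
      _ ≤ ‖z - D₀ v‖ := norm_snd_le _
      _ ≤ δ * ‖v‖ := hdiff
      _ ≤ δ * (2 * K * ‖z‖) := by gcongr
      _ = _ := by ring
  have hS2 : S * S ≤ (2 * K * δ) ^ 2 * S := by
    calc S * S ≤ (2 * K * δ * ‖z‖) * (2 * K * δ * ‖z‖) := by gcongr
      _ = (2 * K * δ) ^ 2 * ‖z‖ ^ 2 := by ring
      _ ≤ _ := by gcongr
  rcases hS0.eq_or_lt with h | h
  · rw [← h]; exact hε.le
  · exact (le_of_mul_le_mul_right hS2 h).trans hδ2

theorem eq_const_of_hasFDerivAt_zero [IsManifold (𝓡 n) ∞ M] [ConnectedSpace M] {G : M → ℝ}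
    (hG : ∀ p, HasFDerivAt (G ∘ (chartAt (EuclideanSpace ℝ (Fin n)) p).symm)
      (0 : EuclideanSpace ℝ (Fin n) →L[ℝ] ℝ) (chartAt (EuclideanSpace ℝ (Fin n)) p p)) :
    ∃ c, ∀ p, G p = c := by
  have h1 : IsLocallyConstant G := (IsLocallyConstant.iff_eventually_eq G).2 fun p =>
    eventually_eq_of_hasFDerivAt_zero isOpen_univ (fun q _ => hG q) (mem_univ p)
  obtain ⟨p₀⟩ := (inferInstance : Nonempty M)
  exact ⟨G p₀, fun p => h1.apply_eq_of_preconnectedSpace p p₀⟩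

/-- The first integral of rotational `r`-minimal hypersurfaces. -/
noncomputable def firstIntegral (r : ℕ) (X : M → Amb n) (p : M) : ℝ :=
  heightGradSq X p ^ (r + 1) * (sinhDist (X p).1 ^ 2) ^ (n - r - 1)

/-- By the structure equations the derivative of `C^{2(r+1)} (sinh ρ)^{2(n-r-1)}` contains the
bracket of the `r`-minimality equation as a factor, and it vanishes trivially where `C = 0`. Squares
are used so that the sign of the normal does not matter. -/
theorem hasFDerivAt_firstIntegral [IsManifold (𝓡 n) ∞ M] [SecondCountableTopology M]
    (hn : 2 ≤ n) {r : ℕ} (hr : r + 1 ≤ n) (hX : IsImmersedHypersurface X)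
    (hrot : IsRotationInvariant (range X)) (hmin : IsRMinimal r X) {p : M} (hp : (X p).1 ≠ 0) :
    HasFDerivAt (firstIntegral r X ∘ (chartAt (EuclideanSpace ℝ (Fin n)) p).symm)
      (0 : EuclideanSpace ℝ (Fin n) →L[ℝ] ℝ) (chartAt (EuclideanSpace ℝ (Fin n)) p p) := by
  obtain ⟨C, β, w, k, hev, hC, -, -, hs, heq⟩ := exists_local_structure hn hr hX hrot hmin hp
  set y₀ := chartAt (EuclideanSpace ℝ (Fin n)) p p with hy₀
  have hFy : chartRep X p y₀ = X p := by
    simp only [chartRep, Function.comp_apply]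
    rw [(chartAt (EuclideanSpace ℝ (Fin n)) p).left_inv (mem_chart_source _ p)]
  have h1 := ((hC.pow 2).pow (r + 1)).mul ((hs.pow 2).pow (n - r - 1))
  have h2 := h1.congr_of_eventuallyEq
    (f₁ := firstIntegral r X ∘ (chartAt (EuclideanSpace ℝ (Fin n)) p).symm) (by
      filter_upwards [hev] with y hy
      simp only [Function.comp_apply, firstIntegral, Pi.mul_apply]
      rw [hy.2.2.1]; rfl)
  refine h2.congr_fderiv ?_
  ext v
  obtain ⟨j, rfl⟩ : ∃ j, n = r + 1 + j := ⟨n - (r + 1), by omega⟩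
  have hj : r + 1 + j - r - 1 = j := by omega
  have hc2 : ((r + 1 + j : ℕ) : ℝ) - r - 1 = j := by push_cast; ring
  rw [hc2] at heq
  simp only [hFy, hj]
  by_cases hC0 : C y₀ = 0
  · simp [hC0]
  have hb := (mul_eq_zero.1 heq).resolve_left (pow_ne_zero _ hC0)
  have hsh := (sinhDist_pos (hX.mem_hypProd p) hp).ne'
  -- For `n = r + 1` the power of `sinh ρ` is absent, and the bracket says that the meridian
  -- curvature is zero.
  rcases j with _ | j
  · have h3 : k = 0 := by
      have h4 : ((r : ℝ) + 1) * sinhDist (X p).1 ≠ 0 := mul_ne_zero (by positivity) hsh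
      apply mul_left_cancel₀ h4
      push_cast at hb
      linear_combination hb
    simp [h3]
  · push_cast at hb
    simp
    linear_combination (2 * (C y₀ ^ 2) ^ r * (sinhDist (X p).1 ^ 2) ^ j * sinhDist (X p).1
      * C y₀ * β y₀ * w v) * hb

/-- A rotational `r`-minimal hypersurface is horizontal, or nowhere horizontal and off the axis. -/
theorem height_const_or_ne [IsManifold (𝓡 n) ∞ M] [SecondCountableTopology M] [ConnectedSpace M]
    (hn : 2 ≤ n) {r : ℕ} (hr : r + 1 ≤ n) (hX : IsImmersedHypersurface X)
    (hrot : IsRotationInvariant (range X)) (hmin : IsRMinimal r X) :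
    (∃ τ, ∀ p, (X p).2 = τ) ∨ ∀ p, (X p).1 ≠ 0 ∧ 0 < heightGradSq X p := by
  have hXc : Continuous X := hX.contMDiff.continuous
  have hopen : IsOpen {p | (X p).1 ≠ 0} := isOpen_ne.preimage (continuous_fst.comp hXc)
  have hloc : ∀ p, (X p).1 ≠ 0 → ∀ᶠ q in 𝓝 p, firstIntegral r X q = firstIntegral r X p :=
    fun p hp => eventually_eq_of_hasFDerivAt_zero hopen
      (fun q hq => hasFDerivAt_firstIntegral hn hr hX hrot hmin hq) hp
  have hnormal : ∀ p, (X p).1 ≠ 0 → (∃ N, IsUnitNormal X p N) ∧ 0 ≤ heightGradSq X p := by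
    intro p hp
    obtain ⟨C, β, w, k, hev, -⟩ := exists_local_structure hn hr hX hrot hmin hp
    have h1 := hev.self_of_nhds
    rw [(chartAt (EuclideanSpace ℝ (Fin n)) p).left_inv (mem_chart_source _ p)] at h1
    exact ⟨h1.2.1, h1.2.2.1 ▸ sq_nonneg _⟩
  -- If the first integral vanishes off the axis, the height gradient is zero there; on the axis the
  -- height is stationary anyway. Otherwise a nonzero level set is shown to be all of `M`.
  by_cases hall : ∀ p, (X p).1 ≠ 0 → firstIntegral r X p = 0
  · left
    refine eq_const_of_hasFDerivAt_zero (n := n) (G := fun p => (X p).2) fun p => ?_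
    have hty := mem_chart_target (EuclideanSpace ℝ (Fin n)) p
    by_cases hp : (X p).1 = 0
    · have h0 : ∀ b, (fderiv ℝ (chartRep X p) (chartAt (EuclideanSpace ℝ (Fin n)) p p) b).2 = 0 :=
        fderiv_snd_eq_zero_of_axis hn (hX.contDiffAt_chartRep p hty)
          (hX.injective_fderiv_chartRep p hty) (by
            simp only [chartRep, Function.comp_apply]
            rw [(chartAt (EuclideanSpace ℝ (Fin n)) p).left_inv (mem_chart_source _ p)]; exact hp)
          (by
            filter_upwards [(chartAt (EuclideanSpace ℝ (Fin n)) p).open_target.mem_nhds hty]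
              with z hz
            exact chartRep_rank_le_one hn hX hrot p hz)
      refine (hX.hasFDerivAt_chartDiff p).snd.congr_fderiv ?_
      ext v
      simpa [chartDiff] using h0 v
    · obtain ⟨C, β, w, k, hev, -, -, ht, -⟩ := exists_local_structure hn hr hX hrot hmin hp
      have h1 := hev.self_of_nhds
      rw [(chartAt (EuclideanSpace ℝ (Fin n)) p).left_inv (mem_chart_source _ p)] at h1
      have h2 : heightGradSq X p = 0 := by
        have h3 := hall p hp
        have h4 := sinhDist_pos (hX.mem_hypProd p) hp
        exact eq_zero_of_pow_eq_zero ((mul_eq_zero.1 h3).resolve_right (by positivity))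
      have h5 := h1.2.2.1
      rw [h2] at h5
      rw [eq_zero_of_pow_eq_zero h5.symm, zero_smul] at ht
      exact ht
  · right
    push Not at hall
    obtain ⟨p₀, hp₀, hκ⟩ := hall
    set A := {p | (X p).1 ≠ 0 ∧ firstIntegral r X p = firstIntegral r X p₀} with hA
    have hAo : IsOpen A := isOpen_iff_mem_nhds.2 fun p hp => by
      filter_upwards [hopen.mem_nhds hp.1, hloc p hp.1] with q h1 h2
      exact ⟨h1, h2.trans hp.2⟩
    -- Off the axis this is local constancy. Near an axis point `sinh ρ < 1` and the squared height
    -- gradient is at most `ε`, so the first integral is at most `ε ^ (r + 1)`, too small to equal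
    -- the chosen nonzero value.
    have hAc : IsOpen Aᶜ := isOpen_iff_mem_nhds.2 fun p hp => by
      by_cases hp0 : (X p).1 = 0
      · obtain ⟨ε, hε, hεκ⟩ : ∃ ε > 0, ε ^ (r + 1) < |firstIntegral r X p₀| := by
          have h1 : Tendsto (fun ε : ℝ => ε ^ (r + 1)) (𝓝[>] 0) (𝓝 0) := by
            have : Continuous fun ε : ℝ => ε ^ (r + 1) := by fun_prop
            simpa using (this.tendsto 0).mono_left nhdsWithin_le_nhds
          obtain ⟨ε, h2, h3⟩ := ((h1.eventually (gt_mem_nhds (abs_pos.2 hκ))).and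
            self_mem_nhdsWithin).exists
          exact ⟨ε, h3, h2⟩
        have hsmall : ∀ᶠ q in 𝓝 p, sinhDist (X q).1 < 1 := by
          have h1 : ContinuousAt (fun q => sinhDist (X q).1) p := by
            have h2 : ContinuousAt conf (X p).1 :=
              (contDiffAt_conf (hX.mem_hypProd p)).continuousAt
            have h3 : ContinuousAt (fun q => (X q).1) p := (continuous_fst.comp hXc).continuousAt
            exact (ContinuousAt.comp (f := fun q => (X q).1) (g := conf) h2 h3).mul h3.norm
          refine h1.eventually (gt_mem_nhds ?_)
          simp [sinhDist, hp0]
        filter_upwards [eventually_heightGradSq_le hn hX hrot hp0 hε, hsmall] with q h1 h2 hq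
        have h3 := hnormal q hq.1
        have h4 := h1 h3.1
        have h5 := sinhDist_pos (hX.mem_hypProd q) hq.1
        have h6 : |firstIntegral r X q| ≤ ε ^ (r + 1) := by
          rw [firstIntegral, abs_of_nonneg (mul_nonneg (pow_nonneg h3.2 _) (by positivity))]
          calc _ ≤ heightGradSq X q ^ (r + 1) * 1 := by
                refine mul_le_mul_of_nonneg_left ?_ (pow_nonneg h3.2 _)
                exact pow_le_one₀ (sq_nonneg _) (pow_le_one₀ h5.le h2.le)
            _ ≤ ε ^ (r + 1) := by rw [mul_one]; exact pow_le_pow_left₀ h3.2 h4 _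
        rw [hq.2] at h6
        exact absurd hεκ (not_lt.2 h6)
      · filter_upwards [hloc p hp0] with q h2 hq
        exact hp ⟨hp0, h2.symm.trans hq.2⟩
    have hAu : A = univ := by
      refine IsClopen.eq_univ ⟨⟨hAc⟩, hAo⟩ ⟨p₀, hp₀, rfl⟩
    intro p
    have hp : p ∈ A := hAu ▸ mem_univ p
    refine ⟨hp.1, lt_of_le_of_ne (hnormal p hp.1).2 fun h => hκ ?_⟩
    rw [← hp.2, firstIntegral, ← h, zero_pow (by omega), zero_mul]

/-- Evolution equations along a nowhere horizontal rotational `r`-minimal hypersurface. -/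
theorem exists_evolution [IsManifold (𝓡 n) ∞ M] [SecondCountableTopology M]
    (hn : 2 ≤ n) {r : ℕ} (hr : r + 1 ≤ n) (hX : IsImmersedHypersurface X)
    (hrot : IsRotationInvariant (range X)) (hmin : IsRMinimal r X) {p : M} (hp : (X p).1 ≠ 0)
    (hpos : 0 < heightGradSq X p) :
    ∃ T : EuclideanSpace ℝ (Fin n) →L[ℝ] ℝ,
      HasFDerivAt ((fun q => (X q).2) ∘ (chartAt (EuclideanSpace ℝ (Fin n)) p).symm) T
        (chartAt (EuclideanSpace ℝ (Fin n)) p p) ∧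
      HasFDerivAt (meridianAngle X ∘ (chartAt (EuclideanSpace ℝ (Fin n)) p).symm)
        ((((n : ℝ) - r - 1) / (r + 1) * (coshDist (X p).1 / sinhDist (X p).1)) • T)
        (chartAt (EuclideanSpace ℝ (Fin n)) p p) ∧
      HasFDerivAt ((fun q => sinhDist (X q).1) ∘ (chartAt (EuclideanSpace ℝ (Fin n)) p).symm)
        ((coshDist (X p).1 * Real.tan (meridianAngle X p)) • T)
        (chartAt (EuclideanSpace ℝ (Fin n)) p p) := by
  obtain ⟨C, β, w, k, hev, hC, hβ, ht, hs, heq⟩ := exists_local_structure hn hr hX hrot hmin hp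
  set y₀ := chartAt (EuclideanSpace ℝ (Fin n)) p p with hy₀
  have h1 := hev.self_of_nhds
  rw [(chartAt (EuclideanSpace ℝ (Fin n)) p).left_inv (mem_chart_source _ p)] at h1
  obtain ⟨hunit, -, hS, hang⟩ := h1
  have hC0 : C y₀ ≠ 0 := by
    intro h
    rw [hS, h] at hpos
    simp at hpos
  have hsh := (sinhDist_pos (hX.mem_hypProd p) hp).ne'
  refine ⟨C y₀ • w, ht, ?_, ?_⟩
  · have h2 := ((hβ.neg).mul ((hasDerivAt_inv hC0).comp_hasFDerivAt y₀ hC)).arctan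
    have h3 := h2.congr_of_eventuallyEq
      (f₁ := meridianAngle X ∘ (chartAt (EuclideanSpace ℝ (Fin n)) p).symm) (by
        filter_upwards [hev] with y hy
        simp only [Function.comp_apply, Pi.mul_apply, Pi.neg_apply]
        rw [hy.2.2.2, div_eq_mul_inv])
    refine h3.congr_fderiv ?_
    ext v
    have hb := (mul_eq_zero.1 heq).resolve_left (pow_ne_zero _ hC0)
    have hk : k = ((n : ℝ) - r - 1) / (r + 1) * (coshDist (X p).1 / sinhDist (X p).1) * C y₀ := by
      field_simp
      linear_combination hb
    -- The relation `1 + tan² = 1 / cos²` for the meridian angle, whose cosine is `C` up to sign.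
    have h5 : 1 + (-β y₀ * (C y₀)⁻¹) ^ 2 = (C y₀ ^ 2)⁻¹ := by
      field_simp
      linear_combination hunit
    have h6 : (β y₀ * (C y₀)⁻¹) ^ 2 = (-β y₀ * (C y₀)⁻¹) ^ 2 := by ring
    have h7 : ((n : ℝ) - r - 1) / (r + 1) * (coshDist (X p).1 / sinhDist (X p).1)
        * (C y₀ * w v) = k * w v := by
      linear_combination (-(w v)) * hk
    simp
    rw [h7, h6, h5, inv_inv]
    field_simp
    linear_combination k * w v * hunit
  · refine hs.congr_fderiv ?_
    rw [hang, Real.tan_arctan, smul_smul]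
    congr 1
    field_simp

end Hypersurface

/-! ### Lifting paths to a complete hypersurface. -/

theorem curveLength_le {n : ℕ} {γ v : ℝ → Amb n} {L : ℝ} (hL : 0 ≤ L)
    (hγ : ∀ s ∈ Icc (0 : ℝ) 1, HasDerivWithinAt γ (v s) (Icc 0 1) s)
    (hv : ∀ s ∈ Icc (0 : ℝ) 1, hypMetric (γ s) (v s) (v s) ≤ L ^ 2) : curveLength γ ≤ L := by
  have h := intervalIntegral.norm_integral_le_of_norm_le_const (a := (0 : ℝ)) (b := 1) (C := L)
    (f := fun s => √(hypMetric (γ s) (derivWithin γ (Icc 0 1) s) (derivWithin γ (Icc 0 1) s)))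
    (fun s hs => by
      rw [uIoc_of_le zero_le_one] at hs
      have hs' : s ∈ Icc (0 : ℝ) 1 := ⟨hs.1.le, hs.2⟩
      rw [(hγ s hs').derivWithin (uniqueDiffOn_Icc_zero_one s hs'), Real.norm_eq_abs,
        abs_of_nonneg (Real.sqrt_nonneg _)]
      exact (Real.sqrt_le_sqrt (hv s hs')).trans (Real.sqrt_sq hL).le)
  simp only [sub_zero, abs_one, mul_one] at h
  exact (le_abs_self _).trans h

section Lifting

attribute [local instance 2000] chartedSpaceSelf

variable {n : ℕ} {M : Type*} [TopologicalSpace M] [ChartedSpace (EuclideanSpace ℝ (Fin n)) M]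
  {X : M → Amb n}

theorem exists_local_inverse [IsManifold (𝓡 n) ∞ M] {H : M → EuclideanSpace ℝ (Fin n)}
    (hH : ContMDiff (𝓡 n) 𝓘(ℝ, EuclideanSpace ℝ (Fin n)) ∞ H) (p : M)
    (hinj : Function.Injective (fderiv ℝ (H ∘ (chartAt (EuclideanSpace ℝ (Fin n)) p).symm)
      (chartAt (EuclideanSpace ℝ (Fin n)) p p))) :
    ∃ e : OpenPartialHomeomorph M (EuclideanSpace ℝ (Fin n)), p ∈ e.source ∧
      (∀ q ∈ e.source, e q = H q) ∧
      ContMDiffAt 𝓘(ℝ, EuclideanSpace ℝ (Fin n)) (𝓡 n) 1 e.symm (H p) := by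
  set cp := chartAt (EuclideanSpace ℝ (Fin n)) p with hcp
  have hty : cp p ∈ cp.target := mem_chart_target _ p
  have hg := contDiffAt_comp_chart_symm hH p hty
  let f' : EuclideanSpace ℝ (Fin n) ≃L[ℝ] EuclideanSpace ℝ (Fin n) :=
    (LinearEquiv.ofInjectiveEndo _ hinj).toContinuousLinearEquiv
  have hf' : HasFDerivAt (H ∘ cp.symm)
      (f' : EuclideanSpace ℝ (Fin n) →L[ℝ] EuclideanSpace ℝ (Fin n)) (cp p) := by
    have h1 := (hg.differentiableAt (by simp)).hasFDerivAt
    have h2 : (f' : EuclideanSpace ℝ (Fin n) →L[ℝ] EuclideanSpace ℝ (Fin n))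
        = fderiv ℝ (H ∘ cp.symm) (cp p) := by ext1 v; rfl
    rw [h2]
    exact h1
  set φ := hg.toOpenPartialHomeomorph _ hf' (by simp) with hφ
  have hφc : (φ : EuclideanSpace ℝ (Fin n) → EuclideanSpace ℝ (Fin n)) = H ∘ cp.symm :=
    hg.toOpenPartialHomeomorph_coe hf' (by simp)
  have hps : cp p ∈ φ.source := hg.mem_toOpenPartialHomeomorph_source hf' (by simp)
  have hHp : (H ∘ cp.symm) (cp p) = H p := by
    simp only [Function.comp_apply]
    rw [cp.left_inv (mem_chart_source _ p)]
  refine ⟨cp.trans φ, ?_, ?_, ?_⟩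
  · rw [OpenPartialHomeomorph.trans_source]
    exact ⟨mem_chart_source _ p, hps⟩
  · intro q hq
    rw [OpenPartialHomeomorph.trans_source] at hq
    rw [OpenPartialHomeomorph.trans_apply, hφc, Function.comp_apply, cp.left_inv hq.1]
  · have h1 : ContDiffAt ℝ ∞ φ.symm (H p) := by
      have := hg.to_localInverse hf' (by simp)
      rw [hHp] at this
      exact this
    have h2 : φ.symm (H p) = cp p := by
      rw [← hHp, ← hφc, φ.left_inv hps]
    have h3 : ContMDiffAt (𝓡 n) (𝓡 n) ∞ cp.symm (φ.symm (H p)) := by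
      rw [h2]
      exact (contMDiffOn_chart_symm (I := 𝓡 n) (n := ∞) (x := p)).contMDiffAt
        (cp.open_target.mem_nhds hty)
    exact (h3.comp _ h1.contMDiffAt).of_le (by simp)

theorem isLocallyInjective_of_fderiv [IsManifold (𝓡 n) ∞ M] {H : M → EuclideanSpace ℝ (Fin n)}
    (hH : ContMDiff (𝓡 n) 𝓘(ℝ, EuclideanSpace ℝ (Fin n)) ∞ H)
    (hinj : ∀ p, Function.Injective (fderiv ℝ (H ∘ (chartAt (EuclideanSpace ℝ (Fin n)) p).symm)
      (chartAt (EuclideanSpace ℝ (Fin n)) p p))) : IsLocallyInjective H := by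
  intro p
  obtain ⟨e, hp, he, -⟩ := exists_local_inverse hH p (hinj p)
  refine ⟨e.source, e.open_source, hp, fun a ha b hb hab => e.injOn ha hb ?_⟩
  rw [he a ha, he b hb, hab]

/-- `c` lifts the path `σ` through `H` on `[0, T]`, starting at `q₀`. -/
structure IsLift {E : Type*} (H : M → E) (σ : ℝ → E) (q₀ : M) (T : ℝ) (c : ℝ → M) : Prop where
  continuousOn : ContinuousOn c (Icc 0 T)
  apply_zero : c 0 = q₀
  comp_eq : ∀ s ∈ Icc 0 T, H (c s) = σ s

theorem IsLift.mono {E : Type*} {H : M → E} {σ : ℝ → E} {q₀ : M} {T T' : ℝ} {c : ℝ → M}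
    (h : IsLift H σ q₀ T c) (hT : T' ≤ T) : IsLift H σ q₀ T' c :=
  ⟨h.continuousOn.mono (Icc_subset_Icc_right hT), h.apply_zero,
    fun s hs => h.comp_eq s ⟨hs.1, hs.2.trans hT⟩⟩

theorem IsLift.congr {E : Type*} {H : M → E} {σ : ℝ → E} {q₀ : M} {T : ℝ} {c c' : ℝ → M}
    (h : IsLift H σ q₀ T c) (hT : 0 ≤ T) (he : EqOn c' c (Icc 0 T)) : IsLift H σ q₀ T c' :=
  ⟨h.continuousOn.congr he, (he ⟨le_rfl, hT⟩).trans h.apply_zero,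
    fun s hs => (he hs).symm ▸ h.comp_eq s hs⟩

theorem IsLift.eqOn [T2Space M] {E : Type*} {H : M → E} (hH : IsLocallyInjective H)
    {σ : ℝ → E} {q₀ : M} {T : ℝ} {c c' : ℝ → M} (hT : 0 ≤ T)
    (h : IsLift H σ q₀ T c) (h' : IsLift H σ q₀ T c') : EqOn c c' (Icc 0 T) := by
  refine (T2Space.isSeparatedMap H).eqOn_of_comp_eqOn hH isPreconnected_Icc h.continuousOn
    h'.continuousOn (fun s hs => ?_) (left_mem_Icc.2 hT) (h.apply_zero.trans h'.apply_zero.symm)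
  simp only [Function.comp_apply]
  rw [h.comp_eq s hs, h'.comp_eq s hs]

theorem IsLift.extend {E : Type*} [TopologicalSpace E] {H : M → E} {σ : ℝ → E} {q₀ : M} {a b : ℝ}
    {c : ℝ → M} (h : IsLift H σ q₀ a c) (ha : 0 ≤ a) (hab : a ≤ b) (hσ : Continuous σ)
    {e : OpenPartialHomeomorph M E} (he : ∀ q ∈ e.source, e q = H q) (hc : c a ∈ e.source)
    (hσe : ∀ s ∈ Icc a b, σ s ∈ e.target) : ∃ c', IsLift H σ q₀ b c' := by
  have hjoin : e.symm (σ a) = c a := by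
    rw [← h.comp_eq a (right_mem_Icc.2 ha), ← he _ hc, e.left_inv hc]
  have hright : EqOn (fun s => if s ≤ a then c s else e.symm (σ s)) (fun s => e.symm (σ s))
      (Icc a b) := by
    intro s hs
    rcases hs.1.eq_or_lt with rfl | hlt
    · simp [hjoin]
    · simp [not_le.2 hlt]
  have hleft : EqOn (fun s => if s ≤ a then c s else e.symm (σ s)) c (Icc 0 a) :=
    fun s hs => if_pos hs.2
  refine ⟨fun s => if s ≤ a then c s else e.symm (σ s), ?_, ?_, ?_⟩
  · rw [← Icc_union_Icc_eq_Icc ha hab]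
    refine (h.continuousOn.congr hleft).union_of_isClosed (ContinuousOn.congr ?_ hright)
      isClosed_Icc isClosed_Icc
    exact e.continuousOn_symm.comp hσ.continuousOn hσe
  · rw [if_pos ha, h.apply_zero]
  · intro s hs
    rcases le_total s a with hsa | hsa
    · exact (congrArg H (hleft ⟨hs.1, hsa⟩)).trans (h.comp_eq s ⟨hs.1, hsa⟩)
    · have h1 := hσe s ⟨hsa, hs.2⟩
      refine (congrArg H (hright ⟨hsa, hs.2⟩)).trans ?_
      change H (e.symm (σ s)) = σ s
      rw [← he _ (e.map_target h1), e.right_inv h1]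

theorem IsLift.contMDiffOn [IsManifold (𝓡 n) ∞ M] {H : M → EuclideanSpace ℝ (Fin n)}
    (hH : ContMDiff (𝓡 n) 𝓘(ℝ, EuclideanSpace ℝ (Fin n)) ∞ H)
    (hinj : ∀ p, Function.Injective (fderiv ℝ (H ∘ (chartAt (EuclideanSpace ℝ (Fin n)) p).symm)
      (chartAt (EuclideanSpace ℝ (Fin n)) p p)))
    {σ : ℝ → EuclideanSpace ℝ (Fin n)} (hσ : ContDiff ℝ 1 σ) {q₀ : M} {T : ℝ} {c : ℝ → M}
    (h : IsLift H σ q₀ T c) : ContMDiffOn 𝓘(ℝ, ℝ) (𝓡 n) 1 c (Icc 0 T) := by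
  intro s hs
  obtain ⟨e, hp, he, hsm⟩ := exists_local_inverse hH (c s) (hinj (c s))
  rw [h.comp_eq s hs] at hsm
  have h1 : ContMDiffAt 𝓘(ℝ, ℝ) (𝓡 n) 1 (e.symm ∘ σ) s :=
    hsm.comp s hσ.contDiffAt.contMDiffAt
  have hkey : ∀ s' ∈ Icc 0 T, c s' ∈ e.source → c s' = (e.symm ∘ σ) s' := by
    intro s' hs' hmem
    rw [Function.comp_apply, ← h.comp_eq s' hs', ← he _ hmem, e.left_inv hmem]
  refine h1.contMDiffWithinAt.congr_of_eventuallyEq ?_ (hkey s hs hp)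
  filter_upwards [(h.continuousOn s hs) (e.open_source.mem_nhds hp), self_mem_nhdsWithin]
    with s' h1 h2
  exact hkey s' h2 h1

/-- The arc of the lift between the two times, reparametrized affinely, joins the points. Its image
under `X` is prescribed by `Y` whatever the lift, so its speed is at most `B * |t - s|`. -/
theorem IsLift.inducedDist_le [IsManifold (𝓡 n) ∞ M] {H : M → EuclideanSpace ℝ (Fin n)}
    (hH : ContMDiff (𝓡 n) 𝓘(ℝ, EuclideanSpace ℝ (Fin n)) ∞ H)
    (hinj : ∀ p, Function.Injective (fderiv ℝ (H ∘ (chartAt (EuclideanSpace ℝ (Fin n)) p).symm)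
      (chartAt (EuclideanSpace ℝ (Fin n)) p p)))
    {σ : ℝ → EuclideanSpace ℝ (Fin n)} (hσ : ContDiff ℝ 1 σ) {q₀ : M} {T : ℝ} {c : ℝ → M}
    (h : IsLift H σ q₀ T c) (hT : T < 1) {Y Y' : ℝ → Amb n} {B : ℝ} (hB : 0 ≤ B)
    (hY : ∀ s ∈ Ico (0 : ℝ) 1, HasDerivAt Y (Y' s) s)
    (hY' : ∀ s ∈ Ico (0 : ℝ) 1, hypMetric (Y s) (Y' s) (Y' s) ≤ B ^ 2)
    (hXY : ∀ s ∈ Ico (0 : ℝ) 1, ∀ q, H q = σ s → X q = Y s)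
    {s t : ℝ} (hs : s ∈ Icc 0 T) (ht : t ∈ Icc 0 T) :
    inducedDist X (c s) (c t) ≤ ENNReal.ofReal (B * |t - s|) := by
  have hmem : ∀ v ∈ Icc (0 : ℝ) 1, s + v * (t - s) ∈ Icc 0 T := by
    intro v hv
    constructor
    · nlinarith [hv.1, hv.2, hs.1, ht.1]
    · nlinarith [hv.1, hv.2, hs.2, ht.2]
  have hmem' : ∀ v ∈ Icc (0 : ℝ) 1, s + v * (t - s) ∈ Ico (0 : ℝ) 1 := fun v hv =>
    ⟨(hmem v hv).1, (hmem v hv).2.trans_lt hT⟩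
  have haff : ContDiff ℝ 1 fun v : ℝ => s + v * (t - s) := by fun_prop
  refine (iInf_le _ ⟨fun v => c (s + v * (t - s)),
    (h.contMDiffOn hH hinj hσ).comp haff.contMDiff.contMDiffOn hmem, by simp, by simp⟩).trans ?_
  refine ENNReal.ofReal_le_ofReal ?_
  have heq : ∀ v ∈ Icc (0 : ℝ) 1, (X ∘ fun v => c (s + v * (t - s))) v = Y (s + v * (t - s)) :=
    fun v hv => hXY _ (hmem' v hv) _ (h.comp_eq _ (hmem v hv))
  refine curveLength_le (v := fun v => (t - s) • Y' (s + v * (t - s))) (by positivity)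
    (fun v hv => ?_) (fun v hv => ?_)
  · have h1 : HasDerivAt (fun v : ℝ => s + v * (t - s)) (t - s) v := by
      simpa using ((hasDerivAt_id v).mul_const (t - s)).const_add s
    exact ((hY _ (hmem' v hv)).scomp v h1).hasDerivWithinAt.congr heq (heq v hv)
  · change hypMetric ((X ∘ fun v => c (s + v * (t - s))) v) _ _ ≤ _
    rw [heq v hv, hypMetric_smul_left, hypMetric_comm, hypMetric_smul_left]
    calc _ = (t - s) ^ 2 * hypMetric (Y (s + v * (t - s))) (Y' (s + v * (t - s)))
          (Y' (s + v * (t - s))) := by ring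
      _ ≤ (t - s) ^ 2 * B ^ 2 := by
          exact mul_le_mul_of_nonneg_left (hY' _ (hmem' v hv)) (sq_nonneg _)
      _ = _ := by rw [mul_pow, sq_abs]; ring

/-- In a complete hypersurface, paths of bounded speed lift up to their endpoint. -/
theorem exists_apply_eq_endpoint [IsManifold (𝓡 n) ∞ M] [T2Space M]
    (hcomplete : IsCompleteHypersurface X) {H : M → EuclideanSpace ℝ (Fin n)}
    (hH : ContMDiff (𝓡 n) 𝓘(ℝ, EuclideanSpace ℝ (Fin n)) ∞ H)
    (hinj : ∀ p, Function.Injective (fderiv ℝ (H ∘ (chartAt (EuclideanSpace ℝ (Fin n)) p).symm)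
      (chartAt (EuclideanSpace ℝ (Fin n)) p p)))
    {σ : ℝ → EuclideanSpace ℝ (Fin n)} (hσ : ContDiff ℝ 1 σ) {Y Y' : ℝ → Amb n} {B : ℝ}
    (hB : 0 ≤ B) (hY : ∀ s ∈ Ico (0 : ℝ) 1, HasDerivAt Y (Y' s) s)
    (hY' : ∀ s ∈ Ico (0 : ℝ) 1, hypMetric (Y s) (Y' s) (Y' s) ≤ B ^ 2)
    (hXY : ∀ s ∈ Ico (0 : ℝ) 1, ∀ q, H q = σ s → X q = Y s) {q₀ : M} (hq₀ : H q₀ = σ 0) :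
    ∃ q, H q = σ 1 := by
  have hloc := isLocallyInjective_of_fderiv hH hinj
  set S : Set ℝ := {T | T ∈ Icc (0 : ℝ) 1 ∧ ∃ c, IsLift H σ q₀ T c} with hS
  have h0S : (0 : ℝ) ∈ S := ⟨⟨le_rfl, zero_le_one⟩, fun _ => q₀, continuousOn_const, rfl,
    fun s hs => by rw [le_antisymm hs.2 hs.1, hq₀]⟩
  have hbdd : BddAbove S := ⟨1, fun T hT => hT.1.2⟩
  set τ := sSup S with hτ
  have hτ0 : 0 ≤ τ := le_csSup hbdd h0S
  have hτ1 : τ ≤ 1 := csSup_le ⟨0, h0S⟩ fun T hT => hT.1.2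
  have hbelow : ∀ T, 0 ≤ T → T < τ → T ∈ S := by
    intro T h0 hT
    obtain ⟨T', hT', hlt⟩ := exists_lt_of_lt_csSup ⟨0, h0S⟩ hT
    obtain ⟨c, hc⟩ := hT'.2
    exact ⟨⟨h0, hlt.le.trans hT'.1.2⟩, c, hc.mono hlt.le⟩
  -- Along times increasing to `τ` the lift is Cauchy for the induced distance, so completeness
  -- gives a limit point. A local inverse of `H` at that point then carries the lift up to `τ`.
  -- Nothing is assumed about `Y` at time `1`.
  have hτS : τ ∈ S := by
    by_contra hnot
    have hτpos : 0 < τ := hτ0.lt_of_ne fun h => hnot (h ▸ h0S)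
    have hex : ∀ T : ℝ, ∃ c : ℝ → M, 0 ≤ T → T < τ → IsLift H σ q₀ T c := by
      intro T
      by_cases h : 0 ≤ T ∧ T < τ
      · obtain ⟨c, hc⟩ := (hbelow T h.1 h.2).2
        exact ⟨c, fun _ _ => hc⟩
      · exact ⟨fun _ => q₀, fun h1 h2 => absurd ⟨h1, h2⟩ h⟩
    choose C hC using hex
    -- Lifts over different intervals agree by uniqueness, so the diagonal is one lift over all of
    -- `[0, τ)`.
    set c : ℝ → M := fun s => C s s with hcdef
    have hc : ∀ T, 0 ≤ T → T < τ → IsLift H σ q₀ T c := by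
      intro T h0 hT
      refine (hC T h0 hT).congr h0 fun s hs => ?_
      have hsτ := hs.2.trans_lt hT
      exact (hC s hs.1 hsτ).eqOn hloc hs.1 ((hC T h0 hT).mono hs.2) (right_mem_Icc.2 hs.1)
    set u : ℕ → ℝ := fun k => τ * (1 - 1 / ((k : ℝ) + 1)) with hu
    have hutend : Tendsto u atTop (𝓝 τ) := by
      have := (tendsto_one_div_add_atTop_nhds_zero_nat (𝕜 := ℝ)).const_sub 1 |>.const_mul τ
      simpa [hu] using this
    have hu0 : ∀ k, 0 ≤ u k := fun k => by
      refine mul_nonneg hτ0 (sub_nonneg.2 ?_)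
      rw [div_le_one (by positivity)]; linarith [(Nat.cast_nonneg k : (0 : ℝ) ≤ k)]
    have hu1 : ∀ k, u k < τ := fun k => by
      have : (0 : ℝ) < 1 / ((k : ℝ) + 1) := by positivity
      simp only [hu]; nlinarith
    obtain ⟨q, hq⟩ := hcomplete (fun k => c (u k)) (by
      intro ε hε
      obtain ⟨ε', hε', hεle⟩ : ∃ ε' : ℝ, 0 < ε' ∧ ENNReal.ofReal ε' ≤ ε := by
        rcases eq_or_ne ε ⊤ with rfl | htop
        · exact ⟨1, one_pos, le_top⟩
        · exact ⟨ε.toReal, ENNReal.toReal_pos hε.ne' htop, (ENNReal.ofReal_toReal htop).le⟩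
      have hcau := Metric.cauchySeq_iff.1 hutend.cauchySeq (ε' / (B + 1)) (by positivity)
      obtain ⟨k, hk⟩ := hcau
      refine ⟨k, fun i hi j hj => ?_⟩
      have hT := hc (max (u i) (u j)) ((hu0 i).trans (le_max_left _ _)) (max_lt (hu1 i) (hu1 j))
      refine (hT.inducedDist_le hH hinj hσ ((max_lt (hu1 i) (hu1 j)).trans_le hτ1) hB hY hY' hXY
        ⟨hu0 i, le_max_left _ _⟩ ⟨hu0 j, le_max_right _ _⟩).trans_lt
        (lt_of_lt_of_le ?_ hεle)
      refine (ENNReal.ofReal_lt_ofReal_iff hε').2 ?_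
      have h1 := hk j hj i hi
      rw [Real.dist_eq, lt_div_iff₀ (by positivity)] at h1
      nlinarith [abs_nonneg (u j - u i)])
    obtain ⟨e, hqe, he, -⟩ := exists_local_inverse hH q (hinj q)
    have hHq : H q = σ τ := by
      have h1 : Tendsto (fun k => H (c (u k))) atTop (𝓝 (H q)) :=
        (hH.continuous.tendsto q).comp hq
      have h2 : Tendsto (fun k => H (c (u k))) atTop (𝓝 (σ τ)) := by
        have : ∀ k, H (c (u k)) = σ (u k) := fun k =>
          (hc (u k) (hu0 k) (hu1 k)).comp_eq _ (right_mem_Icc.2 (hu0 k))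
        simp only [this]
        exact (hσ.continuous.tendsto τ).comp hutend
      exact tendsto_nhds_unique h1 h2
    have htarget : σ τ ∈ e.target := by
      rw [← hHq, ← he q hqe]; exact e.map_source hqe
    obtain ⟨δ, hδ, hball⟩ := Metric.mem_nhds_iff.1
      (hσ.continuous.continuousAt.preimage_mem_nhds (e.open_target.mem_nhds htarget))
    obtain ⟨k, hk1, hk2⟩ := ((hq.eventually (e.open_source.mem_nhds hqe)).and
      (hutend.eventually (Metric.ball_mem_nhds τ hδ))).exists
    refine hnot ⟨⟨hτ0, hτ1⟩, (hc (u k) (hu0 k) (hu1 k)).extend (hu0 k) (hu1 k).le hσ.continuous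
      he hk1 fun s hs => hball ?_⟩
    change dist (u k) τ < δ at hk2
    rw [Metric.mem_ball]
    rw [Real.dist_eq, abs_lt] at hk2 ⊢
    constructor <;> linarith [hs.1, hs.2]
  obtain ⟨c, hc⟩ := hτS.2
  rcases hτ1.eq_or_lt with h1 | hlt
  · exact ⟨c 1, hc.comp_eq 1 ⟨zero_le_one, h1.ge⟩⟩
  · exfalso
    obtain ⟨e, hqe, he, -⟩ := exists_local_inverse hH (c τ) (hinj (c τ))
    have htarget : σ τ ∈ e.target := by
      rw [← hc.comp_eq τ (right_mem_Icc.2 hτ0), ← he _ hqe]; exact e.map_source hqe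
    obtain ⟨δ, hδ, hball⟩ := Metric.mem_nhds_iff.1
      (hσ.continuous.continuousAt.preimage_mem_nhds (e.open_target.mem_nhds htarget))
    have hle : τ ≤ min 1 (τ + δ / 2) := le_min hτ1 (by linarith)
    have hmem : min 1 (τ + δ / 2) ∈ S :=
      ⟨⟨hτ0.trans hle, min_le_left _ _⟩, hc.extend hτ0 hle hσ.continuous he hqe fun s hs => by
        apply hball
        rw [Metric.mem_ball, Real.dist_eq, abs_lt]
        constructor <;> linarith [hs.1, hs.2.trans (min_le_right _ _)]⟩
    have h2 := le_csSup hbdd hmem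
    have h3 : τ < min 1 (τ + δ / 2) := lt_min hlt (by linarith)
    linarith

end Lifting

/-! ### Complete hypersurfaces contained in slices, cones and surfaces of revolution. -/

theorem conf_le_of_norm_le {n : ℕ} {x : EuclideanSpace ℝ (Fin n)} {R : ℝ} (hR : R < 1)
    (hx : ‖x‖ ≤ R) : conf x ≤ 2 / (1 - R ^ 2) := by
  have h0 := norm_nonneg x
  have h1 : 0 < 1 - R ^ 2 := by nlinarith
  unfold conf
  gcongr

section Global

attribute [local instance 2000] chartedSpaceSelf

variable {n : ℕ} {M : Type*} [TopologicalSpace M] [ChartedSpace (EuclideanSpace ℝ (Fin n)) M]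
  {X : M → Amb n}

theorem IsImmersedHypersurface.contMDiff_fst (hX : IsImmersedHypersurface X) :
    ContMDiff (𝓡 n) 𝓘(ℝ, EuclideanSpace ℝ (Fin n)) ∞ fun p => (X p).1 :=
  ContMDiff.comp (I' := 𝓘(ℝ, Amb n)) (contDiff_fst.contMDiff) hX.contMDiff

/-- When the immersion factors through `H`, the differential of `H` inherits injectivity from `dX`
by the chain rule; this makes `H` a local diffeomorphism for path lifting. -/
theorem injective_fderiv_of_comp [IsManifold (𝓡 n) ∞ M] (hX : IsImmersedHypersurface X)
    {H : M → EuclideanSpace ℝ (Fin n)}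
    (hH : ContMDiff (𝓡 n) 𝓘(ℝ, EuclideanSpace ℝ (Fin n)) ∞ H)
    {Φ : EuclideanSpace ℝ (Fin n) → Amb n} (hΦ : ∀ q, X q = Φ (H q)) {p : M}
    (hd : DifferentiableAt ℝ Φ (H p)) :
    Function.Injective (fderiv ℝ (H ∘ (chartAt (EuclideanSpace ℝ (Fin n)) p).symm)
      (chartAt (EuclideanSpace ℝ (Fin n)) p p)) := by
  have hHp : (H ∘ (chartAt (EuclideanSpace ℝ (Fin n)) p).symm)
      (chartAt (EuclideanSpace ℝ (Fin n)) p p) = H p := by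
    simp only [Function.comp_apply]
    rw [(chartAt (EuclideanSpace ℝ (Fin n)) p).left_inv (mem_chart_source _ p)]
  have h1 := ((contDiffAt_comp_chart_symm hH p (mem_chart_target _ p)).differentiableAt
    (by simp)).hasFDerivAt
  have h2 : HasFDerivAt (chartRep X p) _ (chartAt (EuclideanSpace ℝ (Fin n)) p p) :=
    (HasFDerivAt.comp (g := Φ) _ (by rw [hHp]; exact hd.hasFDerivAt) h1).congr_of_eventuallyEq
      (Eventually.of_forall fun y => hΦ _)
  have h3 := h2.unique (hX.hasFDerivAt_chartDiff p)
  have h4 := hX.injective_chartDiff p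
  rw [← h3] at h4
  exact Function.Injective.of_comp (f := fderiv ℝ Φ (H p)) (by exact h4)

/-- The horizontal position is a local diffeomorphism to the ball. Segments in the ball stay within
the larger of the radii of their endpoints, so their hyperbolic speed is bounded and they lift. -/
theorem range_eq_slice [IsManifold (𝓡 n) ∞ M] [T2Space M] [Nonempty M]
    (hX : IsImmersedHypersurface X) (hc : IsCompleteHypersurface X) {τ : ℝ}
    (hτ : ∀ p, (X p).2 = τ) : range X = slice n τ := by
  refine Subset.antisymm (range_subset_iff.2 fun p => ⟨hX.mem_hypProd p, hτ p⟩) ?_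
  rintro z ⟨hz, hzτ⟩
  obtain ⟨p₀⟩ := (inferInstance : Nonempty M)
  set x₀ := (X p₀).1 with hx₀
  have hx₀1 : ‖x₀‖ < 1 := hX.mem_hypProd p₀
  have hz1 : ‖z.1‖ < 1 := hz
  set R := max ‖x₀‖ ‖z.1‖ with hR
  have hR1 : R < 1 := max_lt hx₀1 hz1
  have hσR : ∀ s ∈ Ico (0 : ℝ) 1, ‖x₀ + s • (z.1 - x₀)‖ ≤ R := by
    intro s hs
    have h1 : x₀ + s • (z.1 - x₀) = (1 - s) • x₀ + s • z.1 := by module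
    rw [h1]
    refine (norm_add_le _ _).trans ?_
    rw [norm_smul, norm_smul, Real.norm_eq_abs, Real.norm_eq_abs, abs_of_nonneg hs.1,
      abs_of_nonneg (sub_nonneg.2 hs.2.le)]
    have h2 : ‖x₀‖ ≤ R := le_max_left _ _
    have h3 : ‖z.1‖ ≤ R := le_max_right _ _
    nlinarith [hs.1, hs.2]
  have hσd : ∀ s : ℝ, HasDerivAt (fun s : ℝ => x₀ + s • (z.1 - x₀)) (z.1 - x₀) s := by
    intro s
    simpa using ((hasDerivAt_id s).smul_const (z.1 - x₀)).const_add x₀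
  have hRpos : 0 < 1 - R ^ 2 := by nlinarith [(norm_nonneg x₀).trans (le_max_left _ _ : _ ≤ R)]
  obtain ⟨q, hq⟩ := exists_apply_eq_endpoint hc hX.contMDiff_fst
    (fun p => injective_fderiv_of_comp hX hX.contMDiff_fst (Φ := fun y => (y, τ))
      (fun q => Prod.ext rfl (hτ q)) (differentiableAt_id.prodMk (differentiableAt_const _)))
    (σ := fun s => x₀ + s • (z.1 - x₀)) (by fun_prop)
    (Y := fun s => (x₀ + s • (z.1 - x₀), τ)) (Y' := fun _ => (z.1 - x₀, 0))
    (B := 2 / (1 - R ^ 2) * ‖z.1 - x₀‖) (by positivity)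
    (fun s _ => (hσd s).prodMk (hasDerivAt_const _ _))
    (fun s hs => by
      rw [hypMetric_self, mul_pow]
      simp only
      have h1 := conf_le_of_norm_le hR1 (hσR s hs)
      have h2 := (conf_pos ((hσR s hs).trans_lt hR1)).le
      have h3 : conf (x₀ + s • (z.1 - x₀)) ^ 2 ≤ (2 / (1 - R ^ 2)) ^ 2 := by gcongr
      nlinarith [sq_nonneg ‖z.1 - x₀‖])
    (fun s _ q hq => Prod.ext hq (hτ q)) (q₀ := p₀) (by simp [hx₀])
  refine ⟨q, Prod.ext ?_ ((hτ q).trans hzτ.symm)⟩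
  simpa using hq

theorem hasDerivAt_log_one_add_div {r : ℝ} (h1 : r ∈ Ioo (-1 : ℝ) 1) :
    HasDerivAt (fun r : ℝ => Real.log ((1 + r) / (1 - r))) (2 / (1 - r ^ 2)) r := by
  have h2 : 0 < 1 + r := by linarith [h1.1]
  have h3 : 0 < 1 - r := by linarith [h1.2]
  have h4 := (((hasDerivAt_id r).const_add 1).div ((hasDerivAt_id r).const_sub 1) h3.ne').log
    (div_pos h2 h3).ne'
  refine h4.congr_deriv ?_
  have h5 : 1 - r ^ 2 = (1 + r) * (1 - r) := by ring
  simp only [id, Pi.div_apply]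
  rw [h5]
  field_simp
  ring

/-- The height is affine in `ρ`, so moving a point straight towards the axis has bounded speed on
the cone. The path lifts up to its endpoint, which would be a point of the hypersurface on the axis.
-/
theorem not_conical [IsManifold (𝓡 n) ∞ M] [T2Space M] [Nonempty M]
    (hX : IsImmersedHypersurface X) (hc : IsCompleteHypersurface X) (h0 : ∀ p, (X p).1 ≠ 0)
    {κ c : ℝ}
    (ht : ∀ p, (X p).2 = c + κ * Real.log ((1 + ‖(X p).1‖) / (1 - ‖(X p).1‖))) : False := by
  obtain ⟨p₀⟩ := (inferInstance : Nonempty M)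
  set x₀ := (X p₀).1 with hx₀
  have hx₀1 : ‖x₀‖ < 1 := hX.mem_hypProd p₀
  have hnorm : ∀ s ∈ Ico (0 : ℝ) 1, ‖(1 - s) • x₀‖ = (1 - s) * ‖x₀‖ := by
    intro s hs
    rw [norm_smul, Real.norm_eq_abs, abs_of_nonneg (sub_nonneg.2 hs.2.le)]
  have hle : ∀ s ∈ Ico (0 : ℝ) 1, (1 - s) * ‖x₀‖ ≤ ‖x₀‖ := by
    intro s hs
    nlinarith [norm_nonneg x₀, hs.1]
  have hnn : ∀ s ∈ Ico (0 : ℝ) 1, 0 ≤ (1 - s) * ‖x₀‖ := fun s hs =>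
    mul_nonneg (sub_nonneg.2 hs.2.le) (norm_nonneg _)
  have hdiff : ∀ p, DifferentiableAt ℝ (fun y : EuclideanSpace ℝ (Fin n) =>
      ((y, c + κ * Real.log ((1 + ‖y‖) / (1 - ‖y‖))) : Amb n)) (X p).1 := by
    intro p
    have hp : ‖(X p).1‖ < 1 := hX.mem_hypProd p
    refine differentiableAt_id.prodMk ((DifferentiableAt.const_mul ?_ _).const_add _)
    have h1 := hasDerivAt_log_one_add_div (r := ‖(X p).1‖)
      ⟨by linarith [norm_nonneg (X p).1], hp⟩
    exact (h1.comp_hasFDerivAt (X p).1 (hasFDerivAt_norm_of_ne_zero (h0 p))).differentiableAt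
  have hRpos : 0 < 1 - ‖x₀‖ ^ 2 := one_sub_norm_sq_pos hx₀1
  obtain ⟨q, hq⟩ := exists_apply_eq_endpoint hc hX.contMDiff_fst
    (fun p => injective_fderiv_of_comp hX hX.contMDiff_fst
      (Φ := fun y => (y, c + κ * Real.log ((1 + ‖y‖) / (1 - ‖y‖))))
      (fun q => Prod.ext rfl (ht q)) (hdiff p))
    (σ := fun s => (1 - s) • x₀) (by fun_prop)
    (Y := fun s => ((1 - s) • x₀,
      c + κ * Real.log ((1 + (1 - s) * ‖x₀‖) / (1 - (1 - s) * ‖x₀‖))))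
    (Y' := fun s => (-x₀, κ * (2 / (1 - ((1 - s) * ‖x₀‖) ^ 2) * (-‖x₀‖))))
    (B := 2 / (1 - ‖x₀‖ ^ 2) * ‖x₀‖ * (1 + |κ|)) (by positivity)
    (fun s hs => by
      have h1 : HasDerivAt (fun s : ℝ => (1 - s) * ‖x₀‖) (-‖x₀‖) s := by
        simpa using ((hasDerivAt_id s).const_sub 1).mul_const ‖x₀‖
      have h2 : HasDerivAt (fun s : ℝ => (1 - s) • x₀) (-x₀) s := by
        simpa using ((hasDerivAt_id s).const_sub 1).smul_const x₀
      have h3 := hasDerivAt_log_one_add_div (r := (1 - s) * ‖x₀‖)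
        ⟨by linarith [hnn s hs], (hle s hs).trans_lt hx₀1⟩
      have h4 : HasDerivAt (fun s : ℝ => Real.log ((1 + (1 - s) * ‖x₀‖) / (1 - (1 - s) * ‖x₀‖))) _ s :=
        HasDerivAt.comp (h₂ := fun r => Real.log ((1 + r) / (1 - r))) s h3 h1
      exact h2.prodMk ((h4.const_mul κ).const_add c))
    (fun s hs => by
      rw [hypMetric_self]
      simp only [norm_neg]
      have h1 : conf ((1 - s) • x₀) = 2 / (1 - ((1 - s) * ‖x₀‖) ^ 2) := by
        rw [conf, hnorm s hs]
      have h2 : conf ((1 - s) • x₀) ≤ 2 / (1 - ‖x₀‖ ^ 2) :=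
        conf_le_of_norm_le hx₀1 ((hnorm s hs).trans_le (hle s hs))
      have h3 : 0 < conf ((1 - s) • x₀) :=
        conf_pos (by rw [hnorm s hs]; exact (hle s hs).trans_lt hx₀1)
      rw [← h1]
      have h4 : conf ((1 - s) • x₀) ^ 2 ≤ (2 / (1 - ‖x₀‖ ^ 2)) ^ 2 := by gcongr
      have h5 : 1 + κ ^ 2 ≤ (1 + |κ|) ^ 2 := by
        rw [← sq_abs κ]; nlinarith [abs_nonneg κ]
      calc _ = conf ((1 - s) • x₀) ^ 2 * (‖x₀‖ ^ 2 * (1 + κ ^ 2)) := by ring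
        _ ≤ (2 / (1 - ‖x₀‖ ^ 2)) ^ 2 * (‖x₀‖ ^ 2 * (1 + |κ|) ^ 2) := by gcongr
        _ = _ := by ring)
    (fun s hs q hq => by
      refine Prod.ext hq ?_
      rw [ht q, hq, hnorm s hs]) (q₀ := p₀) (by simp [hx₀])
  exact h0 q (by simpa using hq)

/-- A complete rotational hypersurface lying in a connected hypersurface of revolution covers
it. -/
theorem range_eq_of_subset_revolution [IsManifold (𝓡 n) ∞ M] [T2Space M] [Nonempty M]
    (hn : 2 ≤ n) (hX : IsImmersedHypersurface X) (hc : IsCompleteHypersurface X)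
    (hrot : IsRotationInvariant (range X)) {I : Set ℝ} (hI : IsOpen I) (hIc : I.OrdConnected)
    {g : ℝ → ℝ} (hg : ContDiffOn ℝ ∞ g I) (hg0 : ∀ t ∈ I, 0 < g t) (hg1 : ∀ t ∈ I, g t < 1)
    (hXg : ∀ p, (X p).2 ∈ I ∧ ‖(X p).1‖ = g (X p).2) :
    range X = {p | p.2 ∈ I ∧ ‖p.1‖ = g p.2} := by
  refine Subset.antisymm (range_subset_iff.2 hXg) ?_
  rintro z ⟨hzI, hzg⟩
  obtain ⟨p₀⟩ := (inferInstance : Nonempty M)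
  have hne : ∀ p, (X p).1 ≠ 0 := fun p h => by
    have h1 := (hXg p).2
    rw [h, norm_zero] at h1
    exact (hg0 _ (hXg p).1).ne h1
  have hnormpos : ∀ p, 0 < ‖(X p).1‖ := fun p => norm_pos_iff.2 (hne p)
  -- Polar coordinates with radius `exp t` and direction `x / ‖x‖`: they unroll the hypersurface of
  -- revolution onto a spherical shell in `ℝⁿ`.
  set H : M → EuclideanSpace ℝ (Fin n) :=
    fun p => Real.exp (X p).2 • (‖(X p).1‖⁻¹ • (X p).1) with hHdef
  have hHn : ∀ p, ‖H p‖ = Real.exp (X p).2 := fun p => by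
    simp only [hHdef]
    rw [norm_smul, norm_smul, norm_inv, norm_norm, inv_mul_cancel₀ (hnormpos p).ne', mul_one,
      Real.norm_eq_abs, Real.abs_exp]
  have hHne : ∀ p, H p ≠ 0 := fun p => norm_ne_zero_iff.1 (by rw [hHn]; exact (Real.exp_pos _).ne')
  have hH : ContMDiff (𝓡 n) 𝓘(ℝ, EuclideanSpace ℝ (Fin n)) ∞ H := by
    intro p
    have h1 : ContDiffAt ℝ ∞ (fun z : Amb n => Real.exp z.2 • (‖z.1‖⁻¹ • z.1)) (X p) :=
      contDiffAt_snd.exp.smul (((contDiffAt_fst.norm ℝ (hne p)).inv (hnormpos p).ne').smul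
        contDiffAt_fst)
    exact ContMDiffAt.comp (I' := 𝓘(ℝ, Amb n))
      (g := fun z : Amb n => Real.exp z.2 • (‖z.1‖⁻¹ • z.1)) (f := X) p h1.contMDiffAt
      (hX.contMDiff p)
  have hgd : ∀ t ∈ I, HasDerivAt g (deriv g t) t := fun t ht =>
    ((hg.differentiableOn (by simp)).differentiableAt (hI.mem_nhds ht)).hasDerivAt
  have hlog : ∀ p, Real.log ‖H p‖ = (X p).2 := fun p => by rw [hHn, Real.log_exp]
  have hunit : ∀ p, ‖H p‖⁻¹ • H p = ‖(X p).1‖⁻¹ • (X p).1 := fun p => by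
    rw [hHn]
    simp only [hHdef]
    rw [smul_smul, inv_mul_cancel₀ (Real.exp_pos _).ne', one_smul]
  have hΦ : ∀ q, X q = (fun y : EuclideanSpace ℝ (Fin n) =>
      ((g (Real.log ‖y‖) • (‖y‖⁻¹ • y), Real.log ‖y‖) : Amb n)) (H q) := by
    intro q
    simp only
    rw [hlog, hunit, ← (hXg q).2, smul_smul, mul_inv_cancel₀ (hnormpos q).ne', one_smul]
  have hΦd : ∀ p, DifferentiableAt ℝ (fun y : EuclideanSpace ℝ (Fin n) =>
      ((g (Real.log ‖y‖) • (‖y‖⁻¹ • y), Real.log ‖y‖) : Amb n)) (H p) := by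
    intro p
    have h1 : DifferentiableAt ℝ (fun y : EuclideanSpace ℝ (Fin n) => ‖y‖) (H p) :=
      (hasFDerivAt_norm_of_ne_zero (hHne p)).differentiableAt
    have h2 := h1.log (norm_ne_zero_iff.2 (hHne p))
    have h3 : DifferentiableAt ℝ (fun y : EuclideanSpace ℝ (Fin n) => g (Real.log ‖y‖)) (H p) :=
      DifferentiableAt.comp (g := g) (H p)
        (by rw [hlog]; exact (hgd _ (hXg p).1).differentiableAt) h2
    exact (h3.smul ((h1.inv (norm_ne_zero_iff.2 (hHne p))).smul differentiableAt_id)).prodMk h2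
  set t₀ := (X p₀).2 with ht₀
  set ξ := ‖(X p₀).1‖⁻¹ • (X p₀).1 with hξ
  have hξ1 : ‖ξ‖ = 1 := by
    rw [hξ, norm_smul, norm_inv, norm_norm, inv_mul_cancel₀ (hnormpos p₀).ne']
  set ℓ : ℝ → ℝ := fun s => t₀ + s * (z.2 - t₀) with hℓ
  have hℓI : ∀ s ∈ Icc (0 : ℝ) 1, ℓ s ∈ I := by
    intro s hs
    have h1 : ℓ s = (1 - s) • t₀ + s • z.2 := by simp only [hℓ, smul_eq_mul]; ring
    rw [h1]
    exact hIc.convex (hXg p₀).1 hzI (sub_nonneg.2 hs.2) hs.1 (by ring)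
  have hℓd : ∀ s, HasDerivAt ℓ (z.2 - t₀) s := fun s => by
    simpa only [one_mul] using! ((hasDerivAt_id s).mul_const (z.2 - t₀)).const_add t₀
  have hℓc : Continuous ℓ := by fun_prop
  obtain ⟨B, hB⟩ := isCompact_Icc.exists_bound_of_continuousOn (s := Icc (0 : ℝ) 1)
    (f := fun s => (2 / (1 - g (ℓ s) ^ 2)) ^ 2 * ((z.2 - t₀) * deriv g (ℓ s)) ^ 2
      + (z.2 - t₀) ^ 2) (by
      have h1 : ContinuousOn (fun s => g (ℓ s)) (Icc 0 1) :=
        hg.continuousOn.comp hℓc.continuousOn hℓI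
      have h2 : ContinuousOn (fun s => deriv g (ℓ s)) (Icc 0 1) :=
        (hg.continuousOn_deriv_of_isOpen hI (by simp)).comp hℓc.continuousOn hℓI
      refine (((continuousOn_const.div (continuousOn_const.sub (h1.pow 2)) ?_).pow 2).mul
        ((continuousOn_const.mul h2).pow 2)).add continuousOn_const
      intro s hs
      have h3 := hg0 _ (hℓI s hs)
      have h4 := hg1 _ (hℓI s hs)
      change 1 - g (ℓ s) ^ 2 ≠ 0
      exact ne_of_gt (by nlinarith))
  have hB0 : 0 ≤ B := (norm_nonneg _).trans (hB 0 ⟨le_rfl, zero_le_one⟩)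
  obtain ⟨q, hq⟩ := exists_apply_eq_endpoint hc hH
    (fun p => injective_fderiv_of_comp hX hH hΦ (hΦd p))
    (σ := fun s => Real.exp (ℓ s) • ξ) (by fun_prop)
    (Y := fun s => (g (ℓ s) • ξ, ℓ s))
    (Y' := fun s => (((z.2 - t₀) * deriv g (ℓ s)) • ξ, z.2 - t₀))
    (B := √B) (Real.sqrt_nonneg _)
    (fun s hs => by
      have h1 := ((hgd _ (hℓI s ⟨hs.1, hs.2.le⟩)).comp s (hℓd s)).smul_const ξ
      rw [mul_comm] at h1
      exact h1.prodMk (hℓd s))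
    (fun s hs => by
      have hs' : s ∈ Icc (0 : ℝ) 1 := ⟨hs.1, hs.2.le⟩
      rw [Real.sq_sqrt hB0, hypMetric_self, conf]
      simp only [norm_smul, hξ1, mul_one, Real.norm_eq_abs, sq_abs]
      exact (le_abs_self _).trans (hB s hs'))
    (fun s hs q hq => by
      have h1 : ‖H q‖ = Real.exp (ℓ s) := by
        rw [hq, norm_smul, hξ1, mul_one, Real.norm_eq_abs, Real.abs_exp]
      have h2 : ‖H q‖⁻¹ • H q = ξ := by
        rw [h1, hq, smul_smul, inv_mul_cancel₀ (Real.exp_pos _).ne', one_smul]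
      rw [hΦ q]
      simp only
      rw [h2, h1, Real.log_exp]) (q₀ := p₀) (by simp [hℓ, hHdef, hξ, ht₀])
  have h1 : (X q).2 = z.2 := by
    have h2 : ‖H q‖ = Real.exp (ℓ 1) := by
      rw [hq, norm_smul, hξ1, mul_one, Real.norm_eq_abs, Real.abs_exp]
    rw [hHn] at h2
    rw [Real.exp_injective h2]
    simp [hℓ]
  -- The lifted meridian keeps the direction `ξ` and only attains the height of `z`; rotation
  -- invariance supplies the other directions.
  refine hrot.mem_of_norm_eq hn (mem_range_self q) ?_ h1
  rw [(hXg q).2, h1, hzg]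

end Global

/-! ### Quadrature of the generating curve by its angle. -/

section Profile

open Real intervalIntegral

/-- The derivative with respect to the angle, up to the factor `p`, of the height along the
generating curve with first integral `s`. -/
noncomputable def heightIntegrand (p s u : ℝ) : ℝ := s / √((cos u ^ 2) ^ p + s ^ 2)

/-- The height of the point at which the generating curve makes the angle `ψ` with the
vertical. -/
noncomputable def heightOfAngle (p s ψ : ℝ) : ℝ := p * ∫ u in (0 : ℝ)..ψ, heightIntegrand p s u

variable {p s : ℝ}

theorem cos_sq_rpow_mem_Icc (hp : 0 < p) (u : ℝ) : (cos u ^ 2) ^ p ∈ Icc (0 : ℝ) 1 :=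
  ⟨rpow_nonneg (sq_nonneg _) _, rpow_le_one (sq_nonneg _) (cos_sq_le_one u) hp.le⟩

theorem heightIntegrand_denom_pos (hs : 0 < s) (u : ℝ) : 0 < √((cos u ^ 2) ^ p + s ^ 2) :=
  sqrt_pos.2 (add_pos_of_nonneg_of_pos (rpow_nonneg (sq_nonneg _) _) (by positivity))

theorem heightIntegrand_pos (hs : 0 < s) (u : ℝ) : 0 < heightIntegrand p s u :=
  div_pos hs (heightIntegrand_denom_pos hs u)

theorem heightIntegrand_le_one (hs : 0 < s) (u : ℝ) : heightIntegrand p s u ≤ 1 := by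
  rw [heightIntegrand, div_le_one (heightIntegrand_denom_pos hs u)]
  exact le_sqrt_of_sq_le (le_add_of_nonneg_left (rpow_nonneg (sq_nonneg _) _))

theorem div_sqrt_le_heightIntegrand (hp : 0 < p) (hs : 0 < s) (u : ℝ) :
    s / √(1 + s ^ 2) ≤ heightIntegrand p s u := by
  have h := (cos_sq_rpow_mem_Icc hp u).2
  have h2 := heightIntegrand_denom_pos (p := p) hs u
  unfold heightIntegrand
  gcongr

theorem continuous_heightIntegrand (hp : 0 < p) (hs : 0 < s) :
    Continuous (heightIntegrand p s) :=
  continuous_const.div ((((continuous_cos.pow 2).rpow_const fun _ => Or.inr hp.le).add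
    continuous_const).sqrt) fun u => (heightIntegrand_denom_pos hs u).ne'

theorem hasDerivAt_heightOfAngle (hp : 0 < p) (hs : 0 < s) (ψ : ℝ) :
    HasDerivAt (heightOfAngle p s) (p * heightIntegrand p s ψ) ψ :=
  ((continuous_heightIntegrand hp hs).integral_hasStrictDerivAt 0 ψ).hasDerivAt.const_mul p

theorem continuous_heightOfAngle (hp : 0 < p) (hs : 0 < s) : Continuous (heightOfAngle p s) :=
  continuous_iff_continuousAt.2 fun ψ => (hasDerivAt_heightOfAngle hp hs ψ).continuousAt

theorem strictMono_heightOfAngle (hp : 0 < p) (hs : 0 < s) : StrictMono (heightOfAngle p s) :=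
  strictMono_of_deriv_pos fun ψ => by
    rw [(hasDerivAt_heightOfAngle hp hs ψ).deriv]
    exact mul_pos hp (heightIntegrand_pos hs ψ)

@[simp]
theorem heightOfAngle_zero : heightOfAngle p s 0 = 0 := by simp [heightOfAngle]

theorem heightOfAngle_neg (ψ : ℝ) : heightOfAngle p s (-ψ) = -heightOfAngle p s ψ := by
  have h := integral_comp_neg (a := 0) (b := ψ) (heightIntegrand p s)
  have h2 : (fun u => heightIntegrand p s (-u)) = heightIntegrand p s := by
    funext u; simp [heightIntegrand]
  rw [show (∫ u in (0 : ℝ)..ψ, heightIntegrand p s (-u)) = ∫ u in (0 : ℝ)..ψ, heightIntegrand p s u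
    by rw [← h2]; simp [heightIntegrand], neg_zero] at h
  rw [heightOfAngle, heightOfAngle, h, integral_symm]
  ring

/-- Obtained from `cos² ≤ 1`. The linear growth in `ψ` gives surjectivity onto the line, and at `ψ =
π / 2` the limit `s → ∞` identifies the supremum of the half heights. -/
theorem le_heightOfAngle (hp : 0 < p) (hs : 0 < s) {ψ : ℝ} (hψ : 0 ≤ ψ) :
    p * (s / √(1 + s ^ 2)) * ψ ≤ heightOfAngle p s ψ := by
  have h1 : ∫ u in (0 : ℝ)..ψ, s / √(1 + s ^ 2) ≤ ∫ u in (0 : ℝ)..ψ, heightIntegrand p s u :=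
    integral_mono_on hψ (by simp) ((continuous_heightIntegrand hp hs).intervalIntegrable _ _)
      fun u _ => div_sqrt_le_heightIntegrand hp hs u
  rw [integral_const, smul_eq_mul, sub_zero] at h1
  rw [heightOfAngle]
  nlinarith

/-- Because the integrand uses `(cos ^ 2) ^ p`, it makes sense at every angle. The height is thus a
homeomorphism of the whole line and has a global inverse, although only `|ψ| < π / 2` is geometric.
-/
theorem surjective_heightOfAngle (hp : 0 < p) (hs : 0 < s) :
    Function.Surjective (heightOfAngle p s) := by
  have hc : 0 < p * (s / √(1 + s ^ 2)) := by positivity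
  have htop : Tendsto (heightOfAngle p s) atTop atTop :=
    tendsto_atTop_mono' _ ((eventually_ge_atTop 0).mono fun ψ hψ => le_heightOfAngle hp hs hψ)
      (tendsto_id.const_mul_atTop hc)
  refine (continuous_heightOfAngle hp hs).surjective htop ?_
  have h1 := tendsto_neg_atTop_atBot.comp (htop.comp tendsto_neg_atBot_atTop)
  refine h1.congr fun ψ => ?_
  simp [heightOfAngle_neg]

/-- The angle of the generating curve with the vertical as a function of the height. -/
noncomputable def angleOfHeight (p s t : ℝ) : ℝ := Function.invFun (heightOfAngle p s) t

theorem heightOfAngle_angleOfHeight (hp : 0 < p) (hs : 0 < s) (t : ℝ) :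
    heightOfAngle p s (angleOfHeight p s t) = t :=
  Function.rightInverse_invFun (surjective_heightOfAngle hp hs) t

theorem angleOfHeight_heightOfAngle (hp : 0 < p) (hs : 0 < s) (ψ : ℝ) :
    angleOfHeight p s (heightOfAngle p s ψ) = ψ :=
  Function.leftInverse_invFun (strictMono_heightOfAngle hp hs).injective ψ

/-- `heightOfAngle p s` as a homeomorphism of the line. -/
noncomputable def heightHomeomorph (hp : 0 < p) (hs : 0 < s) : ℝ ≃ₜ ℝ :=
  ((strictMono_heightOfAngle hp hs).orderIsoOfRightInverse _ (angleOfHeight p s)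
    (heightOfAngle_angleOfHeight hp hs)).toHomeomorph

theorem strictMono_angleOfHeight (hp : 0 < p) (hs : 0 < s) : StrictMono (angleOfHeight p s) :=
  ((strictMono_heightOfAngle hp hs).orderIsoOfRightInverse _ (angleOfHeight p s)
    (heightOfAngle_angleOfHeight hp hs)).symm.strictMono

theorem continuous_angleOfHeight (hp : 0 < p) (hs : 0 < s) : Continuous (angleOfHeight p s) :=
  (heightHomeomorph hp hs).symm.continuous

theorem hasDerivAt_angleOfHeight (hp : 0 < p) (hs : 0 < s) (t : ℝ) :
    HasDerivAt (angleOfHeight p s) (p * heightIntegrand p s (angleOfHeight p s t))⁻¹ t :=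
  (hasDerivAt_heightOfAngle hp hs _).of_local_left_inverse
    (continuous_angleOfHeight hp hs).continuousAt (mul_pos hp (heightIntegrand_pos hs _)).ne'
    (Eventually.of_forall (heightOfAngle_angleOfHeight hp hs))

@[simp]
theorem angleOfHeight_zero (hp : 0 < p) (hs : 0 < s) : angleOfHeight p s 0 = 0 := by
  simpa using angleOfHeight_heightOfAngle hp hs 0

theorem angleOfHeight_neg (hp : 0 < p) (hs : 0 < s) (t : ℝ) :
    angleOfHeight p s (-t) = -angleOfHeight p s t := by
  apply (strictMono_heightOfAngle hp hs).injective
  rw [heightOfAngle_neg, heightOfAngle_angleOfHeight hp hs, heightOfAngle_angleOfHeight hp hs]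

theorem angleOfHeight_mem_Ioo (hp : 0 < p) (hs : 0 < s) {t : ℝ} :
    angleOfHeight p s t ∈ Ioo (-(π / 2)) (π / 2) ↔
      t ∈ Ioo (-heightOfAngle p s (π / 2)) (heightOfAngle p s (π / 2)) := by
  rw [← heightOfAngle_neg]
  constructor <;> intro h
  · have h1 := strictMono_heightOfAngle hp hs h.1
    have h2 := strictMono_heightOfAngle hp hs h.2
    rw [heightOfAngle_angleOfHeight hp hs] at h1 h2
    exact ⟨h1, h2⟩
  · have h1 := strictMono_angleOfHeight hp hs h.1
    have h2 := strictMono_angleOfHeight hp hs h.2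
    rw [angleOfHeight_heightOfAngle hp hs] at h1 h2
    exact ⟨h1, h2⟩

/-- Restricted to the open interval on which the cosine is positive, because for real `p` the
function `(cos ^ 2) ^ p` need not be smooth at its zeros. -/
theorem contDiffOn_heightOfAngle (hp : 0 < p) (hs : 0 < s) :
    ContDiffOn ℝ ∞ (heightOfAngle p s) (Ioo (-(π / 2)) (π / 2)) := by
  refine (contDiffOn_infty_iff_deriv_of_isOpen isOpen_Ioo).2
    ⟨fun ψ _ => (hasDerivAt_heightOfAngle hp hs ψ).differentiableAt.differentiableWithinAt, ?_⟩
  have h1 : deriv (heightOfAngle p s) = fun ψ => p * heightIntegrand p s ψ :=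
    funext fun ψ => (hasDerivAt_heightOfAngle hp hs ψ).deriv
  rw [h1]
  intro ψ hψ
  have h2 : 0 < cos ψ := cos_pos_of_mem_Ioo hψ
  have h3 : ContDiffAt ℝ ∞ (fun ψ => (cos ψ ^ 2) ^ p + s ^ 2) ψ :=
    ((contDiff_cos.contDiffAt.pow 2).rpow_const_of_ne (by positivity)).add contDiffAt_const
  exact (contDiffAt_const.mul (contDiffAt_const.div
    (h3.sqrt (sqrt_pos.1 (heightIntegrand_denom_pos hs ψ)).ne')
    (heightIntegrand_denom_pos hs ψ).ne')).contDiffWithinAt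

theorem contDiffAt_angleOfHeight (hp : 0 < p) (hs : 0 < s) {t : ℝ}
    (ht : t ∈ Ioo (-heightOfAngle p s (π / 2)) (heightOfAngle p s (π / 2))) :
    ContDiffAt ℝ ∞ (angleOfHeight p s) t :=
  (heightHomeomorph hp hs).toOpenPartialHomeomorph.contDiffAt_symm_deriv
    (mul_pos hp (heightIntegrand_pos hs (angleOfHeight p s t))).ne' (mem_univ t)
    (hasDerivAt_heightOfAngle hp hs _)
    ((contDiffOn_heightOfAngle hp hs).contDiffAt
      (isOpen_Ioo.mem_nhds ((angleOfHeight_mem_Ioo hp hs).2 ht)))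

/-! ### The catenoid profile and its differential equation. -/

/-- Half of the height of the catenoid with neck radius `a`. -/
noncomputable def halfHeight (p a : ℝ) : ℝ := heightOfAngle p (sinh a) (π / 2)

/-- The distance to the axis along the generating curve of the catenoid with neck radius `a`. -/
noncomputable def profile (p a t : ℝ) : ℝ :=
  arsinh (sinh a / cos (angleOfHeight p (sinh a) t) ^ p)

variable {a t : ℝ}

theorem halfHeight_pos (hp : 0 < p) (ha : 0 < a) : 0 < halfHeight p a := by
  have h := strictMono_heightOfAngle hp (sinh_pos_iff.2 ha) pi_div_two_pos
  rwa [heightOfAngle_zero] at h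

theorem cos_angleOfHeight_pos (hp : 0 < p) (ha : 0 < a)
    (ht : t ∈ Ioo (-halfHeight p a) (halfHeight p a)) :
    0 < cos (angleOfHeight p (sinh a) t) :=
  cos_pos_of_mem_Ioo ((angleOfHeight_mem_Ioo hp (sinh_pos_iff.2 ha)).2 ht)

theorem sinh_profile : sinh (profile p a t) = sinh a / cos (angleOfHeight p (sinh a) t) ^ p :=
  sinh_arsinh _

theorem le_profile (hp : 0 < p) (ha : 0 < a) (ht : t ∈ Ioo (-halfHeight p a) (halfHeight p a)) :
    a ≤ profile p a t := by
  have h1 := cos_angleOfHeight_pos hp ha ht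
  rw [← sinh_le_sinh, sinh_profile, le_div_iff₀ (rpow_pos_of_pos h1 _)]
  exact mul_le_of_le_one_right (sinh_pos_iff.2 ha).le (rpow_le_one h1.le (cos_le_one _) hp.le)

theorem profile_pos (hp : 0 < p) (ha : 0 < a) (ht : t ∈ Ioo (-halfHeight p a) (halfHeight p a)) :
    0 < profile p a t := ha.trans_le (le_profile hp ha ht)

theorem profile_zero (hp : 0 < p) (ha : 0 < a) : profile p a 0 = a := by
  simp [profile, angleOfHeight_zero hp (sinh_pos_iff.2 ha), arsinh_sinh]

theorem profile_neg (hp : 0 < p) (ha : 0 < a) (t : ℝ) : profile p a (-t) = profile p a t := by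
  simp [profile, angleOfHeight_neg hp (sinh_pos_iff.2 ha)]

theorem profile_eq_iff (hp : 0 < p) (ha : 0 < a)
    (ht : t ∈ Ioo (-halfHeight p a) (halfHeight p a)) : profile p a t = a ↔ t = 0 := by
  refine ⟨fun h => ?_, fun h => h ▸ profile_zero hp ha⟩
  have h1 := cos_angleOfHeight_pos hp ha ht
  have h2 := sinh_pos_iff.2 ha
  have h3 := sinh_profile (p := p) (a := a) (t := t)
  rw [h, eq_div_iff (rpow_pos_of_pos h1 _).ne', mul_eq_left₀ h2.ne',
    ← one_rpow p, rpow_left_inj h1.le zero_le_one hp.ne'] at h3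
  have h4 := (angleOfHeight_mem_Ioo hp h2).2 ht
  have h5 := (cos_eq_one_iff_of_lt_of_lt (by linarith [h4.1, pi_pos]) (by linarith [h4.2, pi_pos])).1 h3
  rw [← heightOfAngle_angleOfHeight hp h2 t, h5, heightOfAngle_zero]

theorem contDiffOn_profile (hp : 0 < p) (ha : 0 < a) :
    ContDiffOn ℝ ∞ (profile p a) (Ioo (-halfHeight p a) (halfHeight p a)) := by
  intro t ht
  have h1 := cos_angleOfHeight_pos hp ha ht
  exact ((contDiffAt_const.div ((contDiffAt_angleOfHeight hp (sinh_pos_iff.2 ha) ht).cos.rpow_const_of_ne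
    h1.ne') (rpow_pos_of_pos h1 _).ne').arsinh (n := ⊤)).contDiffWithinAt

/-- With `s = sinh ρ cos^p ψ` the root becomes `cosh ρ cos^p ψ`. This turns the quadrature into `dt
= p tanh ρ dψ`. -/
theorem heightIntegrand_eq_tanh {ψ ρ : ℝ} (hs : 0 < s) (hψ : 0 < cos ψ)
    (hρ : sinh ρ = s / cos ψ ^ p) : heightIntegrand p s ψ = tanh ρ := by
  have h1 : 0 < cos ψ ^ p := rpow_pos_of_pos hψ _
  have h2 : (cos ψ ^ 2) ^ p = (cos ψ ^ p) ^ 2 := by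
    rw [← rpow_natCast, ← rpow_natCast, ← rpow_mul hψ.le, ← rpow_mul hψ.le, mul_comm]
  have h3 : s = sinh ρ * cos ψ ^ p := by rw [hρ]; field_simp
  have h4 : √((cos ψ ^ 2) ^ p + s ^ 2) = cosh ρ * cos ψ ^ p := by
    rw [sqrt_eq_iff_mul_self_eq_of_pos (by positivity), h2, h3]
    nlinarith [cosh_sq ρ]
  rw [heightIntegrand, h4, tanh_eq_sinh_div_cosh]
  nth_rewrite 1 [h3]
  field_simp

theorem hasDerivAt_angleOfHeight_profile (hp : 0 < p) (ha : 0 < a)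
    (ht : t ∈ Ioo (-halfHeight p a) (halfHeight p a)) :
    HasDerivAt (angleOfHeight p (sinh a)) (cosh (profile p a t) / (p * sinh (profile p a t))) t := by
  have h := hasDerivAt_angleOfHeight hp (sinh_pos_iff.2 ha) t
  rw [heightIntegrand_eq_tanh (sinh_pos_iff.2 ha) (cos_angleOfHeight_pos hp ha ht) sinh_profile,
    tanh_eq_sinh_div_cosh] at h
  refine h.congr_deriv ?_
  rw [mul_div_assoc', inv_div]

/-- Differentiate `sinh ρ cos^p ψ = sinh a`, using `dψ/dt = coth ρ / p`. -/
theorem hasDerivAt_profile (hp : 0 < p) (ha : 0 < a)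
    (ht : t ∈ Ioo (-halfHeight p a) (halfHeight p a)) :
    HasDerivAt (profile p a) (tan (angleOfHeight p (sinh a) t)) t := by
  have h1 := cos_angleOfHeight_pos hp ha ht
  have h0 := sinh_pos_iff.2 ha
  have hP := rpow_pos_of_pos h1 p
  have h2 := (hasDerivAt_angleOfHeight_profile hp ha ht).cos.rpow_const (p := p) (Or.inl h1.ne')
  have h3 := (((hasDerivAt_const t (sinh a)).div h2 hP.ne').arsinh)
  refine h3.congr_deriv ?_
  have h4 : √(1 + (sinh a / cos (angleOfHeight p (sinh a) t) ^ p) ^ 2) = cosh (profile p a t) := by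
    rw [profile, cosh_arsinh]
  have h5 : 0 < sinh (profile p a t) := sinh_pos_iff.2 (profile_pos hp ha ht)
  have h6 : sinh a = sinh (profile p a t) * cos (angleOfHeight p (sinh a) t) ^ p := by
    rw [sinh_profile]; field_simp
  simp only [Pi.div_apply]
  rw [h4, rpow_sub_one h1.ne', tan_eq_sin_div_cos, smul_eq_mul]
  have h7 := cosh_pos (profile p a t)
  clear h2 h3 h4
  generalize angleOfHeight p (sinh a) t = θ at *
  generalize profile p a t = ρ at *
  generalize cos θ ^ p = P at *
  generalize sinh a = S at *
  subst h6
  field_simp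
  ring

/-- The slope is `tan ψ`, whose derivative is `(1 + tan² ψ) dψ/dt`. With `p = (r+1)/(n-r-1)` this is
the equation required by `meanCurv_revolutionMap`. -/
theorem hasDerivAt_deriv_profile (hp : 0 < p) (ha : 0 < a)
    (ht : t ∈ Ioo (-halfHeight p a) (halfHeight p a)) :
    HasDerivAt (deriv (profile p a))
      (cosh (profile p a t) / (p * sinh (profile p a t)) * (1 + deriv (profile p a) t ^ 2)) t := by
  have h1 := cos_angleOfHeight_pos hp ha ht
  have h2 : deriv (profile p a) =ᶠ[𝓝 t] fun t => tan (angleOfHeight p (sinh a) t) := by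
    filter_upwards [isOpen_Ioo.mem_nhds ht] with t' ht'
    exact (hasDerivAt_profile hp ha ht').deriv
  refine HasDerivAt.congr_of_eventuallyEq ?_ h2
  refine ((hasDerivAt_tan h1.ne').comp t (hasDerivAt_angleOfHeight_profile hp ha ht)).congr_deriv ?_
  rw [h2.self_of_nhds]
  simp only
  rw [tan_eq_sin_div_cos, div_pow, mul_comm]
  congr 1
  field_simp
  linarith [sin_sq_add_cos_sq (angleOfHeight p (sinh a) t)]

/-- The profile blows up at both ends, in a form suited to closure arguments. Clearing the
denominator turns the bound into a closed condition on `Icc`, which fails at the ends since there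
the cosine vanishes and `sinh a > 0`. -/
theorem isClosed_profile_le (hp : 0 < p) (ha : 0 < a) (R : ℝ) :
    IsClosed {t | t ∈ Ioo (-halfHeight p a) (halfHeight p a) ∧ profile p a t ≤ R} := by
  have h0 := sinh_pos_iff.2 ha
  have h1 : {t | t ∈ Ioo (-halfHeight p a) (halfHeight p a) ∧ profile p a t ≤ R} =
      {t | t ∈ Icc (-halfHeight p a) (halfHeight p a) ∧
        sinh a ≤ sinh R * cos (angleOfHeight p (sinh a) t) ^ p} := by
    ext t
    constructor
    · rintro ⟨h2, h3⟩
      refine ⟨Ioo_subset_Icc_self h2, ?_⟩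
      rwa [← sinh_le_sinh, sinh_profile,
        div_le_iff₀ (rpow_pos_of_pos (cos_angleOfHeight_pos hp ha h2) _)] at h3
    · rintro ⟨h2, h3⟩
      have h4 : t ∈ Ioo (-halfHeight p a) (halfHeight p a) := by
        refine ⟨lt_of_le_of_ne h2.1 ?_, lt_of_le_of_ne h2.2 ?_⟩
        · intro h
          rw [← h, angleOfHeight_neg hp h0, halfHeight, angleOfHeight_heightOfAngle hp h0, cos_neg,
            cos_pi_div_two, zero_rpow hp.ne'] at h3
          linarith
        · intro h
          rw [h, halfHeight, angleOfHeight_heightOfAngle hp h0,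
            cos_pi_div_two, zero_rpow hp.ne'] at h3
          linarith
      refine ⟨h4, ?_⟩
      rwa [← sinh_le_sinh, sinh_profile,
        div_le_iff₀ (rpow_pos_of_pos (cos_angleOfHeight_pos hp ha h4) _)]
  rw [h1]
  exact isClosed_Icc.inter (isClosed_le continuous_const (continuous_const.mul
    ((continuous_cos.comp (continuous_angleOfHeight hp h0)).rpow_const fun _ => Or.inr hp.le)))

/-! ### Dependence on the neck radius: heights and crossings. -/

theorem heightIntegrand_lt {s₁ s₂ u : ℝ} (h1 : 0 < s₁) (h2 : s₁ < s₂) (hu : 0 < cos u) :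
    heightIntegrand p s₁ u < heightIntegrand p s₂ u := by
  have hc : 0 < (cos u ^ 2) ^ p := by positivity
  rw [heightIntegrand, heightIntegrand, div_lt_div_iff₀ (heightIntegrand_denom_pos h1 u)
    (heightIntegrand_denom_pos (h1.trans h2) u), ← sqrt_sq h1.le, ← sqrt_sq (h1.trans h2).le,
    ← sqrt_mul (sq_nonneg _), ← sqrt_mul (sq_nonneg _), sqrt_sq h1.le, sqrt_sq (h1.trans h2).le]
  refine sqrt_lt_sqrt (by positivity) ?_
  have h3 : s₁ ^ 2 < s₂ ^ 2 := by nlinarith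
  nlinarith

theorem strictMonoOn_halfHeight (hp : 0 < p) : StrictMonoOn (halfHeight p) (Ioi 0) := by
  intro a ha b hb hab
  have h1 := sinh_pos_iff.2 ha
  have h2 := sinh_lt_sinh.2 hab
  refine mul_lt_mul_of_pos_left ?_ hp
  refine integral_lt_integral_of_continuousOn_of_le_of_exists_lt pi_div_two_pos
    (continuous_heightIntegrand hp h1).continuousOn
    (continuous_heightIntegrand hp (h1.trans h2)).continuousOn (fun u hu => ?_)
    ⟨0, ⟨le_rfl, pi_div_two_pos.le⟩, heightIntegrand_lt h1 h2 (by simp)⟩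
  -- At `π / 2` the cosine vanishes and both integrands equal one, so the comparison is not strict
  -- there.
  rcases hu.2.eq_or_lt with rfl | hlt
  · rw [heightIntegrand, heightIntegrand, cos_pi_div_two]
    simp [zero_rpow hp.ne', sqrt_sq h1.le, sqrt_sq (h1.trans h2).le, h1.ne', (h1.trans h2).ne']
  · exact (heightIntegrand_lt h1 h2 (cos_pos_of_mem_Ioo ⟨by linarith [hu.1, pi_pos], hlt⟩)).le

theorem halfHeight_lt (hp : 0 < p) (ha : 0 < a) : halfHeight p a < p * (π / 2) := by
  refine mul_lt_mul_of_pos_left ?_ hp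
  have h1 := sinh_pos_iff.2 ha
  have h2 : ∫ _ in (0 : ℝ)..π / 2, (1 : ℝ) = π / 2 := by simp
  refine lt_of_lt_of_eq ?_ h2
  refine integral_lt_integral_of_continuousOn_of_le_of_exists_lt pi_div_two_pos
    (continuous_heightIntegrand hp h1).continuousOn continuousOn_const
    (fun u _ => heightIntegrand_le_one h1 u) ⟨0, ⟨le_rfl, pi_div_two_pos.le⟩, ?_⟩
  rw [heightIntegrand, div_lt_one (heightIntegrand_denom_pos h1 0)]
  refine lt_sqrt_of_sq_lt ?_
  simp

theorem continuous_heightOfAngle_pi_div_two :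
    Continuous fun s => heightOfAngle p s (π / 2) := by
  refine continuous_const.mul (continuous_of_dominated_interval (bound := fun _ => 1)
    (fun s => ?_) (fun s => Eventually.of_forall fun u _ => ?_) (by simp) ?_)
  · refine Measurable.aestronglyMeasurable ?_
    unfold heightIntegrand
    fun_prop
  · rw [heightIntegrand, norm_eq_abs, abs_div, abs_of_nonneg (sqrt_nonneg _)]
    refine div_le_one_of_le₀ ?_ (sqrt_nonneg _)
    rw [← sqrt_sq_eq_abs]
    exact sqrt_le_sqrt (le_add_of_nonneg_left (rpow_nonneg (sq_nonneg _) _))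
  -- At `u = π / 2` the integrand is `s / |s|`, discontinuous at `s = 0`; this single point is
  -- discarded. Continuity at `s = 0` is what makes the infimum of the half heights zero.
  · have h1 : ∀ᵐ u : ℝ ∂MeasureTheory.volume, u ≠ π / 2 := by
      simp [MeasureTheory.ae_iff]
    filter_upwards [h1] with u hu hmem
    rw [uIoc_of_le pi_div_two_pos.le] at hmem
    have h2 : 0 < cos u :=
      cos_pos_of_mem_Ioo ⟨by linarith [hmem.1, pi_pos], lt_of_le_of_ne hmem.2 hu⟩
    unfold heightIntegrand
    refine continuous_id.div (by fun_prop) fun s => ?_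
    have h3 : 0 < (cos u ^ 2) ^ p := by positivity
    positivity

/-- The height at `π / 2` is continuous in `s`, zero at `s = 0`, and bounded below by a quantity
tending to `p π / 2`, so the intermediate value theorem applies. -/
theorem range_halfHeight (hp : 0 < p) :
    halfHeight p '' Ioi 0 = Ioo 0 (p * (π / 2)) := by
  refine Subset.antisymm ?_ ?_
  · rintro _ ⟨a, ha, rfl⟩
    exact ⟨halfHeight_pos hp ha, halfHeight_lt hp ha⟩
  · intro L hL
    have hF := continuous_heightOfAngle_pi_div_two (p := p)
    have h0 : heightOfAngle p 0 (π / 2) = 0 := by simp [heightOfAngle, heightIntegrand]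
    have h1 : Tendsto (fun s : ℝ => p * (s / √(1 + s ^ 2)) * (π / 2)) atTop (𝓝 (p * 1 * (π / 2))) := by
      have h2 : Tendsto (fun s : ℝ => s / √(1 + s ^ 2)) atTop (𝓝 1) := by
        have h3 : Tendsto (fun s : ℝ => √(1 - (1 + s ^ 2)⁻¹)) atTop (𝓝 (√(1 - 0))) := by
          have h4 : Tendsto (fun s : ℝ => 1 + s ^ 2) atTop atTop :=
            tendsto_atTop_add_const_left _ _ (tendsto_pow_atTop (by norm_num))
          exact (tendsto_const_nhds.sub h4.inv_tendsto_atTop).sqrt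
        rw [sub_zero, sqrt_one] at h3
        refine h3.congr' ((eventually_gt_atTop 0).mono fun s hs => ?_)
        rw [eq_div_iff (by positivity), ← sqrt_mul (by
          rw [sub_nonneg]; exact inv_le_one_of_one_le₀ (by nlinarith)), sub_mul,
          inv_mul_cancel₀ (by positivity), one_mul, add_sub_cancel_left, sqrt_sq hs.le]
      exact (h2.const_mul p).mul_const _
    rw [mul_one] at h1
    obtain ⟨s, hs, hs0⟩ := ((h1.eventually (lt_mem_nhds hL.2)).and (eventually_gt_atTop 0)).exists
    have h2 : L < heightOfAngle p s (π / 2) := hs.trans_le (le_heightOfAngle hp hs0 pi_div_two_pos.le)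
    obtain ⟨c, hc, hcL⟩ := intermediate_value_Icc hs0.le hF.continuousOn
      (show L ∈ Icc (heightOfAngle p 0 (π / 2)) (heightOfAngle p s (π / 2)) from
        ⟨h0.symm ▸ hL.1.le, h2.le⟩)
    have hc0 : 0 < c := lt_of_le_of_ne hc.1 (by
      rintro rfl
      exact hL.1.ne (by rw [← hcL]; exact h0.symm))
    refine ⟨arsinh c, arsinh_pos_iff.2 hc0, ?_⟩
    rw [halfHeight, sinh_arsinh]
    exact hcL

theorem eventually_lt_profile (hp : 0 < p) (ha : 0 < a) (R : ℝ) :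
    ∀ᶠ t in 𝓝[<] halfHeight p a, R < profile p a t := by
  have h1 := (isClosed_profile_le hp ha R).isOpen_compl.mem_nhds
    (x := halfHeight p a) (fun h => lt_irrefl _ h.1.2)
  have h2 : Ioo (-halfHeight p a) (halfHeight p a) ∈ 𝓝[<] halfHeight p a :=
    Ioo_mem_nhdsLT (by linarith [halfHeight_pos hp ha])
  filter_upwards [mem_nhdsWithin_of_mem_nhds h1, h2] with t h3 h4
  by_contra h5
  exact h3 ⟨h4, not_lt.1 h5⟩

/-- At a crossing of two generating curves above the necks, the one with the smaller neck
is the steeper. -/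
theorem deriv_profile_lt_of_eq {b : ℝ} (hp : 0 < p) (ha : 0 < a) (hab : a < b)
    (ht : t ∈ Ioo 0 (halfHeight p a)) (h : profile p a t = profile p b t) :
    deriv (profile p b) t < deriv (profile p a) t := by
  have hb := ha.trans hab
  have hLL := strictMonoOn_halfHeight hp ha hb hab
  have hta : t ∈ Ioo (-halfHeight p a) (halfHeight p a) := ⟨by linarith [ht.1, ht.2], ht.2⟩
  have htb : t ∈ Ioo (-halfHeight p b) (halfHeight p b) :=
    ⟨by linarith [ht.1, ht.2], ht.2.trans hLL⟩
  rw [(hasDerivAt_profile hp ha hta).deriv, (hasDerivAt_profile hp hb htb).deriv]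
  have h1 := cos_angleOfHeight_pos hp ha hta
  have h2 := cos_angleOfHeight_pos hp hb htb
  have h3 := congrArg sinh h
  rw [sinh_profile, sinh_profile, div_eq_div_iff (rpow_pos_of_pos h1 _).ne'
    (rpow_pos_of_pos h2 _).ne'] at h3
  have h4 := sinh_lt_sinh.2 hab
  have h5 := sinh_pos_iff.2 ha
  -- Both curves have the same `ρ` here, so in `sinh ρ cos^p ψ = sinh a` the smaller neck has the
  -- smaller cosine, hence the larger angle.
  have h6 : cos (angleOfHeight p (sinh a) t) ^ p < cos (angleOfHeight p (sinh b) t) ^ p := by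
    have := rpow_pos_of_pos h1 p
    by_contra h7
    nlinarith
  rw [rpow_lt_rpow_iff h1.le h2.le hp] at h6
  have h7 := (angleOfHeight_mem_Ioo hp h5).2 hta
  have h8 := (angleOfHeight_mem_Ioo hp (h5.trans h4)).2 htb
  have h9 : 0 < angleOfHeight p (sinh a) t := by
    rw [← angleOfHeight_zero hp h5]; exact strictMono_angleOfHeight hp h5 ht.1
  have h10 : 0 < angleOfHeight p (sinh b) t := by
    rw [← angleOfHeight_zero hp (h5.trans h4)]; exact strictMono_angleOfHeight hp (h5.trans h4) ht.1
  refine tan_lt_tan_of_lt_of_lt_pi_div_two h8.1 h7.2 ?_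
  by_contra h11
  exact absurd h6 (not_lt.2 (cos_le_cos_of_nonneg_of_le_pi h9.le (by linarith [h8.2, pi_pos]) (not_lt.1 h11)))

/-- The curve with neck `a` starts below the other one at `t = 0` and tends to infinity where the
other is still finite, so they cross. At every crossing with `t > 0` the difference of the profiles
has a derivative of the same sign, so a second one is impossible; evenness gives the mirror
crossing. -/
theorem exists_unique_crossing {b : ℝ} (hp : 0 < p) (ha : 0 < a) (hab : a < b) :
    ∃ t₀ ∈ Ioo 0 (halfHeight p a), ∀ t ∈ Ioo (-halfHeight p a) (halfHeight p a),
      profile p a t = profile p b t ↔ t = t₀ ∨ t = -t₀ := by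
  have hb := ha.trans hab
  have hLL := strictMonoOn_halfHeight hp ha hb hab
  have hL := halfHeight_pos hp ha
  have hsub : Ioo (-halfHeight p a) (halfHeight p a) ⊆ Ioo (-halfHeight p b) (halfHeight p b) :=
    Ioo_subset_Ioo (by linarith) hLL.le
  have hca := (contDiffOn_profile hp ha).continuousOn
  have hcb := (contDiffOn_profile hp hb).continuousOn
  obtain ⟨B, hB⟩ := isCompact_Icc.exists_bound_of_continuousOn (s := Icc 0 (halfHeight p a))
    (f := profile p b) (hcb.mono fun t ht => ⟨by linarith [ht.1], ht.2.trans_lt hLL⟩)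
  obtain ⟨t₁, h1, h2⟩ := ((eventually_lt_profile hp ha B).and
    (Ioo_mem_nhdsLT hL : Ioo 0 (halfHeight p a) ∈ 𝓝[<] halfHeight p a)).exists
  have hd : ContinuousOn (fun t => profile p b t - profile p a t)
      (Ioo (-halfHeight p a) (halfHeight p a)) := (hcb.mono hsub).sub hca
  have hsub' : ∀ {t}, t ∈ Icc 0 t₁ → t ∈ Ioo (-halfHeight p a) (halfHeight p a) := fun ht =>
    ⟨by linarith [ht.1], ht.2.trans_lt h2.2⟩
  obtain ⟨t₀, ht₀, h3⟩ := intermediate_value_Icc' h2.1.le (hd.mono fun t ht => hsub' ht)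
    (show (0 : ℝ) ∈ Icc _ _ from ⟨by
      have := (le_abs_self _).trans (hB t₁ ⟨h2.1.le, h2.2.le⟩); linarith, by
      simp only [profile_zero hp ha, profile_zero hp hb]; linarith⟩)
  simp only at h3
  have ht₀0 : 0 < t₀ := lt_of_le_of_ne ht₀.1 (by
    rintro rfl
    rw [profile_zero hp ha, profile_zero hp hb] at h3
    linarith)
  have hderiv : ∀ t ∈ Ioo (-halfHeight p a) (halfHeight p a),
      HasDerivAt (fun t => profile p b t - profile p a t)
        (deriv (profile p b) t - deriv (profile p a) t) t := fun t ht =>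
    (hasDerivAt_profile hp hb (hsub ht)).differentiableAt.hasDerivAt.sub
      (hasDerivAt_profile hp ha ht).differentiableAt.hasDerivAt
  have huniq : ∀ x y, 0 < x → x < y → y < halfHeight p a → profile p a x = profile p b x →
      profile p a y ≠ profile p b y := by
    intro x y hx hxy hy hxe hye
    have hI : ∀ {t}, t ∈ Icc x y → t ∈ Ioo (-halfHeight p a) (halfHeight p a) := fun ht =>
      ⟨by linarith [ht.1], ht.2.trans_lt hy⟩
    -- After the zero at `x` the difference cannot become positive, as its derivative is negative at
    -- each of its zeros. The negative derivative at `y` would however force positive values just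
    -- before `y`.
    have h4 := image_le_of_deriv_right_lt_deriv_boundary (a := x) (b := y) (B := fun _ => 0)
      (B' := fun _ => 0) (hd.mono fun t ht => hI ht)
      (fun t ht => (hderiv t (hI ⟨ht.1, ht.2.le⟩)).hasDerivWithinAt)
      (by simp [hxe]) (fun t => hasDerivAt_const _ _) (fun t ht he => by
        have := deriv_profile_lt_of_eq hp ha hab (t := t)
          ⟨hx.trans_le ht.1, ht.2.trans hy⟩ (by linarith)
        linarith)
    have h5 := deriv_profile_lt_of_eq hp ha hab (t := y) ⟨hx.trans hxy, hy⟩ hye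
    have h6 := (hderiv y (hI ⟨hxy.le, le_rfl⟩)).tendsto_slope
    have h7 := (h6.eventually (gt_mem_nhds (show _ < (0 : ℝ) by linarith)))
    have h8 : ∀ᶠ t in 𝓝[<] y, slope (fun t => profile p b t - profile p a t) y t < 0 :=
      h7.filter_mono (nhdsWithin_mono _ fun t ht => ne_of_lt ht)
    obtain ⟨t, h9, h10⟩ := (h8.and (Ioo_mem_nhdsLT hxy : Ioo x y ∈ 𝓝[<] y)).exists
    have h11 := h4 (x := t) ⟨h10.1.le, h10.2.le⟩
    rw [slope_def_field, hye, sub_self, sub_zero] at h9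
    have h12 : 0 ≤ (profile p b t - profile p a t) / (t - y) :=
      div_nonneg_of_nonpos h11 (by linarith [h10.2])
    linarith
  have ht₀L : t₀ < halfHeight p a := ht₀.2.trans_lt h2.2
  have hpos : ∀ t, 0 < t → t < halfHeight p a → profile p a t = profile p b t → t = t₀ := by
    intro t ht htL he
    rcases lt_trichotomy t t₀ with h | h | h
    · exact absurd (by linarith) (huniq t t₀ ht h ht₀L he)
    · exact h
    · exact absurd he (huniq t₀ t ht₀0 h htL (by linarith))
  refine ⟨t₀, ⟨ht₀0, ht₀L⟩, fun t ht => ⟨fun he => ?_, ?_⟩⟩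
  · rcases lt_trichotomy t 0 with h | h | h
    · right
      rw [← profile_neg hp ha t, ← profile_neg hp hb t] at he
      linarith [hpos (-t) (by linarith) (by linarith [ht.1]) he]
    · rw [h, profile_zero hp ha, profile_zero hp hb] at he
      exact absurd he hab.ne
    · exact Or.inl (hpos t h ht.2 he)
  · rintro (rfl | rfl)
    · linarith
    · rw [profile_neg hp ha, profile_neg hp hb]; linarith

end Profile

/-! ### Euclidean radius versus hyperbolic distance. -/

theorem tanh_half (ρ : ℝ) : Real.tanh (ρ / 2) = Real.sinh ρ / (1 + Real.cosh ρ) := by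
  have h1 : ρ = 2 * (ρ / 2) := by ring
  have h2 := Real.cosh_pos (ρ / 2)
  rw [Real.tanh_eq_sinh_div_cosh]
  nth_rewrite 3 [h1]
  nth_rewrite 4 [h1]
  rw [Real.sinh_two_mul, Real.cosh_two_mul, Real.sinh_sq]
  rw [div_eq_div_iff h2.ne' (by nlinarith [sq_nonneg (Real.cosh (ρ / 2))])]
  ring

theorem norm_eq_tanh_iff {n : ℕ} {x : EuclideanSpace ℝ (Fin n)} (hx : ‖x‖ < 1) {ρ : ℝ} :
    ‖x‖ = Real.tanh (ρ / 2) ↔ sinhDist x = Real.sinh ρ := by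
  have hc := conf_pos hx
  have hm := conf_mul hx
  constructor
  · intro h
    have h2 := Real.cosh_pos (ρ / 2)
    have h3 := Real.cosh_sq (ρ / 2)
    have h4 : ‖x‖ * Real.cosh (ρ / 2) = Real.sinh (ρ / 2) := by
      rw [h, Real.tanh_eq_sinh_div_cosh]; field_simp
    have h5 : conf x = 2 * Real.cosh (ρ / 2) ^ 2 := by
      have h6 : (1 - ‖x‖ ^ 2) * Real.cosh (ρ / 2) ^ 2 = 1 := by
        have : ‖x‖ ^ 2 * Real.cosh (ρ / 2) ^ 2 = Real.sinh (ρ / 2) ^ 2 := by rw [← h4]; ring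
        linarith
      linear_combination Real.cosh (ρ / 2) ^ 2 * hm - conf x * h6
    have h1 : ρ = 2 * (ρ / 2) := by ring
    rw [sinhDist, h5, h1, Real.sinh_two_mul, ← h1, ← h4]
    ring
  · intro h
    have h1 := coshDist_sq hx
    rw [h] at h1
    have h2 : Real.cosh ρ = coshDist x := by
      rw [← sq_eq_sq₀ (Real.cosh_pos _).le (coshDist_pos hx).le, h1, Real.cosh_sq]; ring
    have h3 : 0 < 1 + coshDist x := by linarith [coshDist_pos hx]
    rw [tanh_half, ← h, h2, eq_div_iff h3.ne', coshDist, sinhDist]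
    linear_combination -‖x‖ * hm

theorem tanh_mem_Ioo_of_pos {ρ : ℝ} (h : 0 < ρ) : Real.tanh ρ ∈ Ioo (0 : ℝ) 1 := by
  have h1 := Real.sinh_pos_iff.2 h
  have h2 := Real.cosh_pos ρ
  rw [Real.tanh_eq_sinh_div_cosh]
  exact ⟨div_pos h1 h2, (div_lt_one h2).2 (Real.sinh_lt_cosh ρ)⟩

theorem arsinh_sinhDist {n : ℕ} {x : EuclideanSpace ℝ (Fin n)} (hx : ‖x‖ < 1) :
    Real.arsinh (sinhDist x) = Real.log ((1 + ‖x‖) / (1 - ‖x‖)) := by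
  have h1 : 0 < 1 - ‖x‖ := by linarith
  have h2 := norm_nonneg x
  rw [Real.arsinh, ← coshDist_sq hx, Real.sqrt_sq (coshDist_pos hx).le]
  congr 1
  rw [eq_div_iff h1.ne', sinhDist, coshDist]
  linear_combination ‖x‖ * conf_mul hx

theorem cosh_arsinh_sinhDist {n : ℕ} {x : EuclideanSpace ℝ (Fin n)} (hx : ‖x‖ < 1) :
    Real.cosh (Real.arsinh (sinhDist x)) = coshDist x := by
  rw [Real.cosh_arsinh, ← coshDist_sq hx, Real.sqrt_sq (coshDist_pos hx).le]

theorem contDiff_tanh : ContDiff ℝ ∞ Real.tanh := by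
  have h : Real.tanh = fun x => Real.sinh x / Real.cosh x :=
    funext Real.tanh_eq_sinh_div_cosh
  rw [h]
  exact Real.contDiff_sinh.div Real.contDiff_cosh fun x => (Real.cosh_pos x).ne'

theorem rotHypersurface_eq {n : ℕ} {I : Set ℝ} {f : ℝ → ℝ} (hf : ∀ t ∈ I, 0 < f t) :
    rotHypersurface n I f = {p | p.2 ∈ I ∧ ‖p.1‖ = Real.tanh (f p.2 / 2)} := by
  ext p
  refine and_congr_right fun hp => ?_
  have h0 := (tanh_mem_Ioo_of_pos (half_pos (hf _ hp))).1
  constructor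
  · rintro ⟨ζ, hζ, h⟩
    rw [h, norm_smul, hζ, mul_one, Real.norm_eq_abs, abs_of_pos h0]
  · intro h
    refine ⟨‖p.1‖⁻¹ • p.1, ?_, ?_⟩
    · rw [norm_smul, norm_inv, norm_norm, inv_mul_cancel₀ (by rw [h]; exact h0.ne')]
    · rw [← h, smul_smul, mul_inv_cancel₀ (by rw [h]; exact h0.ne'), one_smul]

/-! ### Classification of the complete examples. -/

section Classification

attribute [local instance 2000] chartedSpaceSelf

variable {n : ℕ} {M : Type*} [TopologicalSpace M] [ChartedSpace (EuclideanSpace ℝ (Fin n)) M]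
  {X : M → Amb n}

/-- The coefficient `n - r - 1` vanishes, so the meridian angle is constant. A vertical meridian
gives constant `ρ`, hence a cylinder; otherwise `t - ρ / tan ψ` is constant, and `not_conical`
excludes this. -/
theorem exists_range_eq_cylinder [IsManifold (𝓡 n) ∞ M] [T2Space M] [SecondCountableTopology M]
    [ConnectedSpace M] (hn : 2 ≤ n) {r : ℕ} (hr : n = r + 1)
    (hX : IsCompleteRotationalRMinimal r X) (hslice : ¬ ∃ τ, range X = slice n τ) :
    ∃ R, 0 < R ∧ range X = cylinder n R := by
  obtain ⟨hX, hc, hmin, hrot⟩ := hX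
  have hr' : r + 1 ≤ n := hr.ge
  rcases height_const_or_ne hn hr' hX hrot hmin with ⟨τ, hτ⟩ | h
  · exact absurd ⟨τ, range_eq_slice hX hc hτ⟩ hslice
  have h0 : ((n : ℝ) - r - 1) / (r + 1) = 0 := by rw [hr]; push_cast; ring
  have hev := fun p => exists_evolution hn hr' hX hrot hmin (h p).1 (h p).2
  have hself : ∀ (G : M → ℝ) p, (G ∘ (chartAt (EuclideanSpace ℝ (Fin n)) p).symm)
      (chartAt (EuclideanSpace ℝ (Fin n)) p p) = G p := fun G p => by
    rw [Function.comp_apply, (chartAt (EuclideanSpace ℝ (Fin n)) p).left_inv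
      (mem_chart_source _ p)]
  obtain ⟨ψ, hψ⟩ := eq_const_of_hasFDerivAt_zero (n := n) (G := meridianAngle X) fun p => by
    obtain ⟨T, -, h2, -⟩ := hev p
    rwa [h0, zero_mul, zero_smul] at h2
  obtain ⟨p₀⟩ := (inferInstance : Nonempty M)
  by_cases htan : Real.tan ψ = 0
  · obtain ⟨s, hs⟩ := eq_const_of_hasFDerivAt_zero (n := n) (G := fun q => sinhDist (X q).1)
      fun p => by
        obtain ⟨T, -, -, h3⟩ := hev p
        rwa [hψ p, htan, mul_zero, zero_smul] at h3
    have hs0 : 0 < s := hs p₀ ▸ sinhDist_pos (hX.mem_hypProd p₀) (h p₀).1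
    have hR : 0 < Real.arsinh s := Real.arsinh_pos_iff.2 hs0
    have ht := tanh_mem_Ioo_of_pos (half_pos hR)
    refine ⟨Real.arsinh s, hR, ?_⟩
    rw [range_eq_of_subset_revolution (g := fun _ => Real.tanh (Real.arsinh s / 2)) hn hX hc hrot
      isOpen_univ ordConnected_univ contDiffOn_const (fun _ _ => ht.1) (fun _ _ => ht.2)
      fun p => ⟨mem_univ _, (norm_eq_tanh_iff (hX.mem_hypProd p)).2 (by
        rw [Real.sinh_arsinh, hs p])⟩]
    simp [cylinder]
  · obtain ⟨c, hcst⟩ := eq_const_of_hasFDerivAt_zero (n := n)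
      (G := fun q => (X q).2 - (Real.tan ψ)⁻¹ * Real.arsinh (sinhDist (X q).1)) fun p => by
        obtain ⟨T, h1, -, h3⟩ := hev p
        have h4 := h1.sub ((h3.arsinh).const_mul (Real.tan ψ)⁻¹)
        refine h4.congr_fderiv ?_
        rw [hself (fun q => sinhDist (X q).1) p, ← coshDist_sq (hX.mem_hypProd p),
          Real.sqrt_sq (coshDist_pos (hX.mem_hypProd p)).le, hψ p, smul_smul, smul_smul]
        have h5 := (coshDist_pos (hX.mem_hypProd p)).ne'
        rw [show (Real.tan ψ)⁻¹ * (coshDist (X p).1)⁻¹ * (coshDist (X p).1 * Real.tan ψ) = 1 by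
          field_simp, one_smul, sub_self]
    exact (not_conical hX hc (fun p => (h p).1) (κ := (Real.tan ψ)⁻¹) (c := c) fun p => by
      rw [← arsinh_sinhDist (hX.mem_hypProd p), ← hcst p]; ring).elim

theorem exists_range_eq_catenoid [IsManifold (𝓡 n) ∞ M] [T2Space M] [SecondCountableTopology M]
    [ConnectedSpace M] (hn : 2 ≤ n) {r : ℕ} (hr : r + 1 < n)
    (hX : IsCompleteRotationalRMinimal r X) (hslice : ¬ ∃ τ, range X = slice n τ)
    {P : ℝ} (hP : P = ((r : ℝ) + 1) / ((n : ℝ) - r - 1)) :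
    ∃ a τ, 0 < a ∧ range X = verticalTranslate τ
      (rotHypersurface n (Ioo (-halfHeight P a) (halfHeight P a)) (profile P a)) := by
  obtain ⟨hX, hc, hmin, hrot⟩ := hX
  have hnr : 0 < (n : ℝ) - r - 1 := by
    have : ((r + 1 : ℕ) : ℝ) < n := by exact_mod_cast hr
    push_cast at this; linarith
  have hr1 : 0 < (r : ℝ) + 1 := by positivity
  have hP0 : 0 < P := hP ▸ div_pos hr1 hnr
  have hm : ((n : ℝ) - r - 1) / (r + 1) = P⁻¹ := by rw [hP, inv_div]
  rcases height_const_or_ne hn hr.le hX hrot hmin with ⟨τ, hτ⟩ | h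
  · exact absurd ⟨τ, range_eq_slice hX hc hτ⟩ hslice
  have hev := fun p => exists_evolution hn hr.le hX hrot hmin (h p).1 (h p).2
  rw [hm] at hev
  have hself : ∀ (G : M → ℝ) p, (G ∘ (chartAt (EuclideanSpace ℝ (Fin n)) p).symm)
      (chartAt (EuclideanSpace ℝ (Fin n)) p p) = G p := fun G p => by
    rw [Function.comp_apply, (chartAt (EuclideanSpace ℝ (Fin n)) p).left_inv
      (mem_chart_source _ p)]
  have hcos : ∀ p, 0 < Real.cos (meridianAngle X p) := fun p => Real.cos_arctan_pos _
  have hsh : ∀ p, 0 < sinhDist (X p).1 := fun p => sinhDist_pos (hX.mem_hypProd p) (h p).1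
  have hch : ∀ p, 0 < coshDist (X p).1 := fun p => coshDist_pos (hX.mem_hypProd p)
  -- The first integral in terms of the angle: the logarithmic derivatives `coth ρ tan ψ dt` of
  -- `sinh ρ` and `-P tan ψ dψ` of `cos^P ψ` cancel.
  obtain ⟨s, hs⟩ := eq_const_of_hasFDerivAt_zero (n := n)
    (G := fun q => sinhDist (X q).1 * Real.cos (meridianAngle X q) ^ P) fun p => by
      obtain ⟨T, -, h2, h3⟩ := hev p
      have h4 := h3.mul ((h2.cos).rpow_const (p := P) (Or.inl (by
        rw [hself (meridianAngle X)]; exact (hcos p).ne')))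
      refine h4.congr_fderiv ?_
      rw [hself (meridianAngle X), Real.rpow_sub_one (hcos p).ne',
        Real.tan_eq_sin_div_cos]
      simp only [smul_smul, ← add_smul]
      convert zero_smul ℝ T using 2
      have := hcos p; have := hsh p
      rw [hself (fun q => sinhDist (X q).1)]
      field_simp
      ring
  obtain ⟨p₀⟩ := (inferInstance : Nonempty M)
  have hs0 : 0 < s := hs p₀ ▸ mul_pos (hsh p₀) (Real.rpow_pos_of_pos (hcos p₀) _)
  have hsd : ∀ p, sinhDist (X p).1 = s / Real.cos (meridianAngle X p) ^ P := fun p => by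
    rw [← hs p, mul_div_assoc, div_self (Real.rpow_pos_of_pos (hcos p) _).ne', mul_one]
  -- Integration of `dt = P tanh ρ dψ`; the constant `τ` is the height of the neck.
  obtain ⟨τ, hτ⟩ := eq_const_of_hasFDerivAt_zero (n := n)
    (G := fun q => (X q).2 - heightOfAngle P s (meridianAngle X q)) fun p => by
      obtain ⟨T, h1, h2, -⟩ := hev p
      have h3 := h1.sub ((hasDerivAt_heightOfAngle hP0 hs0 _).comp_hasFDerivAt _ h2)
      refine h3.congr_fderiv ?_
      rw [hself (meridianAngle X), heightIntegrand_eq_tanh (ρ := Real.arsinh (sinhDist (X p).1)) hs0 (hcos p)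
        (by rw [Real.sinh_arsinh, hsd p]), Real.tanh_eq_sinh_div_cosh, Real.sinh_arsinh,
        cosh_arsinh_sinhDist (hX.mem_hypProd p), smul_smul]
      have := hch p; have := hsh p
      rw [show P * (sinhDist (X p).1 / coshDist (X p).1)
        * (P⁻¹ * (coshDist (X p).1 / sinhDist (X p).1)) = 1 by field_simp, one_smul, sub_self]
  set a := Real.arsinh s with ha
  have ha0 : 0 < a := Real.arsinh_pos_iff.2 hs0
  have has : Real.sinh a = s := Real.sinh_arsinh s
  set L := halfHeight P a with hL
  have hang : ∀ p, angleOfHeight P s ((X p).2 - τ) = meridianAngle X p := fun p => by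
    rw [← hτ p, sub_sub_cancel, angleOfHeight_heightOfAngle hP0 hs0]
  have hmem : ∀ p, (X p).2 - τ ∈ Ioo (-L) L := fun p => by
    rw [hL, halfHeight, has, ← angleOfHeight_mem_Ioo hP0 hs0, hang p]
    exact ⟨Real.neg_pi_div_two_lt_arctan _, Real.arctan_lt_pi_div_two _⟩
  have hmaps : ∀ t ∈ Ioo (τ - L) (τ + L), t - τ ∈ Ioo (-L) L := fun t ht =>
    ⟨by linarith [ht.1], by linarith [ht.2]⟩
  have htanh : ∀ t ∈ Ioo (τ - L) (τ + L), Real.tanh (profile P a (t - τ) / 2) ∈ Ioo (0 : ℝ) 1 :=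
    fun t ht => tanh_mem_Ioo_of_pos (half_pos (profile_pos hP0 ha0 (hmaps t ht)))
  refine ⟨a, τ, ha0, ?_⟩
  rw [range_eq_of_subset_revolution (g := fun t => Real.tanh (profile P a (t - τ) / 2)) hn hX hc
    hrot isOpen_Ioo ordConnected_Ioo
    (contDiff_tanh.comp_contDiffOn (((contDiffOn_profile hP0 ha0).comp
      (contDiff_id.sub contDiff_const).contDiffOn hmaps).div_const 2))
    (fun t ht => (htanh t ht).1) (fun t ht => (htanh t ht).2)
    (fun p => ⟨⟨by linarith [(hmem p).1], by linarith [(hmem p).2]⟩,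
      (norm_eq_tanh_iff (hX.mem_hypProd p)).2 (by rw [sinh_profile, has, hang p, hsd p])⟩)]
  rw [rotHypersurface_eq fun t ht => profile_pos hP0 ha0 ht]
  ext p
  constructor
  · rintro ⟨h1, h2⟩
    exact ⟨(p.1, p.2 - τ), ⟨hmaps _ h1, h2⟩, Prod.ext rfl (sub_add_cancel _ _)⟩
  · rintro ⟨q, ⟨h1, h2⟩, rfl⟩
    refine ⟨⟨by simpa using by linarith [h1.1], by simpa using by linarith [h1.2]⟩, ?_⟩
    simpa using h2

end Classification

/-! ### Lower bounds for lengths, and the distance to the axis. -/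

/-- A map which does not increase lengths infinitesimally does not increase distances. -/
theorem norm_sub_le_curveLength {n : ℕ} {V : Type*} [NormedAddCommGroup V] [NormedSpace ℝ V]
    {h : Amb n → V} {h' : Amb n → Amb n →L[ℝ] V}
    (hh : ∀ z ∈ hypProd n, HasFDerivAt h (h' z) z)
    (hle : ∀ z ∈ hypProd n, ∀ v, ‖h' z v‖ ≤ √(hypMetric z v v)) {γ : ℝ → Amb n}
    (hγ : ContDiffOn ℝ 1 γ (Icc 0 1)) (hmem : ∀ s ∈ Icc (0 : ℝ) 1, γ s ∈ hypProd n) :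
    ‖h (γ 1) - h (γ 0)‖ ≤ curveLength γ := by
  set v := derivWithin γ (Icc 0 1) with hv
  set σ : ℝ → ℝ := fun s => √(hypMetric (γ s) (v s) (v s)) with hσ
  have hvc : ContinuousOn v (Icc 0 1) :=
    hγ.continuousOn_derivWithin (uniqueDiffOn_Icc zero_lt_one) le_rfl
  have hσc : ContinuousOn σ (Icc 0 1) := by
    have h1 : ContinuousOn (fun s => conf (γ s).1) (Icc 0 1) := fun s hs =>
      ContinuousAt.comp_continuousWithinAt (g := conf) (f := fun s => (γ s).1)
        (contDiffAt_conf (hmem s hs)).continuousAt (hγ.continuousOn s hs).fst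
    simp only [hσ, hypMetric_self]
    exact (((h1.pow 2).mul (hvc.fst.norm.pow 2)).add (hvc.snd.pow 2)).sqrt
  -- A continuous extension of the speed to the line, so that its primitive is differentiable
  -- everywhere, endpoints included.
  set σ' : ℝ → ℝ := IccExtend (zero_le_one' ℝ) ((Icc (0 : ℝ) 1).domRestrict σ) with hσ'
  have hσ'c : Continuous σ' := (continuousOn_iff_continuous_domRestrict.1 hσc).Icc_extend'
  have heq : ∀ s ∈ Icc (0 : ℝ) 1, σ' s = σ s := fun s hs => by
    rw [hσ', IccExtend_of_mem _ _ hs]; rfl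
  have hderiv : ∀ s ∈ Icc (0 : ℝ) 1, HasDerivWithinAt γ (v s) (Icc 0 1) s := fun s hs =>
    (hγ.differentiableOn (by simp) s hs).hasDerivWithinAt
  have key := image_norm_le_of_norm_deriv_right_le_deriv_boundary (a := (0 : ℝ)) (b := 1)
    (f := fun s => h (γ s) - h (γ 0)) (f' := fun s => h' (γ s) (v s))
    (B := fun s => ∫ x in (0 : ℝ)..s, σ' x) (B' := σ')
    (fun s hs => ((hh _ (hmem s hs)).continuousAt.comp_continuousWithinAt
      (hγ.continuousOn s hs)).sub continuousWithinAt_const)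
    (fun s hs => by
      have h1 := (hh _ (hmem s ⟨hs.1, hs.2.le⟩)).comp_hasDerivWithinAt s
        (hderiv s ⟨hs.1, hs.2.le⟩)
      exact (h1.mono_of_mem_nhdsWithin (Icc_mem_nhdsGE_of_mem hs)).sub_const _)
    (by simp) (fun s => (hσ'c.integral_hasStrictDerivAt 0 s).hasDerivAt)
    (fun s hs => by
      rw [heq s ⟨hs.1, hs.2.le⟩]
      exact hle _ (hmem s ⟨hs.1, hs.2.le⟩) _)
    (x := 1) ⟨zero_le_one, le_rfl⟩
  refine key.trans_eq (intervalIntegral.integral_congr fun s hs => ?_)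
  rw [uIcc_of_le zero_le_one] at hs
  exact heq s hs

theorem norm_apply_sub_le_curveLength {n : ℕ} {γ : ℝ → Amb n}
    (hγ : ContDiffOn ℝ 1 γ (Icc 0 1)) (hmem : ∀ s ∈ Icc (0 : ℝ) 1, γ s ∈ hypProd n) :
    ‖γ 1 - γ 0‖ ≤ curveLength γ :=
  norm_sub_le_curveLength (h := id) (fun z _ => hasFDerivAt_id z)
    (fun _ hz v => Real.le_sqrt_of_sq_le (norm_sq_le_hypMetric hz v)) hγ hmem

/-- The differential of `log conf` is `conf` times the inner product with `x`, and `‖x‖ < 1`. This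
controls how fast a curve can approach the ideal boundary. -/
theorem abs_log_conf_sub_le_curveLength {n : ℕ} {γ : ℝ → Amb n}
    (hγ : ContDiffOn ℝ 1 γ (Icc 0 1)) (hmem : ∀ s ∈ Icc (0 : ℝ) 1, γ s ∈ hypProd n) :
    |Real.log (conf (γ 1).1) - Real.log (conf (γ 0).1)| ≤ curveLength γ := by
  refine norm_sub_le_curveLength (h := fun z => Real.log (conf z.1))
    (h' := fun z => (conf z.1)⁻¹ • ((conf z.1 ^ 2) • innerSL ℝ z.1).comp
      (ContinuousLinearMap.fst ℝ _ ℝ))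
    (fun z hz => ((hasFDerivAt_conf hz).comp z hasFDerivAt_fst).log (conf_pos hz).ne')
    (fun z hz v => Real.le_sqrt_of_sq_le ?_) hγ hmem
  have h1 := conf_pos hz
  have h2 := abs_real_inner_le_norm z.1 v.1
  have h3 : ‖z.1‖ < 1 := hz
  have h4 : ((conf z.1)⁻¹ • ((conf z.1 ^ 2) • innerSL ℝ z.1).comp
      (ContinuousLinearMap.fst ℝ _ ℝ)) v = conf z.1 * inner ℝ z.1 v.1 := by
    simp
    field_simp
  rw [h4, hypMetric_self, Real.norm_eq_abs, sq_abs, mul_pow, ← sq_abs (inner ℝ z.1 v.1)]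
  have h5 : |inner ℝ z.1 v.1| ^ 2 ≤ ‖v.1‖ ^ 2 := by
    refine pow_le_pow_left₀ (abs_nonneg _) (h2.trans ?_) 2
    exact mul_le_of_le_one_left (norm_nonneg _) h3.le
  nlinarith [sq_nonneg (conf z.1), sq_nonneg v.2]

/-- The function is the signed hyperbolic distance to the totally geodesic hyperplane orthogonal to
`ξ`. Unlike `ρ` it is smooth on the whole ball, and it vanishes on the axis. -/
theorem arsinh_sub_le_curveLength {n : ℕ} {ξ : EuclideanSpace ℝ (Fin n)} (hξ : ‖ξ‖ = 1)
    {γ : ℝ → Amb n} (hγ : ContDiffOn ℝ 1 γ (Icc 0 1))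
    (hmem : ∀ s ∈ Icc (0 : ℝ) 1, γ s ∈ hypProd n) :
    |Real.arsinh (conf (γ 1).1 * inner ℝ ξ (γ 1).1)
      - Real.arsinh (conf (γ 0).1 * inner ℝ ξ (γ 0).1)| ≤ curveLength γ := by
  refine norm_sub_le_curveLength (h := fun z => Real.arsinh (conf z.1 * inner ℝ ξ z.1))
    (h' := fun z => (√(1 + (conf z.1 * inner ℝ ξ z.1) ^ 2))⁻¹ •
      (conf z.1 • innerSL ℝ ξ + inner ℝ ξ z.1 • ((conf z.1 ^ 2) • innerSL ℝ z.1)).comp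
      (ContinuousLinearMap.fst ℝ _ ℝ))
    (fun z hz => ?_) (fun z hz v => Real.le_sqrt_of_sq_le ?_) hγ hmem
  · have h1 := (hasFDerivAt_conf (x := z.1) hz).mul (innerSL ℝ ξ).hasFDerivAt
    exact (h1.comp z hasFDerivAt_fst).arsinh
  · have hz1 : ‖z.1‖ < 1 := hz
    have h1 := conf_pos hz1
    have hm := conf_mul hz1
    set c := inner ℝ ξ z.1 with hc
    have hA : 0 < 1 + (conf z.1 * c) ^ 2 := by positivity
    have h4 : ((√(1 + (conf z.1 * c) ^ 2))⁻¹ •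
      (conf z.1 • innerSL ℝ ξ + c • ((conf z.1 ^ 2) • innerSL ℝ z.1)).comp
      (ContinuousLinearMap.fst ℝ _ ℝ)) v = (√(1 + (conf z.1 * c) ^ 2))⁻¹ * (conf z.1 *
        inner ℝ (ξ + (conf z.1 * c) • z.1) v.1) := by
      simp [inner_add_left, real_inner_smul_left]
      ring_nf
    -- By `conf_mul` the square of the norm is exactly the quantity under the root, so
    -- Cauchy–Schwarz gives the Lipschitz constant one.
    have h5 : ‖ξ + (conf z.1 * c) • z.1‖ ^ 2 = 1 + (conf z.1 * c) ^ 2 := by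
      rw [norm_add_sq_real, hξ, real_inner_smul_right, ← hc, norm_smul, mul_pow,
        Real.norm_eq_abs, sq_abs]
      linear_combination (- conf z.1 * c ^ 2) * hm
    have h6 : inner ℝ (ξ + (conf z.1 * c) • z.1) v.1 ^ 2
        ≤ (1 + (conf z.1 * c) ^ 2) * ‖v.1‖ ^ 2 := by
      rw [← h5, ← mul_pow, ← sq_abs (inner ℝ _ _)]
      exact pow_le_pow_left₀ (abs_nonneg _) (abs_real_inner_le_norm _ _) 2
    rw [h4, hypMetric_self, Real.norm_eq_abs, sq_abs]
    have h7 : (1 + (conf z.1 * c) ^ 2)⁻¹ * inner ℝ (ξ + (conf z.1 * c) • z.1) v.1 ^ 2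
        ≤ ‖v.1‖ ^ 2 := by
      rw [inv_mul_le_iff₀ hA]; exact h6
    calc _ = conf z.1 ^ 2 * ((1 + (conf z.1 * c) ^ 2)⁻¹
          * inner ℝ (ξ + (conf z.1 * c) • z.1) v.1 ^ 2) := by
          rw [mul_pow (√(1 + (conf z.1 * c) ^ 2))⁻¹, inv_pow, Real.sq_sqrt hA.le]; ring
      _ ≤ conf z.1 ^ 2 * ‖v.1‖ ^ 2 := by gcongr
      _ ≤ _ := le_add_of_nonneg_right (sq_nonneg _)

theorem hasDerivAt_tanh (x : ℝ) : HasDerivAt Real.tanh (1 - Real.tanh x ^ 2) x := by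
  have h : Real.tanh = fun x => Real.sinh x / Real.cosh x :=
    funext Real.tanh_eq_sinh_div_cosh
  rw [h]
  refine ((Real.hasDerivAt_sinh x).div (Real.hasDerivAt_cosh x) (Real.cosh_pos x).ne').congr_deriv ?_
  have := Real.cosh_pos x
  field_simp

/-- The horizontal radial geodesic, run at constant speed `ρ`, gives the upper bound. For the lower
bound, the function of `arsinh_sub_le_curveLength` with `ξ` pointing towards `p` rises from `0` to
`ρ` along every admissible curve. -/
theorem axisDist_eq {n : ℕ} {p : Amb n} (h0 : p.1 ≠ 0) {ρ : ℝ}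
    (hρ : 0 < ρ) (h : ‖p.1‖ = Real.tanh (ρ / 2)) : axisDist p = ENNReal.ofReal ρ := by
  have htanh : ∀ s ∈ Icc (0 : ℝ) 1, Real.tanh (s * ρ / 2) ∈ Ico (0 : ℝ) 1 := fun s hs => by
    rcases hs.1.eq_or_lt with rfl | hs0
    · simp
    · exact Ioo_subset_Ico_self (tanh_mem_Ioo_of_pos (by positivity))
  have hp : ‖p.1‖ < 1 := h ▸ (tanh_mem_Ioo_of_pos (half_pos hρ)).2
  have hr := norm_pos_iff.2 h0
  set ξ := ‖p.1‖⁻¹ • p.1 with hξ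
  have hξ1 : ‖ξ‖ = 1 := by rw [hξ, norm_smul, norm_inv, norm_norm, inv_mul_cancel₀ hr.ne']
  refine le_antisymm ?_ (le_iInf fun γ => ?_)
  · set γ : ℝ → Amb n := fun s => (Real.tanh (s * ρ / 2) • ξ, p.2) with hγ
    have hnorm : ∀ s ∈ Icc (0 : ℝ) 1, ‖(γ s).1‖ = Real.tanh (s * ρ / 2) := fun s hs => by
      simp only [hγ]
      rw [norm_smul, hξ1, mul_one, Real.norm_eq_abs, abs_of_nonneg (htanh s hs).1]
    have hmem : ∀ s ∈ Icc (0 : ℝ) 1, γ s ∈ hypProd n := fun s hs =>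
      (hnorm s hs).trans_lt (htanh s hs).2
    have hend : γ 1 = p := by
      refine Prod.ext ?_ rfl
      simp only [hγ]
      rw [one_mul, ← h, hξ, smul_smul, mul_inv_cancel₀ hr.ne', one_smul]
    have hc : ContDiffOn ℝ 1 γ (Icc 0 1) := by
      refine ContDiff.contDiffOn (ContDiff.prodMk ?_ contDiff_const)
      exact (((contDiff_tanh.of_le (by simp)).comp
        ((contDiff_id.mul contDiff_const).div_const 2)).smul contDiff_const)
    refine (iInf_le _ ⟨γ, hc, hmem, by simp [hγ], hend⟩).trans
      (ENNReal.ofReal_le_ofReal ?_)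
    · refine curveLength_le (v := fun s => (((1 - Real.tanh (s * ρ / 2) ^ 2) * (ρ / 2)) • ξ, 0))
        hρ.le (fun s hs => ?_) fun s hs => ?_
      · have h1 : HasDerivAt (fun s : ℝ => s * ρ / 2) (ρ / 2) s := by
          simpa using ((hasDerivAt_id s).mul_const ρ).div_const 2
        exact ((((hasDerivAt_tanh _).comp s h1).smul_const ξ).prodMk
          (hasDerivAt_const s p.2)).hasDerivWithinAt
      · rw [hypMetric_self]
        have h1 := conf_mul (x := (γ s).1) (hmem s hs)
        rw [hnorm s hs] at h1
        simp only
        rw [norm_smul, hξ1, mul_one, Real.norm_eq_abs, sq_abs, ← mul_pow, ← mul_assoc, h1]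
        apply le_of_eq; ring
  · refine ENNReal.ofReal_le_ofReal ?_
    obtain ⟨γ, hc, hmem, h1, h2⟩ := γ
    have h3 := (le_abs_self _).trans (arsinh_sub_le_curveLength hξ1 hc hmem)
    rw [h1, h2, inner_zero_right, mul_zero, Real.arsinh_zero, sub_zero, hξ, real_inner_smul_left,
      real_inner_self_eq_norm_sq] at h3
    have h4 : conf p.1 * (‖p.1‖⁻¹ * ‖p.1‖ ^ 2) = sinhDist p.1 := by
      rw [sinhDist]; field_simp
    rwa [h4, (norm_eq_tanh_iff hp).1 h, Real.arsinh_sinh] at h3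

/-! ### Completeness of closed embedded hypersurfaces. -/

section Complete

attribute [local instance 2000] chartedSpaceSelf

variable {n : ℕ} {M : Type*} [TopologicalSpace M] [ChartedSpace (EuclideanSpace ℝ (Fin n)) M]
  {X : M → Amb n}

theorem ofReal_norm_sub_le_inducedDist (hX : ContMDiff (𝓡 n) 𝓘(ℝ, Amb n) ∞ X)
    (hmem : ∀ p, X p ∈ hypProd n) (p q : M) :
    ENNReal.ofReal ‖X q - X p‖ ≤ inducedDist X p q ∧
    ENNReal.ofReal |Real.log (conf (X q).1) - Real.log (conf (X p).1)| ≤ inducedDist X p q := by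
  have hC : ∀ c : {c : ℝ → M // ContMDiffOn 𝓘(ℝ, ℝ) (𝓡 n) 1 c (Icc 0 1) ∧ c 0 = p ∧ c 1 = q},
      ContDiffOn ℝ 1 (X ∘ c.1) (Icc 0 1) := fun c => by
    rw [← contMDiffOn_iff_contDiffOn]
    exact (hX.of_le (by simp)).comp_contMDiffOn c.2.1
  constructor <;> refine le_iInf fun c => ENNReal.ofReal_le_ofReal ?_
  · have h1 := norm_apply_sub_le_curveLength (hC c) fun s _ => hmem _
    simpa only [Function.comp_apply, c.2.2.1, c.2.2.2] using h1
  · have h1 := abs_log_conf_sub_le_curveLength (hC c) fun s _ => hmem _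
    simpa only [Function.comp_apply, c.2.2.1, c.2.2.2] using h1

/-- An embedded hypersurface closed in `ℍⁿ × ℝ` is complete. -/
theorem isCompleteHypersurface_of_isEmbedding (hX : ContMDiff (𝓡 n) 𝓘(ℝ, Amb n) ∞ X)
    (hmem : ∀ p, X p ∈ hypProd n) (hemb : IsEmbedding X)
    (hcl : closure (range X) ∩ hypProd n ⊆ range X) : IsCompleteHypersurface X := by
  intro u hu
  have hcau : CauchySeq (X ∘ u) := by
    refine Metric.cauchySeq_iff.2 fun ε hε => ?_
    obtain ⟨k, hk⟩ := hu (ENNReal.ofReal ε) (ENNReal.ofReal_pos.2 hε)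
    refine ⟨k, fun i hi j hj => ?_⟩
    have h1 := ((ofReal_norm_sub_le_inducedDist hX hmem (u j) (u i)).1).trans_lt (hk j hj i hi)
    rw [dist_eq_norm]
    exact (ENNReal.ofReal_lt_ofReal_iff hε).1 h1
  obtain ⟨z, hz⟩ := cauchySeq_tendsto_of_complete hcau
  obtain ⟨k, hk⟩ := hu (ENNReal.ofReal 1) (ENNReal.ofReal_pos.2 one_pos)
  -- The tail stays at induced distance less than one from `u k`, so `log conf` grows by less than
  -- one. Hence `conf ≤ K`, and the Euclidean limit stays inside the open ball.
  set K := conf (X (u k)).1 * Real.exp 1 with hK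
  have hK0 : 0 < K := mul_pos (conf_pos (hmem _)) (Real.exp_pos _)
  have hbound : ∀ i ≥ k, ‖(X (u i)).1‖ ^ 2 ≤ 1 - 2 / K := by
    intro i hi
    have h1 := ((ofReal_norm_sub_le_inducedDist hX hmem (u k) (u i)).2).trans_lt (hk k le_rfl i hi)
    have h2 := (le_abs_self _).trans_lt ((ENNReal.ofReal_lt_ofReal_iff one_pos).1 h1)
    have h3 : conf (X (u i)).1 ≤ K := by
      rw [← Real.exp_log (conf_pos (hmem (u i))), hK, ← Real.exp_log (conf_pos (hmem (u k))),
        ← Real.exp_add, Real.exp_le_exp]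
      linarith
    have h4 := conf_mul (x := (X (u i)).1) (hmem (u i))
    have h5 := one_sub_norm_sq_pos (x := (X (u i)).1) (hmem (u i))
    rw [le_sub_iff_add_le, ← le_sub_iff_add_le', div_le_iff₀ hK0]
    nlinarith
  have hz1 : ‖z.1‖ ^ 2 ≤ 1 - 2 / K :=
    le_of_tendsto (((continuous_fst.norm.pow 2).tendsto z).comp hz)
      ((eventually_ge_atTop k).mono hbound)
  have hzmem : z ∈ hypProd n := by
    have : 0 < 2 / K := by positivity
    change ‖z.1‖ < 1
    nlinarith [norm_nonneg z.1]
  obtain ⟨p, hp⟩ := hcl ⟨mem_closure_of_tendsto hz (Eventually.of_forall fun i => mem_range_self _),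
    hzmem⟩
  refine ⟨p, hemb.isInducing.tendsto_nhds_iff.2 ?_⟩
  rw [hp]
  exact hz

end Complete

/-! ### The mean curvature of a hypersurface of revolution. -/

section Revolution

variable {n : ℕ} {I : Set ℝ} {f : ℝ → ℝ}

/-- Parametrisation of a rotational hypersurface by a spherical shell. -/
noncomputable def revolutionMap (n : ℕ) (f : ℝ → ℝ) (y : EuclideanSpace ℝ (Fin n)) : Amb n :=
  (Real.tanh (f (Real.log ‖y‖) / 2) • (‖y‖⁻¹ • y), Real.log ‖y‖)

/-- The spherical shell `{y : log ‖y‖ ∈ I}`. -/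
def shell (n : ℕ) (I : Set ℝ) : Set (EuclideanSpace ℝ (Fin n)) := {y | y ≠ 0 ∧ Real.log ‖y‖ ∈ I}

theorem isOpen_shell (hI : IsOpen I) : IsOpen (shell n I) := by
  refine isOpen_iff_mem_nhds.2 fun y hy => ?_
  have h1 : ContinuousAt (fun y : EuclideanSpace ℝ (Fin n) => Real.log ‖y‖) y :=
    continuous_norm.continuousAt.log (norm_ne_zero_iff.2 hy.1)
  filter_upwards [isOpen_ne.mem_nhds hy.1, h1.preimage_mem_nhds (hI.mem_nhds hy.2)] with z h2 h3
  exact ⟨h2, h3⟩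

theorem norm_revolutionMap_fst (hf0 : ∀ t ∈ I, 0 < f t) {y : EuclideanSpace ℝ (Fin n)}
    (hy : y ∈ shell n I) : ‖(revolutionMap n f y).1‖ = Real.tanh (f (Real.log ‖y‖) / 2) := by
  have h1 := (tanh_mem_Ioo_of_pos (half_pos (hf0 _ hy.2))).1
  rw [revolutionMap, norm_smul, norm_smul, norm_inv, norm_norm,
    inv_mul_cancel₀ (norm_ne_zero_iff.2 hy.1), mul_one, Real.norm_eq_abs, abs_of_pos h1]

theorem revolutionMap_mem_hypProd (hf0 : ∀ t ∈ I, 0 < f t) {y : EuclideanSpace ℝ (Fin n)}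
    (hy : y ∈ shell n I) : revolutionMap n f y ∈ hypProd n :=
  (norm_revolutionMap_fst hf0 hy).trans_lt (tanh_mem_Ioo_of_pos (half_pos (hf0 _ hy.2))).2

theorem revolutionMap_fst_ne_zero (hf0 : ∀ t ∈ I, 0 < f t) {y : EuclideanSpace ℝ (Fin n)}
    (hy : y ∈ shell n I) : (revolutionMap n f y).1 ≠ 0 := by
  rw [← norm_pos_iff, norm_revolutionMap_fst hf0 hy]
  exact (tanh_mem_Ioo_of_pos (half_pos (hf0 _ hy.2))).1

theorem sinhDist_revolutionMap (hf0 : ∀ t ∈ I, 0 < f t) {y : EuclideanSpace ℝ (Fin n)}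
    (hy : y ∈ shell n I) : sinhDist (revolutionMap n f y).1 = Real.sinh (f (Real.log ‖y‖)) :=
  (norm_eq_tanh_iff (revolutionMap_mem_hypProd hf0 hy)).1 (norm_revolutionMap_fst hf0 hy)

theorem coshDist_revolutionMap (hf0 : ∀ t ∈ I, 0 < f t) {y : EuclideanSpace ℝ (Fin n)}
    (hy : y ∈ shell n I) : coshDist (revolutionMap n f y).1 = Real.cosh (f (Real.log ‖y‖)) := by
  rw [← cosh_arsinh_sinhDist (revolutionMap_mem_hypProd hf0 hy), sinhDist_revolutionMap hf0 hy,
    Real.arsinh_sinh]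

theorem contDiffAt_log_norm {y : EuclideanSpace ℝ (Fin n)} (hy : y ≠ 0) :
    ContDiffAt ℝ ∞ (fun y : EuclideanSpace ℝ (Fin n) => Real.log ‖y‖) y :=
  (contDiffAt_id.norm ℝ hy).log (norm_ne_zero_iff.2 hy)

theorem contDiffAt_revolutionMap (hI : IsOpen I) (hf : ContDiffOn ℝ ∞ f I)
    {y : EuclideanSpace ℝ (Fin n)} (hy : y ∈ shell n I) :
    ContDiffAt ℝ ∞ (revolutionMap n f) y := by
  have h1 := contDiffAt_log_norm hy.1
  have h2 : ContDiffAt ℝ ∞ (fun y : EuclideanSpace ℝ (Fin n) => f (Real.log ‖y‖)) y :=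
    ContDiffAt.comp y (g := f) (f := fun y : EuclideanSpace ℝ (Fin n) => Real.log ‖y‖)
      (hf.contDiffAt (hI.mem_nhds hy.2)) h1
  exact ((contDiff_tanh.contDiffAt.comp y (h2.div_const 2)).smul
    (((contDiffAt_id.norm ℝ hy.1).inv (norm_ne_zero_iff.2 hy.1)).smul contDiffAt_id)).prodMk h1

/-- A left inverse of `revolutionMap`. -/
noncomputable def revolutionInv (z : Amb n) : EuclideanSpace ℝ (Fin n) :=
  Real.exp z.2 • (‖z.1‖⁻¹ • z.1)

theorem revolutionInv_revolutionMap (hf0 : ∀ t ∈ I, 0 < f t) {y : EuclideanSpace ℝ (Fin n)}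
    (hy : y ∈ shell n I) : revolutionInv (revolutionMap n f y) = y := by
  have h1 := (tanh_mem_Ioo_of_pos (half_pos (hf0 _ hy.2))).1
  have h2 := norm_pos_iff.2 hy.1
  rw [revolutionInv, norm_revolutionMap_fst hf0 hy, revolutionMap]
  simp only
  rw [Real.exp_log h2, smul_smul _ _ (‖y‖⁻¹ • y), inv_mul_cancel₀ h1.ne', one_smul, smul_smul,
    mul_inv_cancel₀ h2.ne', one_smul]

theorem injective_fderiv_revolutionMap (hI : IsOpen I) (hf : ContDiffOn ℝ ∞ f I)
    (hf0 : ∀ t ∈ I, 0 < f t) {y : EuclideanSpace ℝ (Fin n)} (hy : y ∈ shell n I) :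
    Function.Injective (fderiv ℝ (revolutionMap n f) y) := by
  have h1 := ((contDiffAt_revolutionMap hI hf hy).differentiableAt (by simp)).hasFDerivAt
  have hne := revolutionMap_fst_ne_zero hf0 hy
  have h2 : ContDiffAt ℝ ∞ (revolutionInv (n := n)) (revolutionMap n f y) :=
    contDiffAt_snd.exp.smul (((contDiffAt_fst.norm ℝ hne).inv (norm_ne_zero_iff.2 hne)).smul
        contDiffAt_fst)
  have h3 := (h2.differentiableAt (by simp)).hasFDerivAt.comp y h1
  have h4 : HasFDerivAt (revolutionInv (n := n) ∘ revolutionMap n f)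
      (ContinuousLinearMap.id ℝ (EuclideanSpace ℝ (Fin n))) y := by
    refine (hasFDerivAt_id y).congr_of_eventuallyEq ?_
    filter_upwards [(isOpen_shell hI).mem_nhds hy] with z hz
    exact revolutionInv_revolutionMap hf0 hz
  have h5 := h3.unique h4
  refine Function.Injective.of_comp
    (f := fderiv ℝ (revolutionInv (n := n)) (revolutionMap n f y)) ?_
  intro a b hab
  have ha := congrArg (fun T => T a) h5
  have hb := congrArg (fun T => T b) h5
  exact (ha.symm.trans hab).trans hb

/-- The field is `ε (∂ρ - f' ∂t) / √(1 + f'²)`; the sign `ε` allows both orientations. Orthogonality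
to the surface comes from differentiating `sinh ρ = sinh (f t)`. -/
theorem isRadialNormalField_revolutionMap (hI : IsOpen I) (hf : ContDiffOn ℝ ∞ f I)
    (hf0 : ∀ t ∈ I, 0 < f t) {y : EuclideanSpace ℝ (Fin n)} (hy : y ∈ shell n I) {ε : ℝ}
    (hε : ε ^ 2 = 1) :
    IsRadialNormalField (revolutionMap n f) y
      (fun y => ε * (√(1 + deriv f (Real.log ‖y‖) ^ 2))⁻¹ / Real.sinh (f (Real.log ‖y‖)))
      (fun y => -(ε * deriv f (Real.log ‖y‖) * (√(1 + deriv f (Real.log ‖y‖) ^ 2))⁻¹)) := by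
  have hfd : ∀ t ∈ I, DifferentiableAt ℝ f t := fun t ht =>
    (hf.differentiableOn (by simp)).differentiableAt (hI.mem_nhds ht)
  have hf'd : DifferentiableAt ℝ (deriv f) (Real.log ‖y‖) :=
    (((contDiffOn_infty_iff_deriv_of_isOpen hI).1 hf).2.differentiableOn
      (by simp)).differentiableAt (hI.mem_nhds hy.2)
  have hlog : DifferentiableAt ℝ (fun y : EuclideanSpace ℝ (Fin n) => Real.log ‖y‖) y :=
    (contDiffAt_log_norm hy.1).differentiableAt (by simp)
  have hd1 : DifferentiableAt ℝ (fun y : EuclideanSpace ℝ (Fin n) => f (Real.log ‖y‖)) y :=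
    DifferentiableAt.comp (g := f) y (hfd _ hy.2) hlog
  have hd2 : DifferentiableAt ℝ (fun y : EuclideanSpace ℝ (Fin n) => deriv f (Real.log ‖y‖)) y :=
    DifferentiableAt.comp (g := deriv f) y hf'd hlog
  have hpos : ∀ t, 0 < 1 + deriv f t ^ 2 := fun t => by positivity
  have hd3 : DifferentiableAt ℝ
      (fun y : EuclideanSpace ℝ (Fin n) => (√(1 + deriv f (Real.log ‖y‖) ^ 2))⁻¹) y :=
    (((hd2.pow 2).const_add 1).sqrt (hpos _).ne').inv (Real.sqrt_pos.2 (hpos _)).ne'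
  have hsh : ∀ t ∈ I, 0 < Real.sinh (f t) := fun t ht => Real.sinh_pos_iff.2 (hf0 t ht)
  have hd4 : DifferentiableAt ℝ (fun y : EuclideanSpace ℝ (Fin n) =>
      ε * (√(1 + deriv f (Real.log ‖y‖) ^ 2))⁻¹ / Real.sinh (f (Real.log ‖y‖))) y := by
    simp only [div_eq_mul_inv]
    exact (hd3.const_mul ε).mul (hd1.sinh.inv (hsh _ hy.2).ne')
  refine ⟨contDiffAt_revolutionMap hI hf hy, revolutionMap_mem_hypProd hf0 hy,
    revolutionMap_fst_ne_zero hf0 hy, injective_fderiv_revolutionMap hI hf hf0 hy,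
    hd4, ((hd2.const_mul ε).mul hd3).neg, ?_, ?_⟩
  · filter_upwards [(isOpen_shell hI).mem_nhds hy] with z hz b
    have hF := ((contDiffAt_revolutionMap hI hf hz).differentiableAt (by simp)).hasFDerivAt
    have hmem := revolutionMap_mem_hypProd hf0 hz
    have hne := revolutionMap_fst_ne_zero hf0 hz
    have h1 := (hasFDerivAt_sinhDist hmem hne).comp z hF.fst
    have h2 : HasFDerivAt (fun z : EuclideanSpace ℝ (Fin n) => Real.log ‖z‖) _ z := hF.snd
    have h3 := ((hfd _ hz.2).hasDerivAt.comp_hasFDerivAt z h2).sinh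
    have h4 : (sinhDist ∘ fun z => (revolutionMap n f z).1) =ᶠ[𝓝 z]
        fun z => Real.sinh ((f ∘ fun z : EuclideanSpace ℝ (Fin n) => Real.log ‖z‖) z) := by
      filter_upwards [(isOpen_shell hI).mem_nhds hz] with z' hz'
      exact sinhDist_revolutionMap hf0 hz'
    have h5 := congrArg (fun T => T b) (h1.unique (h3.congr_of_eventuallyEq h4))
    simp only [ContinuousLinearMap.comp_apply, smul_apply, smul_eq_mul, innerSL_apply_apply,
      ContinuousLinearMap.coe_fst', ContinuousLinearMap.coe_snd', Function.comp_apply] at h5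
    rw [coshDist_revolutionMap hf0 hz] at h5
    have hs := hsh _ hz.2
    have hss := sinhDist_revolutionMap hf0 hz
    rw [sinhDist] at hss
    set x := (revolutionMap n f z).1 with hx
    set t := Real.log ‖z‖ with ht
    set D := fderiv ℝ (revolutionMap n f) z b with hD
    have hxn : 0 < ‖x‖ := norm_pos_iff.2 hne
    have hu := Real.sqrt_pos.2 (hpos t)
    have hch := Real.cosh_pos (f t)
    have h6 : conf x * inner ℝ x D.1 = ‖x‖ * (deriv f t * D.2) := by
      have : Real.cosh (f t) * (conf x * inner ℝ x D.1) =
          Real.cosh (f t) * (‖x‖ * (deriv f t * D.2)) := by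
        field_simp at h5
        linear_combination Real.cosh (f t) * h5
      exact mul_left_cancel₀ hch.ne' this
    rw [hypMetric_eq, real_inner_smul_left]
    simp only
    rw [← hx, ← hss]
    have hcx : 0 < conf x := conf_pos hmem
    field_simp
    linear_combination ε * h6
  · filter_upwards [(isOpen_shell hI).mem_nhds hy] with z hz
    have hs := hsh _ hz.2
    have hu := Real.sqrt_pos.2 (hpos (Real.log ‖z‖))
    have hu2 := Real.sq_sqrt (hpos (Real.log ‖z‖)).le
    rw [sinhDist_revolutionMap hf0 hz]
    field_simp
    linear_combination (1 + deriv f (Real.log ‖z‖) ^ 2) * hε - hu2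

theorem hasDerivAt_div_sqrt_one_add_sq (q : ℝ) :
    HasDerivAt (fun q : ℝ => q * (√(1 + q ^ 2))⁻¹) (((√(1 + q ^ 2))⁻¹) ^ 3) q := by
  have hpos : 0 < 1 + q ^ 2 := by positivity
  have hu := Real.sqrt_pos.2 hpos
  have hu2 := Real.sq_sqrt hpos.le
  have h1 := (((hasDerivAt_id q).pow 2).const_add 1).sqrt hpos.ne'
  have h2 := (hasDerivAt_id q).mul (h1.inv hu.ne')
  refine h2.congr_deriv ?_
  simp
  field_simp
  linear_combination hu2

/-- The parallels have principal curvature `-ε coth f / √(1 + f'²)` and the meridian `ε f'' / (1 +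
f'²)^{3/2}`. The differential equation makes the linear factor in `meanCurv_eq_zero_iff` vanish. The
hypothesis on `N` leaves only the two signs `ε = ±1`. -/
theorem meanCurv_revolutionMap {r : ℕ} (hr : r + 1 ≤ n) (hI : IsOpen I) (hf : ContDiffOn ℝ ∞ f I)
    (hf0 : ∀ t ∈ I, 0 < f t)
    (hode : ∀ t ∈ I, ((r : ℝ) + 1) * deriv (deriv f) t
      = ((n : ℝ) - r - 1) * (Real.cosh (f t) / Real.sinh (f t)) * (1 + deriv f t ^ 2))
    {y : EuclideanSpace ℝ (Fin n)} (hy : y ∈ shell n I) {N : Amb n}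
    (hN : ∀ N', (∀ b, hypMetric (revolutionMap n f y) N' (fderiv ℝ (revolutionMap n f) y b) = 0) →
      hypMetric (revolutionMap n f y) N' N' = 1 → N = N' ∨ N = -N')
    {A : EuclideanSpace ℝ (Fin n) →ₗ[ℝ] EuclideanSpace ℝ (Fin n)}
    (hA : ∀ a b, hypMetric (revolutionMap n f y) (fderiv ℝ (revolutionMap n f) y (A a))
      (fderiv ℝ (revolutionMap n f) y b) = secondFormAt (revolutionMap n f) y N a b) :
    meanCurv (r + 1) A = 0 := by
  have key : ∀ ε : ℝ, ε ^ 2 = 1 →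
      N = ((ε * (√(1 + deriv f (Real.log ‖y‖) ^ 2))⁻¹ / Real.sinh (f (Real.log ‖y‖)))
        • (revolutionMap n f y).1,
        -(ε * deriv f (Real.log ‖y‖) * (√(1 + deriv f (Real.log ‖y‖) ^ 2))⁻¹)) →
      meanCurv (r + 1) A = 0 := by
    intro ε hε hNε
    have hrad := isRadialNormalField_revolutionMap hI hf hf0 hy hε
    obtain ⟨w, e, k, hwe, ht, -, -, hβ, hshape⟩ := hrad.structure_equations
    rw [hNε] at hA
    rw [(hshape A).1 hA, meanCurv_eq_zero_iff hr _ _ _ _ hwe]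
    have hf'd : DifferentiableAt ℝ (deriv f) (Real.log ‖y‖) :=
      (((contDiffOn_infty_iff_deriv_of_isOpen hI).1 hf).2.differentiableOn
        (by simp)).differentiableAt (hI.mem_nhds hy.2)
    have hF := ((contDiffAt_revolutionMap hI hf hy).differentiableAt (by simp)).hasFDerivAt
    have hlog : HasFDerivAt (fun z : EuclideanSpace ℝ (Fin n) => Real.log ‖z‖) _ y := hF.snd
    have h1 := (((hasDerivAt_div_sqrt_one_add_sq _).comp_hasFDerivAt y
      (hf'd.hasDerivAt.comp_hasFDerivAt y hlog)).const_mul ε).neg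
    have h2 := hβ.unique (h1.congr_of_eventuallyEq (Eventually.of_forall fun z => by
      simp [mul_assoc]))
    have h3 := congrArg (fun T => T e) h2
    have ht' := ht e
    have hode' := hode _ hy.2
    rw [sinhDist_revolutionMap hf0 hy] at ht' h3
    simp only [ContinuousLinearMap.comp_apply, smul_apply, smul_eq_mul, neg_apply,
      ContinuousLinearMap.coe_snd', Function.comp_apply, hwe, mul_one] at h3 ht'
    rw [ht'] at h3
    rw [coshDist_revolutionMap hf0 hy]
    have hs := Real.sinh_pos_iff.2 (hf0 _ hy.2)
    have hpos : 0 < 1 + deriv f (Real.log ‖y‖) ^ 2 := by positivity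
    have hu := Real.sqrt_pos.2 hpos
    have hu2 := Real.sq_sqrt hpos.le
    have hε0 : ε ≠ 0 := by rintro rfl; norm_num at hε
    clear hβ h1 h2 hshape hF hlog hf'd hrad hA ht ht' hwe
    set q := deriv f (Real.log ‖y‖)
    set q' := deriv (deriv f) (Real.log ‖y‖)
    set u := √(1 + q ^ 2)
    -- Read off by comparing two expressions for the derivative of the vertical normal component
    -- along the meridian.
    have hk : k = ε * q' / u ^ 3 := by
      field_simp at h3 ⊢
      linear_combination -h3
    rw [← hu2] at hode'
    have h5 : ((n : ℝ) - r - 1) * -(ε * u⁻¹ / Real.sinh (f (Real.log ‖y‖)) * Real.cosh (f (Real.log ‖y‖)))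
        + (r + 1) * k = 0 := by
      rw [hk]
      field_simp at hode' ⊢
      linear_combination ε * hode'
    rw [mul_eq_zero]
    right
    linear_combination h5
  have hrad := isRadialNormalField_revolutionMap hI hf hf0 hy (one_pow 2)
  have hunit := hrad.unit.self_of_nhds
  rcases hN _ hrad.orthogonal.self_of_nhds (by
    refine Eq.trans ?_ hunit
    rw [hypMetric_self, norm_smul, mul_pow, Real.norm_eq_abs, sq_abs, sinhDist]; ring)
    with h | h
  · exact key 1 (one_pow 2) h
  · refine key (-1) (by norm_num) (h.trans (Prod.ext ?_ ?_))
    · simp only [Prod.fst_neg, ← neg_smul]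
      congr 1; ring
    · simp only [Prod.snd_neg]; ring

end Revolution

/-! ### From a profile to a complete embedded hypersurface. -/

theorem strictMono_tanh : StrictMono Real.tanh :=
  strictMono_of_deriv_pos fun x => by
    rw [(hasDerivAt_tanh x).deriv]
    nlinarith [Real.neg_one_lt_tanh x, Real.tanh_lt_one x]

section Embedded

attribute [local instance 2000] chartedSpaceSelf

variable {n : ℕ}

theorem contMDiff_comp_coe {U : TopologicalSpace.Opens (EuclideanSpace ℝ (Fin n))}
    {F : EuclideanSpace ℝ (Fin n) → Amb n} (hF : ContDiffOn ℝ ∞ F U) :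
    ContMDiff (𝓡 n) 𝓘(ℝ, Amb n) ∞ fun y : U => F y := by
  intro y
  have h1 : ContMDiffAt (𝓡 n) 𝓘(ℝ, Amb n) ∞ F (y : EuclideanSpace ℝ (Fin n)) :=
    (hF.contDiffAt (U.isOpen.mem_nhds y.2)).contMDiffAt
  exact h1.comp y (contMDiff_subtype_val y)

theorem chart_opens_apply {U : TopologicalSpace.Opens (EuclideanSpace ℝ (Fin n))} (y z : U) :
    chartAt (EuclideanSpace ℝ (Fin n)) y z = z := rfl

theorem chartRep_opens_eventuallyEq {U : TopologicalSpace.Opens (EuclideanSpace ℝ (Fin n))}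
    (F : EuclideanSpace ℝ (Fin n) → Amb n) (y : U) :
    chartRep (fun z : U => F z) y =ᶠ[𝓝 (y : EuclideanSpace ℝ (Fin n))] F := by
  have h1 := (chartAt (EuclideanSpace ℝ (Fin n)) y).open_target.mem_nhds
    (mem_chart_target (EuclideanSpace ℝ (Fin n)) y)
  filter_upwards [h1] with z hz
  have h2 := (chartAt (EuclideanSpace ℝ (Fin n)) y).right_inv hz
  rw [chart_opens_apply] at h2
  rw [chartRep, Function.comp_apply, h2]

theorem chartDiff_opens {U : TopologicalSpace.Opens (EuclideanSpace ℝ (Fin n))}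
    (F : EuclideanSpace ℝ (Fin n) → Amb n) (y : U) :
    chartDiff (fun z : U => F z) y = fderiv ℝ F y :=
  (chartRep_opens_eventuallyEq F y).fderiv_eq

theorem isImmersedHypersurface_opens {U : TopologicalSpace.Opens (EuclideanSpace ℝ (Fin n))}
    {F : EuclideanSpace ℝ (Fin n) → Amb n} (hF : ContDiffOn ℝ ∞ F U)
    (hmem : ∀ y ∈ U, F y ∈ hypProd n) (hinj : ∀ y ∈ U, Function.Injective (fderiv ℝ F y)) :
    IsImmersedHypersurface fun y : U => F y := by
  refine ⟨contMDiff_comp_coe hF, fun y => hmem y y.2, fun y => ?_⟩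
  have hd : MDifferentiableAt (𝓡 n) 𝓘(ℝ, Amb n) (fun y : U => F y) y :=
    (contMDiff_comp_coe hF).mdifferentiableAt (by simp)
  have h2 : mfderiv (𝓡 n) 𝓘(ℝ, Amb n) (fun y : U => F y) y = chartDiff (fun y : U => F y) y := by
    rw [hd.mfderiv]
    simp only [mfld_simps, fderivWithin_univ]
    rfl
  rw [h2, chartDiff_opens]
  exact hinj y y.2

theorem secondForm_opens {U : TopologicalSpace.Opens (EuclideanSpace ℝ (Fin n))}
    (F : EuclideanSpace ℝ (Fin n) → Amb n) (y : U) (N : Amb n) (a b : EuclideanSpace ℝ (Fin n)) :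
    secondForm (fun z : U => F z) y N a b = secondFormAt F y N a b := by
  rw [secondForm, secondFormAt, chartDiff_opens, chart_opens_apply,
    (chartRep_opens_eventuallyEq F y).fderiv.fderiv_eq]

variable {I : Set ℝ} {f : ℝ → ℝ}

theorem image_revolutionMap :
    revolutionMap n f '' shell n I = rotHypersurface n I f := by
  ext p
  constructor
  · rintro ⟨y, hy, rfl⟩
    refine ⟨hy.2, ‖y‖⁻¹ • y, ?_, rfl⟩
    rw [norm_smul, norm_inv, norm_norm, inv_mul_cancel₀ (norm_ne_zero_iff.2 hy.1)]
  · rintro ⟨hp, ζ, hζ, h⟩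
    have h1 : ‖Real.exp p.2 • ζ‖ = Real.exp p.2 := by
      rw [norm_smul, hζ, mul_one, Real.norm_eq_abs, Real.abs_exp]
    have h2 : Real.log ‖Real.exp p.2 • ζ‖ = p.2 := by rw [h1, Real.log_exp]
    refine ⟨Real.exp p.2 • ζ, ⟨?_, by rwa [h2]⟩, Prod.ext ?_ h2⟩
    · rw [← norm_ne_zero_iff, h1]; exact (Real.exp_pos _).ne'
    · rw [revolutionMap]
      simp only
      rw [h2, h1, smul_smul (Real.exp p.2)⁻¹, inv_mul_cancel₀ (Real.exp_pos _).ne', one_smul, h]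

/-- In polar coordinates the shell is the image of a sphere times an interval, and the sphere is
connected because `2 ≤ n`. -/
theorem isConnected_shell (hn : 2 ≤ n) (hIc : I.OrdConnected) (hne : I.Nonempty) :
    IsConnected (shell n I) := by
  have h1 : IsConnected (Metric.sphere (0 : EuclideanSpace ℝ (Fin n)) 1) := by
    refine isConnected_sphere ?_ 0 zero_le_one
    rw [← Module.finrank_eq_rank, finrank_euclideanSpace_fin]
    exact_mod_cast hn
  have h2 : IsConnected I := ⟨hne, hIc.isPreconnected⟩
  have h3 : shell n I = (fun q : EuclideanSpace ℝ (Fin n) × ℝ => Real.exp q.2 • q.1) ''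
      (Metric.sphere (0 : EuclideanSpace ℝ (Fin n)) 1 ×ˢ I) := by
    ext y
    constructor
    · rintro ⟨hy, hyI⟩
      have hpos := norm_pos_iff.2 hy
      refine ⟨(‖y‖⁻¹ • y, Real.log ‖y‖), ⟨?_, hyI⟩, ?_⟩
      · rw [mem_sphere_zero_iff_norm, norm_smul, norm_inv, norm_norm, inv_mul_cancel₀ hpos.ne']
      · simp only
        rw [Real.exp_log hpos, smul_smul, mul_inv_cancel₀ hpos.ne', one_smul]
    · rintro ⟨q, ⟨hq1, hq2⟩, rfl⟩
      have hn1 : ‖Real.exp q.2 • q.1‖ = Real.exp q.2 := by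
        rw [norm_smul, mem_sphere_zero_iff_norm.1 hq1, mul_one, Real.norm_eq_abs, Real.abs_exp]
      refine ⟨?_, ?_⟩
      · rw [← norm_ne_zero_iff, hn1]; exact (Real.exp_pos _).ne'
      · rw [hn1, Real.log_exp]; exact hq2
  rw [h3]
  exact (h1.prod h2).image _ (by fun_prop)

theorem isEmbedding_revolutionMap (hI : IsOpen I) (hf : ContDiffOn ℝ ∞ f I)
    (hf0 : ∀ t ∈ I, 0 < f t) : IsEmbedding fun y : shell n I => revolutionMap n f y := by
  have hc : Continuous fun y : shell n I => revolutionMap n f y :=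
    continuous_iff_continuousAt.2 fun y => ContinuousAt.comp (g := revolutionMap n f)
      (contDiffAt_revolutionMap hI hf y.2).continuousAt continuous_subtype_val.continuousAt
  let X' : shell n I → {z : Amb n // z.1 ≠ 0} :=
    fun y => ⟨revolutionMap n f y, revolutionMap_fst_ne_zero hf0 y.2⟩
  have hX' : Continuous X' := hc.subtype_mk _
  have hinv : Continuous fun z : {z : Amb n // z.1 ≠ 0} => revolutionInv z.1 :=
    (Real.continuous_exp.comp (continuous_snd.comp continuous_subtype_val)).smul
      (((continuous_fst.comp continuous_subtype_val).norm.inv₀ fun z =>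
        norm_ne_zero_iff.2 z.2).smul (continuous_fst.comp continuous_subtype_val))
  have h1 : IsEmbedding ((fun z : {z : Amb n // z.1 ≠ 0} => revolutionInv z.1) ∘ X') := by
    have h2 : (fun z : {z : Amb n // z.1 ≠ 0} => revolutionInv z.1) ∘ X' = Subtype.val :=
      funext fun y => revolutionInv_revolutionMap hf0 y.2
    rw [h2]
    exact IsEmbedding.subtypeVal
  exact IsEmbedding.subtypeVal.comp (IsEmbedding.of_comp hX' hinv h1)

/-- A sequence converging inside the open ball has radii bounded away from one, so its heights lie
in a closed sublevel set of `f`. The limit height therefore stays in `I`, where `f` is continuous.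
-/
theorem closure_rotHypersurface_inter_hypProd (hI : IsOpen I) (hf : ContDiffOn ℝ ∞ f I)
    (hf0 : ∀ t ∈ I, 0 < f t) (hcl : ∀ R, IsClosed {t | t ∈ I ∧ f t ≤ R}) :
    closure (rotHypersurface n I f) ∩ hypProd n ⊆ rotHypersurface n I f := by
  rw [rotHypersurface_eq hf0]
  rintro z ⟨hz, hz1⟩
  have hz1 : ‖z.1‖ < 1 := hz1
  obtain ⟨c, hc1, hc2⟩ := exists_between hz1
  have hc0 : 0 < c := (norm_nonneg _).trans_lt hc1
  -- Hyperbolic radius of the Euclidean sphere of radius `c`.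
  set R := 2 * Real.artanh c with hR
  have hRc : Real.tanh (R / 2) = c := by
    rw [hR, mul_div_cancel_left₀ _ two_ne_zero, Real.tanh_artanh ⟨by linarith, hc2⟩]
  obtain ⟨u, hu, hlim⟩ := mem_closure_iff_seq_limit.1 hz
  have h1 : ∀ᶠ i in atTop, (u i).2 ∈ {t | t ∈ I ∧ f t ≤ R} := by
    filter_upwards [(continuous_fst.norm.tendsto z).comp hlim |>.eventually (gt_mem_nhds hc1)]
      with i hi
    refine ⟨(hu i).1, ?_⟩
    simp only [Function.comp_apply] at hi
    rw [(hu i).2, ← hRc] at hi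
    by_contra hlt
    exact absurd hi (not_lt.2 (strictMono_tanh.monotone (by linarith)))
  have h2 : z.2 ∈ {t | t ∈ I ∧ f t ≤ R} :=
    (hcl R).mem_of_tendsto ((continuous_snd.tendsto z).comp hlim) h1
  refine ⟨h2.1, ?_⟩
  have h3 : ContinuousAt f z.2 := (hf.contDiffAt (hI.mem_nhds h2.1)).continuousAt
  have h4 : Tendsto (fun i => Real.tanh (f (u i).2 / 2)) atTop (𝓝 (Real.tanh (f z.2 / 2))) :=
    ((contDiff_tanh.continuous.tendsto _).comp ((h3.tendsto.comp
      ((continuous_snd.tendsto z).comp hlim)).div_const 2))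
  exact tendsto_nhds_unique ((continuous_fst.norm.tendsto z).comp hlim)
    (h4.congr fun i => ((hu i).2).symm)

/-- A rotational hypersurface whose profile solves the `r`-minimal equation and leaves every
compact set is a complete embedded `r`-minimal hypersurface. -/
theorem isEmbeddedCompleteRotationalRMinimal_rotHypersurface (hn : 2 ≤ n) {r : ℕ}
    (hr : r + 1 ≤ n) (hI : IsOpen I) (hIc : I.OrdConnected) (hne : I.Nonempty)
    (hf : ContDiffOn ℝ ∞ f I) (hf0 : ∀ t ∈ I, 0 < f t)
    (hcl : ∀ R, IsClosed {t | t ∈ I ∧ f t ≤ R})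
    (hode : ∀ t ∈ I, ((r : ℝ) + 1) * deriv (deriv f) t
      = ((n : ℝ) - r - 1) * (Real.cosh (f t) / Real.sinh (f t)) * (1 + deriv f t ^ 2)) :
    IsEmbeddedCompleteRotationalRMinimal r (rotHypersurface n I f) := by
  let U : TopologicalSpace.Opens (EuclideanSpace ℝ (Fin n)) := ⟨shell n I, isOpen_shell hI⟩
  have hF : ContDiffOn ℝ ∞ (revolutionMap n f) U := fun y hy =>
    (contDiffAt_revolutionMap hI hf hy).contDiffWithinAt
  have himm : IsImmersedHypersurface fun y : U => revolutionMap n f y :=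
    isImmersedHypersurface_opens hF (fun y hy => revolutionMap_mem_hypProd hf0 hy)
      fun y hy => injective_fderiv_revolutionMap hI hf hf0 hy
  have hrange : range (fun y : U => revolutionMap n f y) = rotHypersurface n I f := by
    rw [← image_revolutionMap, image_eq_range]
    rfl
  have hemb : IsEmbedding fun y : U => revolutionMap n f y := isEmbedding_revolutionMap hI hf hf0
  have hconn : ConnectedSpace U := isConnected_iff_connectedSpace.1 (isConnected_shell hn hIc hne)
  refine ⟨U, inferInstance, inferInstance, inferInstance, inferInstance, inferInstance, hconn,
    fun y => revolutionMap n f y, ⟨himm, ?_, ?_, ?_⟩, hemb, hrange⟩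
  · refine isCompleteHypersurface_of_isEmbedding himm.contMDiff himm.mem_hypProd hemb ?_
    rw [hrange]
    exact closure_rotHypersurface_inter_hypProd hI hf hf0 hcl
  · intro y N A hN hA
    refine meanCurv_revolutionMap hr hI hf hf0 hode y.2 (N := N) (fun N' h1 h2 => ?_) fun a b => ?_
    · refine IsUnitNormal.eq_or_eq_neg himm (N := N') ⟨h2, fun a => ?_⟩ hN
      rw [chartDiff_opens]
      exact h1 a
    · have := hA a b
      rwa [secondForm_opens, chartDiff_opens] at this
  · rw [hrange, rotHypersurface_eq hf0]
    rintro B - p ⟨h1, h2⟩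
    exact ⟨h1, by simpa using h2⟩

end Embedded

/-! ### Geometry of the individual members. -/

section Members

variable {n : ℕ}

theorem tendsto_tanh_atTop : Tendsto Real.tanh atTop (𝓝 1) := by
  refine tendsto_order.2 ⟨fun c hc => ?_,
    fun c hc => Eventually.of_forall fun x => (Real.tanh_lt_one x).trans hc⟩
  have h1 : max c 0 ∈ Ioo (-1 : ℝ) 1 :=
    ⟨by linarith [le_max_right c 0], max_lt hc one_pos⟩
  filter_upwards [eventually_gt_atTop (Real.artanh (max c 0))] with x hx
  have h2 := strictMono_tanh hx
  rw [Real.tanh_artanh h1] at h2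
  exact (le_max_left _ _).trans_lt h2

theorem mem_rotHypersurface {I : Set ℝ} {f : ℝ → ℝ} (hf : ∀ t ∈ I, 0 < f t) {p : Amb n} :
    p ∈ rotHypersurface n I f ↔ p.2 ∈ I ∧ ‖p.1‖ = Real.tanh (f p.2 / 2) := by
  rw [rotHypersurface_eq hf]
  rfl

theorem cylinder_eq_rotHypersurface {R : ℝ} (hR : 0 < R) :
    cylinder n R = rotHypersurface n univ fun _ => R := by
  rw [rotHypersurface_eq fun _ _ => hR]
  simp [cylinder]

theorem isEmbeddedCompleteRotationalRMinimal_cylinder {r : ℕ} (hn : 2 ≤ n) (hr : n = r + 1)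
    {R : ℝ} (hR : 0 < R) : IsEmbeddedCompleteRotationalRMinimal r (cylinder n R) := by
  rw [cylinder_eq_rotHypersurface hR]
  refine isEmbeddedCompleteRotationalRMinimal_rotHypersurface hn hr.ge isOpen_univ
    ordConnected_univ univ_nonempty contDiffOn_const (fun _ _ => hR)
    (fun R' => by simp only [mem_univ, true_and]; exact isClosed_const)
    fun t _ => ?_
  rw [hr]
  simp

/-- A rotational hypersurface is homeomorphic to the product of a sphere and an interval. -/
noncomputable def rotHypersurfaceHomeomorph {I : Set ℝ} {f : ℝ → ℝ} (hf : ContinuousOn f I)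
    (hf0 : ∀ t ∈ I, 0 < f t) :
    rotHypersurface n I f ≃ₜ Metric.sphere (0 : EuclideanSpace ℝ (Fin n)) 1 × I where
  toFun p := (⟨‖p.1.1‖⁻¹ • p.1.1, by
    have h := (mem_rotHypersurface hf0).1 p.2
    rw [mem_sphere_zero_iff_norm, norm_smul, norm_inv, norm_norm, inv_mul_cancel₀]
    rw [h.2]
    exact (tanh_mem_Ioo_of_pos (half_pos (hf0 _ h.1))).1.ne'⟩, ⟨p.1.2, p.2.1⟩)
  invFun q := ⟨(Real.tanh (f q.2 / 2) • q.1.1, q.2), q.2.2, q.1.1,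
    mem_sphere_zero_iff_norm.1 q.1.2, rfl⟩
  left_inv p := by
    have h := (mem_rotHypersurface hf0).1 p.2
    refine Subtype.ext (Prod.ext ?_ rfl)
    simp only
    rw [← h.2, smul_smul, mul_inv_cancel₀, one_smul]
    rw [h.2]
    exact (tanh_mem_Ioo_of_pos (half_pos (hf0 _ h.1))).1.ne'
  right_inv q := by
    have h0 := (tanh_mem_Ioo_of_pos (half_pos (hf0 _ q.2.2))).1
    refine Prod.ext (Subtype.ext ?_) rfl
    simp only
    rw [norm_smul, mem_sphere_zero_iff_norm.1 q.1.2, mul_one, Real.norm_eq_abs, abs_of_pos h0,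
      smul_smul, inv_mul_cancel₀ h0.ne', one_smul]
  continuous_toFun := by
    have h1 : Continuous fun p : rotHypersurface n I f => p.1.1 :=
      continuous_fst.comp continuous_subtype_val
    have h2 : Continuous fun p : rotHypersurface n I f => p.1.2 :=
      continuous_snd.comp continuous_subtype_val
    refine Continuous.prodMk (Continuous.subtype_mk (Continuous.smul (h1.norm.inv₀ fun p => ?_) h1) _)
      (h2.subtype_mk _)
    have h := (mem_rotHypersurface hf0).1 p.2
    rw [h.2]
    exact (tanh_mem_Ioo_of_pos (half_pos (hf0 _ h.1))).1.ne'
  continuous_invFun := by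
    have h1 : Continuous fun t : I => f t := continuousOn_iff_continuous_domRestrict.1 hf
    refine Continuous.subtype_mk (Continuous.prodMk (Continuous.smul
      (contDiff_tanh.continuous.comp ((h1.comp continuous_snd).div_const 2))
      (continuous_subtype_val.comp continuous_fst)) (continuous_subtype_val.comp continuous_snd)) _

theorem nonempty_Ioo_homeomorph {L : ℝ} (hL : 0 < L) : Nonempty (Ioo (-L) L ≃ₜ ℝ) := by
  refine ⟨(Homeomorph.symm ?_).trans (orderIsoIooNegOneOne ℝ).toHomeomorph.symm⟩
  refine (Homeomorph.mulLeft₀ L hL.ne').subtype fun x => ?_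
  simp only [mem_Ioo, Homeomorph.coe_mulLeft₀]
  constructor <;> rintro ⟨h1, h2⟩ <;> constructor <;> nlinarith

/-- At a limit height inside the interval `f` is finite and continuous, so the limiting radius is
less than one. At the ends the closed sublevel sets force `f → ∞`, so along a fixed direction the
radius tends to one. -/
theorem asymptoticBoundary_rotHypersurface {L : ℝ} {f : ℝ → ℝ} (hL : 0 < L)
    (hf : ContinuousOn f (Ioo (-L) L)) (hf0 : ∀ t ∈ Ioo (-L) L, 0 < f t)
    (heven : ∀ t, f (-t) = f t) (hcl : ∀ R, IsClosed {t | t ∈ Ioo (-L) L ∧ f t ≤ R}) :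
    asymptoticBoundary (rotHypersurface n (Ioo (-L) L) f)
      = {p | ‖p.1‖ = 1 ∧ (p.2 = L ∨ p.2 = -L)} := by
  ext p
  refine and_congr_right fun hp => ⟨fun h => ?_, fun h => ?_⟩
  · rw [rotHypersurface_eq hf0] at h
    obtain ⟨u, hu, hlim⟩ := mem_closure_iff_seq_limit.1 h
    have hlim2 : Tendsto (fun i => (u i).2) atTop (𝓝 p.2) := (continuous_snd.tendsto p).comp hlim
    have h1 : p.2 ∈ Icc (-L) L :=
      isClosed_Icc.mem_of_tendsto hlim2 (Eventually.of_forall fun i => Ioo_subset_Icc_self (hu i).1)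
    by_contra hne
    push Not at hne
    have h2 : p.2 ∈ Ioo (-L) L :=
      ⟨lt_of_le_of_ne h1.1 hne.2.symm, lt_of_le_of_ne h1.2 hne.1⟩
    have h3 : ContinuousAt f p.2 := hf.continuousAt (isOpen_Ioo.mem_nhds h2)
    have h4 : Tendsto (fun i => Real.tanh (f (u i).2 / 2)) atTop (𝓝 (Real.tanh (f p.2 / 2))) :=
      (contDiff_tanh.continuous.tendsto _).comp ((h3.tendsto.comp hlim2).div_const 2)
    have h5 := tendsto_nhds_unique ((continuous_fst.norm.tendsto p).comp hlim)
      (h4.congr fun i => ((hu i).2).symm)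
    rw [hp] at h5
    exact (Real.tanh_lt_one _).ne h5.symm
  · have hmem : Ioo (-L) L ∈ 𝓝[<] L := Ioo_mem_nhdsLT (by linarith)
    have h1 : Tendsto f (𝓝[<] L) atTop := by
      refine tendsto_atTop.2 fun R => ?_
      have h2 := (hcl R).isOpen_compl.mem_nhds (x := L) fun h => lt_irrefl _ h.1.2
      filter_upwards [mem_nhdsWithin_of_mem_nhds h2, hmem] with t h3 h4
      by_contra h5
      exact h3 ⟨h4, (not_le.1 h5).le⟩
    have h2 : Tendsto (fun t => Real.tanh (f t / 2)) (𝓝[<] L) (𝓝 1) :=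
      tendsto_tanh_atTop.comp (h1.atTop_div_const two_pos)
    have h3 : Tendsto (fun t : ℝ => t) (𝓝[<] L) (𝓝 L) := tendsto_id.mono_left nhdsWithin_le_nhds
    rcases h with h | h
    · have h4 : Tendsto (fun t => ((Real.tanh (f t / 2) • p.1, t) : Amb n)) (𝓝[<] L) (𝓝 p) := by
        have := (h2.smul_const p.1).prodMk_nhds h3
        rwa [one_smul, show (p.1, L) = p from Prod.ext rfl h.symm] at this
      refine mem_closure_of_tendsto h4 ?_
      filter_upwards [hmem] with t ht
      exact ⟨ht, p.1, hp, rfl⟩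
    · have h4 : Tendsto (fun t => ((Real.tanh (f t / 2) • p.1, -t) : Amb n)) (𝓝[<] L) (𝓝 p) := by
        have := (h2.smul_const p.1).prodMk_nhds h3.neg
        rwa [one_smul, show (p.1, -L) = p from Prod.ext rfl h.symm] at this
      refine mem_closure_of_tendsto h4 ?_
      filter_upwards [hmem] with t ht
      exact ⟨⟨by linarith [ht.2], by linarith [ht.1]⟩, p.1, hp, by simp only; rw [heven]⟩

variable {P a : ℝ}

theorem isEmbeddedCompleteRotationalRMinimal_catenoid {r : ℕ} (hn : 2 ≤ n) (hr : r + 1 ≤ n)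
    (hP : P = ((r : ℝ) + 1) / ((n : ℝ) - r - 1)) (hP0 : 0 < P) (ha : 0 < a) :
    IsEmbeddedCompleteRotationalRMinimal r
      (rotHypersurface n (Ioo (-halfHeight P a) (halfHeight P a)) (profile P a)) := by
  have hL := halfHeight_pos hP0 ha
  refine isEmbeddedCompleteRotationalRMinimal_rotHypersurface hn hr isOpen_Ioo
    ordConnected_Ioo ⟨0, by linarith, hL⟩ (contDiffOn_profile hP0 ha)
    (fun t ht => profile_pos hP0 ha ht) (isClosed_profile_le hP0 ha) fun t ht => ?_
  have hnr : (n : ℝ) - r - 1 ≠ 0 := by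
    rintro h
    rw [h, div_zero] at hP
    exact hP0.ne' hP
  have hr1 : (r : ℝ) + 1 ≠ 0 := by positivity
  have hs := (Real.sinh_pos_iff.2 (profile_pos hP0 ha ht)).ne'
  rw [(hasDerivAt_deriv_profile hP0 ha ht).deriv, hP]
  field_simp

theorem axisDist_of_mem_rotHypersurface {I : Set ℝ} {f : ℝ → ℝ} (hf0 : ∀ t ∈ I, 0 < f t)
    {p : Amb n} (hp : p ∈ rotHypersurface n I f) : axisDist p = ENNReal.ofReal (f p.2) := by
  rw [rotHypersurface_eq hf0] at hp
  have h := hf0 _ hp.1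
  refine axisDist_eq ?_ h hp.2
  rw [← norm_pos_iff, hp.2]
  exact (tanh_mem_Ioo_of_pos (half_pos h)).1

theorem exists_generatingCurve_inter_eq {b : ℝ} (hP0 : 0 < P) (ha : 0 < a) (hb : 0 < b)
    (hab : a ≠ b) : ∃ ρ t, 0 < t ∧
      generatingCurve (Ioo (-halfHeight P a) (halfHeight P a)) (profile P a)
        ∩ generatingCurve (Ioo (-halfHeight P b) (halfHeight P b)) (profile P b)
        = {(ρ, t), (ρ, -t)} := by
  wlog h : a < b generalizing a b
  · obtain ⟨ρ, t, ht, heq⟩ := this hb ha hab.symm (lt_of_le_of_ne (not_lt.1 h) hab.symm)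
    exact ⟨ρ, t, ht, by rw [inter_comm, heq]⟩
  obtain ⟨t₀, ht₀, hiff⟩ := exists_unique_crossing hP0 ha h
  have hLL := strictMonoOn_halfHeight hP0 ha hb h
  have hsub : Ioo (-halfHeight P a) (halfHeight P a) ⊆ Ioo (-halfHeight P b) (halfHeight P b) :=
    Ioo_subset_Ioo (by linarith) hLL.le
  have hpos : t₀ ∈ Ioo (-halfHeight P a) (halfHeight P a) := ⟨by linarith [ht₀.1, ht₀.2], ht₀.2⟩
  have hneg : -t₀ ∈ Ioo (-halfHeight P a) (halfHeight P a) :=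
    ⟨by linarith [ht₀.2], by linarith [ht₀.1, ht₀.2]⟩
  refine ⟨profile P a t₀, t₀, ht₀.1, Subset.antisymm ?_ ?_⟩
  · rintro ⟨ρ, t⟩ ⟨⟨h1, h2⟩, -, h3⟩
    simp only at h1 h2 h3
    rcases (hiff t h1).1 (h2.symm.trans h3) with rfl | rfl
    · left; rw [h2]
    · right; rw [h2, profile_neg hP0 ha]; rfl
  · rintro z (rfl | rfl)
    · exact ⟨⟨hpos, rfl⟩, hsub hpos, (hiff t₀ hpos).2 (Or.inl rfl)⟩
    · refine ⟨⟨hneg, (profile_neg hP0 ha t₀).symm⟩, hsub hneg, ?_⟩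
      change profile P a t₀ = profile P b (-t₀)
      rw [profile_neg hP0 hb]
      exact (hiff t₀ hpos).2 (Or.inl rfl)

end Members

/-! ### Assembly of the theorem. -/

theorem theorem1 (n r : ℕ) (hn : 2 ≤ n) (hr : r + 1 ≤ n) :
    (n = r + 1 →
      (∀ (M : Type*) [TopologicalSpace M] [ChartedSpace (EuclideanSpace ℝ (Fin n)) M]
          [IsManifold (𝓡 n) ∞ M] [T2Space M] [SecondCountableTopology M] [ConnectedSpace M]
          (X : M → Amb n), IsCompleteRotationalRMinimal r X →
          (¬ ∃ τ, range X = slice n τ) → ∃ R, 0 < R ∧ range X = cylinder n R) ∧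
      (∀ R, 0 < R → IsEmbeddedCompleteRotationalRMinimal r (cylinder n R))) ∧
    (r + 1 < n →
      ∃ (𝓜 : ℝ → Set (Amb n)) (f : ℝ → ℝ → ℝ) (L : ℝ → ℝ),
        -- every complete example other than a slice is a vertical translate of a member
        (∀ (M : Type*) [TopologicalSpace M] [ChartedSpace (EuclideanSpace ℝ (Fin n)) M]
          [IsManifold (𝓡 n) ∞ M] [T2Space M] [SecondCountableTopology M] [ConnectedSpace M]
          (X : M → Amb n), IsCompleteRotationalRMinimal r X →
          (¬ ∃ τ, range X = slice n τ) →
            ∃ a τ, 0 < a ∧ range X = verticalTranslate τ (𝓜 a)) ∧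
        (∀ a, 0 < a →
          -- the member with parameter `a` and its generating curve
          (ContDiffOn ℝ ∞ (f a) (Ioo (-L a) (L a)) ∧ (∀ t ∈ Ioo (-L a) (L a), 0 < f a t) ∧
            𝓜 a = rotHypersurface n (Ioo (-L a) (L a)) (f a)) ∧
          IsEmbeddedCompleteRotationalRMinimal r (𝓜 a) ∧
          -- it is an annulus, symmetric with respect to `t = 0`
          Nonempty (𝓜 a ≃ₜ Metric.sphere (0 : EuclideanSpace ℝ (Fin n)) 1 × ℝ) ∧
          (∀ x t, (x, t) ∈ 𝓜 a → (x, -t) ∈ 𝓜 a) ∧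
          -- its neck lies in the slice `t = 0`, at distance `a` from the axis
          ((𝓜 a ∩ slice n 0).Nonempty ∧ (∀ p ∈ 𝓜 a, ENNReal.ofReal a ≤ axisDist p) ∧
            ∀ p ∈ 𝓜 a, axisDist p = ENNReal.ofReal a ↔ p.2 = 0) ∧
          -- its asymptotic boundary
          asymptoticBoundary (𝓜 a) = {p | ‖p.1‖ = 1 ∧ (p.2 = L a ∨ p.2 = -L a)}) ∧
        -- the vertical distance between the two boundary circles
        StrictMonoOn (fun a => 2 * L a) (Ioi 0) ∧
        (fun a => 2 * L a) '' Ioi 0 = Ioo 0 (((r : ℝ) + 1) * Real.pi / ((n : ℝ) - r - 1)) ∧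
        -- two distinct generating curves
        (∀ a b, 0 < a → 0 < b → a ≠ b → ∃ ρ t, 0 < t ∧
          generatingCurve (Ioo (-L a) (L a)) (f a) ∩ generatingCurve (Ioo (-L b) (L b)) (f b)
            = {(ρ, t), (ρ, -t)})) := by
  refine ⟨fun h => ⟨?_, fun R hR => isEmbeddedCompleteRotationalRMinimal_cylinder hn h hR⟩,
    fun h => ?_⟩
  · intro M _ _ _ _ _ _ X hX hslice
    exact exists_range_eq_cylinder hn h hX hslice
  have hnr : 0 < (n : ℝ) - r - 1 := by
    have : ((r + 1 : ℕ) : ℝ) < n := by exact_mod_cast h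
    push_cast at this; linarith
  -- The exponent of the cosine in the first integral. Half heights range over `(0, P π / 2)`, so
  -- the distance between the boundary circles ranges over `(0, P π)`.
  obtain ⟨P, hP⟩ : ∃ P, P = ((r : ℝ) + 1) / ((n : ℝ) - r - 1) := ⟨_, rfl⟩
  have hP0 : 0 < P := hP ▸ div_pos (by positivity) hnr
  refine ⟨fun a => rotHypersurface n (Ioo (-halfHeight P a) (halfHeight P a)) (profile P a),
    profile P, halfHeight P, ?_, fun a ha => ?_, ?_, ?_, fun a b ha hb hab =>
      exists_generatingCurve_inter_eq hP0 ha hb hab⟩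
  · intro M _ _ _ _ _ _ X hX hslice
    exact exists_range_eq_catenoid hn h hX hslice hP
  · have hL := halfHeight_pos hP0 ha
    have hf := contDiffOn_profile hP0 ha
    have hf0 : ∀ t ∈ Ioo (-halfHeight P a) (halfHeight P a), 0 < profile P a t :=
      fun t ht => profile_pos hP0 ha ht
    have hdist := fun p hp => axisDist_of_mem_rotHypersurface (n := n) (p := p) hf0 hp
    refine ⟨⟨hf, hf0, rfl⟩, isEmbeddedCompleteRotationalRMinimal_catenoid hn hr hP hP0 ha,
      ?_, ?_, ⟨?_, ?_, ?_⟩, asymptoticBoundary_rotHypersurface hL hf.continuousOn hf0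
        (profile_neg hP0 ha) (isClosed_profile_le hP0 ha)⟩
    · obtain ⟨e⟩ := nonempty_Ioo_homeomorph hL
      exact ⟨(rotHypersurfaceHomeomorph hf.continuousOn hf0).trans
        ((Homeomorph.refl _).prodCongr e)⟩
    · rintro x t ⟨ht, ζ, hζ, hx⟩
      refine ⟨⟨by simpa using ht.2, by simpa using neg_lt.1 ht.1⟩, ζ, hζ, ?_⟩
      simp only at hx ⊢
      rw [profile_neg hP0 ha, hx]
    · have h0 : (0 : ℝ) ∈ Ioo (-halfHeight P a) (halfHeight P a) := ⟨by linarith, hL⟩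
      obtain ⟨ζ, hζ⟩ : ∃ ζ : EuclideanSpace ℝ (Fin n), ‖ζ‖ = 1 :=
        ⟨EuclideanSpace.single ⟨0, by omega⟩ 1, by simp⟩
      refine ⟨(Real.tanh (profile P a 0 / 2) • ζ, 0), ⟨h0, ζ, hζ, rfl⟩, ?_, rfl⟩
      have h1 := tanh_mem_Ioo_of_pos (half_pos (hf0 0 h0))
      change ‖Real.tanh (profile P a 0 / 2) • ζ‖ < 1
      rw [norm_smul, hζ, mul_one, Real.norm_eq_abs, abs_of_pos h1.1]
      exact h1.2
    · intro p hp
      rw [hdist p hp]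
      exact ENNReal.ofReal_le_ofReal (le_profile hP0 ha hp.1)
    · intro p hp
      rw [hdist p hp, ENNReal.ofReal_eq_ofReal_iff (hf0 _ hp.1).le ha.le,
        profile_eq_iff hP0 ha hp.1]
  · intro a ha b hb hab
    exact mul_lt_mul_of_pos_left (strictMonoOn_halfHeight hP0 ha hb hab) two_pos
  · have h1 : (fun a => 2 * halfHeight P a) '' Ioi 0
        = (fun x => 2 * x) '' (halfHeight P '' Ioi 0) := by rw [image_image]
    rw [h1, range_halfHeight hP0, image_mul_left_Ioo two_pos, mul_zero]
    congr 1
    rw [hP]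
    field_simp
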